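/- Let $d\in\{2,3\}$, let $Y=(0,1]^d$, and let $D\subset\mathbb{R}^d$ be a nonempty open set (a union of inclusions) with $\overline D\subset \operatorname{int} Y$ and with boundary of class $C^{1,\gamma}$ for some $\gamma>0$. Let $L^2_0(Y)$ be the space of complex square integrable functions on $Y$ with zero mean, with $(u,v)=\int_Y u\overline v\,dx$, and let $\mathcal H=\{u\in H^1(Y):\int_Y u\,dx=0\}$ with $\langle u,v\rangle=\int_Y\nabla u\cdot\nabla\overline v\,dx$. For $k\in\mathbb{C}$ put $$B_k(u,v)=k\int_{Y\setminus D}\nabla u\cdot\nabla\overline v\,dx+\int_D\nabla u\cdot\nabla\overline v\,dx ,\qquad u,v\in\mathcal H,$$ let $T_k:\mathcal H\to\mathcal H$ be the operator given by $\langle T_ku,v\rangle=B_k(u,v)$, and let $(-\Delta_N)^{-1}:L^2_0(Y)\to\mathcal H$ be the operator given by $\langle(-\Delta_N)^{-1}f,v\rangle=(f,v)$ for all $v\in\mathcal H$. A number $\nu\in\mathbb{C}$ is a Neumann eigenvalue of $-\nabla\cdot(k(1-\chi_D)+\chi_D)\nabla$ on $Y$ if there is $u\in\mathcal H$, $u\neq0$,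 with $B_k(u,v)=\nu\,(u,v)$ for all $v\in\mathcal H$; such $u$ (and $0$) form its eigenspace. Let $W_1\subset\mathcal H$ be the closure of the functions in $\mathcal H$ with support away from $D$ (vanishing in a neighbourhood of $\overline D$), let $W_2=\{\tilde u-(\int_D\tilde u\,dx)1_Y:\tilde u\in H^1_0(D)\text{ extended by }0\}$, and let $W_3=(W_1\oplus W_2)^\perp$ in $\mathcal H$. Let $\{\mu_i\}\subset\mathbb{R}$ be the eigenvalues of the operator $T$ on $W_3$ given by $\langle Tu,v\rangle=\frac12\int_{Y\setminus D}\nabla u\cdot\nabla\overline v\,dx-\frac12\int_D\nabla u\cdot\nabla\overline v\,dx$, and let $$Z=\Big\{\frac{\mu_i-1/2}{\mu_i+1/2}:\ \mu_i\neq-\tfrac12\Big\}\cup\{-1\},$$ where $-1$ corresponds to the accumulation point $0$ of the $\mu_i$. Then $Z\subset(-\infty,0]$, the operators $T_k$ ($k\in\mathbb{C}$) and $(-\Delta_N)^{-1}$ exist as bounded operators and are unique, and for every $k\in\mathbb{C}\setminus Z$ the following holds. The operator $T_k$ is invertible, with bounded inverse. The operator $B(k)=T_k^{-1}(-\Delta_N)^{-1}$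 is compact on $L^2_0(Y)$ and depends holomorphically on $k\in\mathbb{C}\setminus Z$. For $\nu\neq0$, the eigenspace of the Neumann problem for $\nu$ equals the eigenspace of $B(k)$ for $\nu^{-1}$, and all eigenspaces of the Neumann problem are finite dimensional. There is a sequence $(\gamma_j(k))_{j\in\mathbb{N}}$ in $\mathbb{C}$ with non-increasing moduli and $\gamma_j(k)\to0$ such that the spectrum of $B(k)$ is $\{0\}\cup\{\gamma_j(k):j\in\mathbb{N}\}$ and each nonzero number $g$ occurs in the sequence as often as its algebraic multiplicity as an eigenvalue of $B(k)$, which is finite (zero if $g$ is not an eigenvalue; the sequence ends in zeros if there are only finitely many nonzero eigenvalues). The Neumann eigenvalues are exactly the numbers $\nu_j(k)=\gamma_j(k)^{-1}$ with $\gamma_j(k)\neq0$. If $k>0$, then all $\gamma_j(k)$ are positive, so that the Neumann eigenvalues form an infinite sequence $0<\nu_1(k)\le\nu_2(k)\le\cdots$. -/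

import Mathlib

open MeasureTheory Filter Topology
open scoped ContDiff NNReal ENNReal

noncomputable section

namespace NeumannCell

/-- The unit period cell `Y = (0,1]^d`. -/
def unitCell (d : ℕ) : Set (EuclideanSpace ℝ (Fin d)) := {x | ∀ i, x i ∈ Set.Ioc (0 : ℝ) 1}

/-- Lebesgue measure on the period cell. -/
abbrev cellMeasure (d : ℕ) : Measure (EuclideanSpace ℝ (Fin d)) := volume.restrict (unitCell d)

theorem isFiniteMeasure_cellMeasure (d : ℕ) : IsFiniteMeasure (cellMeasure d) := by
  refine ⟨?_⟩
  rw [Measure.restrict_apply_univ]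
  have hb : Bornology.IsBounded (unitCell d) := by
    rw [isBounded_iff_forall_norm_le]
    refine ⟨√(d : ℝ), fun x hx => ?_⟩
    rw [EuclideanSpace.norm_eq]
    apply Real.sqrt_le_sqrt
    calc ∑ i, ‖x i‖ ^ 2 ≤ ∑ _i : Fin d, (1 : ℝ) := by
          apply Finset.sum_le_sum
          intro i _
          have h := hx i
          rw [Real.norm_eq_abs, sq_abs]
          nlinarith [h.1, h.2]
      _ = d := by simp
  exact hb.measure_lt_top

/-- An open set is locally, up to a rigid motion, the region below the graph of a `C^{1,γ}`
function. The graph is taken in the direction of a unit vector `e`; the graph function `g` is a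
function of the component of `x` orthogonal to `e`, i.e. it is invariant under translation
along `e`. -/
def HasHolderBoundary {d : ℕ} (γ : ℝ≥0) (D : Set (EuclideanSpace ℝ (Fin d))) : Prop :=
  ∀ p ∈ frontier D, ∃ (e : EuclideanSpace ℝ (Fin d)) (r : ℝ) (g : EuclideanSpace ℝ (Fin d) → ℝ),
    ‖e‖ = 1 ∧ 0 < r ∧ (∀ x, ∀ t : ℝ, g (x + t • e) = g x) ∧ ContDiff ℝ 1 g ∧
    (∃ C : ℝ≥0, HolderWith C γ (fderiv ℝ g)) ∧
    ∀ x ∈ Metric.ball p r, (x ∈ D ↔ inner ℝ e x < g x)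

/-- The union `D` of the inclusions: a nonempty open set, staying away from the boundary of the
period cell, with boundary of class `C^{1,γ}` for some `γ > 0`. (By compactness of its boundary,
such a set has finitely many components, and these have disjoint closures.) -/
structure IsInclusionDomain {d : ℕ} (D : Set (EuclideanSpace ℝ (Fin d))) : Prop where
  isOpen : IsOpen D
  nonempty : D.Nonempty
  closure_subset : closure D ⊆ interior (unitCell d)
  holder_boundary : ∃ γ : ℝ≥0, 0 < γ ∧ HasHolderBoundary γ D

/-- Square integrable complex valued functions on the cell. -/
abbrev L2 (d : ℕ) : Type := Lp ℂ 2 (cellMeasure d)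

/-- Square integrable complex vector fields on the cell. -/
abbrev L2Vec (d : ℕ) : Type := Lp (EuclideanSpace ℂ (Fin d)) 2 (cellMeasure d)

/-- `g` is the weak gradient of `u` in the (interior of the) cell. -/
def IsWeakGradient {d : ℕ} (u : L2 d) (g : L2Vec d) : Prop :=
  ∀ φ : EuclideanSpace ℝ (Fin d) → ℝ, ContDiff ℝ ∞ φ → HasCompactSupport φ →
    tsupport φ ⊆ interior (unitCell d) → ∀ i : Fin d,
      ∫ x in unitCell d, (fderiv ℝ φ x (EuclideanSpace.single i 1)) • u x =
        - ∫ x in unitCell d, φ x • g x i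

theorem integrable_smul_of_test {d : ℕ} {φ : EuclideanSpace ℝ (Fin d) → ℝ} (hφ : Continuous φ)
    (hc : HasCompactSupport φ) {u : EuclideanSpace ℝ (Fin d) → ℂ}
    (hu : MemLp u 2 (cellMeasure d)) : Integrable (fun x => φ x • u x) (cellMeasure d) := by
  have h1 : MemLp φ 2 (cellMeasure d) := hφ.memLp_of_hasCompactSupport hc
  exact (memLp_one_iff_integrable.1 (hu.smul (p := 2) (q := 2) (r := 1) h1))

theorem integrable_fderiv_smul {d : ℕ} {φ : EuclideanSpace ℝ (Fin d) → ℝ} (hφ : ContDiff ℝ ∞ φ)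
    (hc : HasCompactSupport φ) (i : Fin d) (u : L2 d) :
    Integrable (fun x => (fderiv ℝ φ x (EuclideanSpace.single i 1)) • u x) (cellMeasure d) := by
  refine integrable_smul_of_test
    (φ := fun x => fderiv ℝ φ x (EuclideanSpace.single i 1)) ?_ ?_ (Lp.memLp u)
  · exact (hφ.continuous_fderiv (by simp)).clm_apply continuous_const
  · exact hc.fderiv_apply (𝕜 := ℝ) _

theorem integrable_smul_coord {d : ℕ} {φ : EuclideanSpace ℝ (Fin d) → ℝ} (hφ : ContDiff ℝ ∞ φ)
    (hc : HasCompactSupport φ) (i : Fin d) (g : L2Vec d) :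
    Integrable (fun x => φ x • g x i) (cellMeasure d) := by
  refine integrable_smul_of_test hφ.continuous hc ?_
  exact (EuclideanSpace.proj (𝕜 := ℂ) i).comp_memLp' (Lp.memLp g)

/-- The Sobolev space `H¹(Y)`: pairs of an `L²` function and its weak gradient, with the usual
`H¹` inner product, inherited from `L² × L²`. -/
def H1 (d : ℕ) : Submodule ℂ (WithLp 2 (L2 d × L2Vec d)) where
  carrier := {w | IsWeakGradient w.fst w.snd}
  zero_mem' := by
    intro φ _ _ _ i
    have h1 := Lp.coeFn_zero ℂ 2 (cellMeasure d)
    have h2 := Lp.coeFn_zero (EuclideanSpace ℂ (Fin d)) 2 (cellMeasure d)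
    have e1 : ∫ x in unitCell d, (fderiv ℝ φ x (EuclideanSpace.single i 1)) •
        (0 : L2 d) x = 0 := by
      refine integral_eq_zero_of_ae ?_
      filter_upwards [h1] with x hx
      simp only [hx, Pi.zero_apply, smul_zero]
    have e2 : ∫ x in unitCell d, φ x • (0 : L2Vec d) x i = 0 := by
      refine integral_eq_zero_of_ae ?_
      filter_upwards [h2] with x hx
      simp only [hx, Pi.zero_apply, PiLp.zero_apply, smul_zero]
    simp only [WithLp.zero_fst, WithLp.zero_snd, e1, e2, neg_zero]
  add_mem' := by
    intro v w hv hw φ h1 h2 h3 i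
    have e1 : ∫ x in unitCell d, (fderiv ℝ φ x (EuclideanSpace.single i 1)) •
        (v.fst + w.fst : L2 d) x =
        (∫ x in unitCell d, (fderiv ℝ φ x (EuclideanSpace.single i 1)) • v.fst x) +
        ∫ x in unitCell d, (fderiv ℝ φ x (EuclideanSpace.single i 1)) • w.fst x := by
      rw [← integral_add (integrable_fderiv_smul h1 h2 i _) (integrable_fderiv_smul h1 h2 i _)]
      refine integral_congr_ae ?_
      filter_upwards [Lp.coeFn_add v.fst w.fst] with x hx
      simp only [hx, Pi.add_apply, smul_add]
    have e2 : ∫ x in unitCell d, φ x • (v.snd + w.snd : L2Vec d) x i =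
        (∫ x in unitCell d, φ x • v.snd x i) + ∫ x in unitCell d, φ x • w.snd x i := by
      rw [← integral_add (integrable_smul_coord h1 h2 i _) (integrable_smul_coord h1 h2 i _)]
      refine integral_congr_ae ?_
      filter_upwards [Lp.coeFn_add v.snd w.snd] with x hx
      simp only [hx, Pi.add_apply, PiLp.add_apply, smul_add]
    rw [WithLp.add_fst, WithLp.add_snd, e1, e2, hv φ h1 h2 h3 i, hw φ h1 h2 h3 i, neg_add]
  smul_mem' := by
    intro c v hv φ h1 h2 h3 i
    have e1 : ∫ x in unitCell d, (fderiv ℝ φ x (EuclideanSpace.single i 1)) •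
        (c • v.fst : L2 d) x =
        c * ∫ x in unitCell d, (fderiv ℝ φ x (EuclideanSpace.single i 1)) • v.fst x := by
      rw [← integral_const_mul]
      refine integral_congr_ae ?_
      filter_upwards [Lp.coeFn_smul c v.fst] with x hx
      simp only [hx, Pi.smul_apply, Complex.real_smul, smul_eq_mul]
      ring
    have e2 : ∫ x in unitCell d, φ x • (c • v.snd : L2Vec d) x i =
        c * ∫ x in unitCell d, φ x • v.snd x i := by
      rw [← integral_const_mul]
      refine integral_congr_ae ?_
      filter_upwards [Lp.coeFn_smul c v.snd] with x hx
      simp only [hx, Pi.smul_apply, PiLp.smul_apply, Complex.real_smul, smul_eq_mul]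
      ring
    rw [WithLp.smul_fst, WithLp.smul_snd, e1, e2, hv φ h1 h2 h3 i, mul_neg]

/-- The space `L²₀(Y)` of square integrable functions with zero mean. -/
def L20 (d : ℕ) : Submodule ℂ (L2 d) where
  carrier := {u | ∫ x in unitCell d, u x = 0}
  zero_mem' := by
    refine integral_eq_zero_of_ae ?_
    filter_upwards [Lp.coeFn_zero ℂ 2 (cellMeasure d)] with x hx
    simp only [hx, Pi.zero_apply]
  add_mem' := by
    intro v w hv hw
    have := isFiniteMeasure_cellMeasure d
    have hi : ∀ u : L2 d, Integrable u (cellMeasure d) := fun u =>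
      (Lp.memLp u).integrable one_le_two
    change ∫ x in unitCell d, (v + w : L2 d) x = 0
    rw [integral_congr_ae (Lp.coeFn_add v w)]
    simp only [Pi.add_apply]
    rw [integral_add (hi v) (hi w), show ∫ x in unitCell d, v x = 0 from hv,
      show ∫ x in unitCell d, w x = 0 from hw, add_zero]
  smul_mem' := by
    intro c v hv
    change ∫ x in unitCell d, (c • v : L2 d) x = 0
    rw [integral_congr_ae (Lp.coeFn_smul c v)]
    simp only [Pi.smul_apply, smul_eq_mul]
    rw [integral_const_mul, show ∫ x in unitCell d, v x = 0 from hv, mul_zero]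

/-- The space `𝓗 = {h ∈ H¹(Y) : ∫_Y h = 0}`. Its topology is that of `H¹(Y)`, which by the
Poincaré inequality is also that of the inner product `gradForm` below. -/
def EnergySpace (d : ℕ) : Submodule ℂ (WithLp 2 (L2 d × L2Vec d)) :=
  H1 d ⊓ (L20 d).comap (WithLp.fstₗ 2 ℂ (L2 d) (L2Vec d))

/-- The weak gradient of an element of `𝓗`. -/
def grad {d : ℕ} (u : EnergySpace d) : L2Vec d := u.1.snd

/-- The inclusion `𝓗 → L²₀(Y)`. -/
def energyIncl (d : ℕ) : EnergySpace d →L[ℂ] L20 d :=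
  ((WithLp.fstL 2 ℂ (L2 d) (L2Vec d)).comp (EnergySpace d).subtypeL).codRestrict (L20 d)
    (fun u => u.2.2)

/-- `∫_A ∇u · ∇v̄ dx`. -/
def gradFormOn {d : ℕ} (A : Set (EuclideanSpace ℝ (Fin d))) (u v : EnergySpace d) : ℂ :=
  ∫ x in A, ∑ i, grad u x i * (starRingEnd ℂ) (grad v x i)

/-- The inner product `⟨u, v⟩ = ∫_Y ∇u · ∇v̄ dx` of `𝓗`. -/
def gradForm {d : ℕ} (u v : EnergySpace d) : ℂ := gradFormOn (unitCell d) u v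

/-- The inner product `(u, v) = ∫_Y u v̄ dx` of `L²₀(Y)`. -/
def cellInner {d : ℕ} (u v : L20 d) : ℂ :=
  ∫ x in unitCell d, u.1 x * (starRingEnd ℂ) (v.1 x)

/-- The sesquilinear form `B_k(u, v) = k ∫_{Y∖D} ∇u · ∇v̄ dx + ∫_D ∇u · ∇v̄ dx`. -/
def transmissionForm {d : ℕ} (D : Set (EuclideanSpace ℝ (Fin d))) (k : ℂ)
    (u v : EnergySpace d) : ℂ :=
  k * gradFormOn (unitCell d \ D) u v + gradFormOn D u v

/-- `W₁`: the closure of the functions in `𝓗` with support away from `D`. -/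
def W1 {d : ℕ} (D : Set (EuclideanSpace ℝ (Fin d))) : Set (EnergySpace d) :=
  closure {u | ∃ U : Set (EuclideanSpace ℝ (Fin d)), IsOpen U ∧ closure D ⊆ U ∧
    ∀ᵐ x ∂(cellMeasure d), x ∈ U → u.1.fst x = 0}

/-- The functions of `H¹₀(D)`, extended by zero to the cell: the closure in `H¹(Y)` of the smooth
functions with compact support in `D`. -/
def H10 {d : ℕ} (D : Set (EuclideanSpace ℝ (Fin d))) : Set (H1 d) :=
  closure {w | ∃ φ : EuclideanSpace ℝ (Fin d) → ℂ, ContDiff ℝ ∞ φ ∧ HasCompactSupport φ ∧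
    tsupport φ ⊆ D ∧ w.1.fst =ᵐ[cellMeasure d] φ}

/-- `W₂`: the functions `ũ - (∫_D ũ dx) 1_Y` with `ũ` in `H¹₀(D)`, extended by zero. -/
def W2 {d : ℕ} (D : Set (EuclideanSpace ℝ (Fin d))) : Set (EnergySpace d) :=
  {u | ∃ w ∈ H10 D, u.1.fst =ᵐ[cellMeasure d] fun x => w.1.fst x - ∫ y in D, w.1.fst y}

/-- `W₃`: the orthogonal complement of `W₁ ⊕ W₂` in `𝓗`. -/
def W3 {d : ℕ} (D : Set (EuclideanSpace ℝ (Fin d))) : Set (EnergySpace d) :=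
  {u | ∀ v ∈ W1 D ∪ W2 D, gradForm u v = 0}

/-- `μ` is a Neumann electrostatic resonance of `D`: an eigenvalue of the operator `T` on `W₃`
given by `⟨T u, v⟩ = ½ ∫_{Y∖D} ∇u · ∇v̄ dx - ½ ∫_D ∇u · ∇v̄ dx`. -/
def IsResonance {d : ℕ} (D : Set (EuclideanSpace ℝ (Fin d))) (μ : ℝ) : Prop :=
  ∃ u ∈ W3 D, u ≠ 0 ∧ ∀ v ∈ W3 D,
    1 / 2 * gradFormOn (unitCell d \ D) u v - 1 / 2 * gradFormOn D u v = μ * gradForm u v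

/-- The exceptional set `Z` of the numbers `(μ - 1/2) / (μ + 1/2)`, where `μ` is a resonance or
the accumulation point `0` of the resonances. -/
def exceptionalSet {d : ℕ} (D : Set (EuclideanSpace ℝ (Fin d))) : Set ℂ :=
  {k | ∃ μ : ℝ, (IsResonance D μ ∨ μ = 0) ∧ μ ≠ -(1 / 2) ∧
    k = (((μ - 1 / 2) / (μ + 1 / 2) : ℝ) : ℂ)}

/-- `T` is the operator on `𝓗` associated with the form `B_k`: `⟨T u, v⟩ = B_k(u, v)`. -/
def IsFormOperator {d : ℕ} (D : Set (EuclideanSpace ℝ (Fin d))) (k : ℂ)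
    (T : EnergySpace d →L[ℂ] EnergySpace d) : Prop :=
  ∀ u v, gradForm (T u) v = transmissionForm D k u v

open Classical in
/-- The operator `T_k : 𝓗 → 𝓗` associated with the form `B_k`. -/
def formOperator {d : ℕ} (D : Set (EuclideanSpace ℝ (Fin d))) (k : ℂ) :
    EnergySpace d →L[ℂ] EnergySpace d :=
  if h : ∃ T, IsFormOperator D k T then h.choose else 0

/-- `A` is the solution operator `f ↦ u` of the Neumann problem `-Δu = f`: `⟨A f, v⟩ = (f, v)`. -/
def IsNeumannSolution {d : ℕ} (A : L20 d →L[ℂ] EnergySpace d) : Prop :=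
  ∀ f v, gradForm (A f) v = cellInner f (energyIncl d v)

open Classical in
/-- The inverse `(-Δ_N)⁻¹ : L²₀(Y) → 𝓗` of the Neumann Laplacian. -/
def invNeumannLaplacian (d : ℕ) : L20 d →L[ℂ] EnergySpace d :=
  if h : ∃ A : L20 d →L[ℂ] EnergySpace d, IsNeumannSolution A then h.choose else 0

/-- The operator `B(k) = T_k⁻¹ (-Δ_N)⁻¹` on `L²₀(Y)`. -/
def solutionOperator {d : ℕ} (D : Set (EuclideanSpace ℝ (Fin d))) (k : ℂ) : L20 d →L[ℂ] L20 d :=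
  (energyIncl d).comp ((formOperator D k).inverse.comp (invNeumannLaplacian d))

theorem gradFormOn_add_left {d : ℕ} {A : Set (EuclideanSpace ℝ (Fin d))} (hA : A ⊆ unitCell d)
    (u u' v : EnergySpace d) :
    gradFormOn A (u + u') v = gradFormOn A u v + gradFormOn A u' v := by
  have hi : ∀ w : EnergySpace d,
      Integrable (fun x => ∑ i, grad w x i * (starRingEnd ℂ) (grad v x i)) (volume.restrict A) := by
    intro w
    have h0 : Integrable (fun x => ∑ i, grad w x i * (starRingEnd ℂ) (grad v x i))
        (cellMeasure d) := by
      have h := MeasureTheory.L2.integrable_inner (𝕜 := ℂ) (grad v) (grad w)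
      refine h.congr (Eventually.of_forall fun x => ?_)
      simp [PiLp.inner_apply]
    exact h0.mono_measure (Measure.restrict_mono hA le_rfl)
  unfold gradFormOn
  rw [← integral_add (hi u) (hi u')]
  refine integral_congr_ae ?_
  have h := ae_mono (Measure.restrict_mono hA le_rfl)
    (Lp.coeFn_add (grad u) (grad u'))
  filter_upwards [h] with x hx
  have hx' : grad (u + u') x = grad u x + grad u' x := hx
  simp only [hx', PiLp.add_apply, add_mul, Finset.sum_add_distrib]

theorem gradFormOn_smul_left {d : ℕ} {A : Set (EuclideanSpace ℝ (Fin d))} (hA : A ⊆ unitCell d)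
    (c : ℂ) (u v : EnergySpace d) : gradFormOn A (c • u) v = c * gradFormOn A u v := by
  unfold gradFormOn
  rw [← integral_const_mul]
  refine integral_congr_ae ?_
  have h := ae_mono (Measure.restrict_mono hA le_rfl) (Lp.coeFn_smul c (grad u))
  filter_upwards [h] with x hx
  have hx' : grad (c • u) x = c • grad u x := hx
  simp only [hx', PiLp.smul_apply, smul_eq_mul, Finset.mul_sum, mul_assoc]

theorem cellInner_add_left {d : ℕ} (u u' v : L20 d) :
    cellInner (u + u') v = cellInner u v + cellInner u' v := by
  have e : ∀ w : L20 d, cellInner w v = inner ℂ v.1 w.1 := by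
    intro w
    rw [MeasureTheory.L2.inner_def]
    simp [cellInner]
  rw [e, e, e, Submodule.coe_add, inner_add_right]

theorem cellInner_smul_left {d : ℕ} (c : ℂ) (u v : L20 d) :
    cellInner (c • u) v = c * cellInner u v := by
  have e : ∀ w : L20 d, cellInner w v = inner ℂ v.1 w.1 := by
    intro w
    rw [MeasureTheory.L2.inner_def]
    simp [cellInner]
  rw [e, e, Submodule.coe_smul, inner_smul_right]

theorem IsInclusionDomain.subset_unitCell {d : ℕ} {D : Set (EuclideanSpace ℝ (Fin d))}
    (hD : IsInclusionDomain D) : D ⊆ unitCell d :=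
  subset_closure.trans (hD.closure_subset.trans interior_subset)

/-- The eigenspace in `𝓗` of the weak Neumann eigenvalue problem
`-∇·(k(1 - χ_D) + χ_D)∇u = ν u`: all `u` with `B_k(u, v) = ν (u, v)` for every `v ∈ 𝓗`. -/
def neumannEigenspace {d : ℕ} (D : Set (EuclideanSpace ℝ (Fin d))) (hD : IsInclusionDomain D)
    (k ν : ℂ) : Submodule ℂ (EnergySpace d) where
  carrier := {u | ∀ v, transmissionForm D k u v = ν * cellInner (energyIncl d u) (energyIncl d v)}
  zero_mem' := by
    intro v
    have h1 := gradFormOn_smul_left (A := unitCell d \ D) Set.sdiff_subset 0 0 v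
    have h2 := gradFormOn_smul_left hD.subset_unitCell 0 0 v
    have h3 := cellInner_smul_left 0 0 (energyIncl d v)
    simp only [zero_smul, zero_mul] at h1 h2 h3
    simp [transmissionForm, h1, h2, h3]
  add_mem' := by
    intro u u' hu hu' v
    have h1 := hu v
    have h2 := hu' v
    simp only [transmissionForm] at h1 h2 ⊢
    rw [gradFormOn_add_left Set.sdiff_subset, gradFormOn_add_left hD.subset_unitCell, map_add, cellInner_add_left]
    linear_combination h1 + h2
  smul_mem' := by
    intro c u hu v
    have h1 := hu v
    simp only [transmissionForm] at h1 ⊢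
    rw [gradFormOn_smul_left Set.sdiff_subset, gradFormOn_smul_left hD.subset_unitCell, map_smul,
      cellInner_smul_left]
    linear_combination c * h1

end NeumannCell

end

/-!
The transmission form `B_k` is represented on `𝓗`, with the `H¹` inner product, by the bounded operator
`transmissionOp D k`, and `T_k` is its composition with the fixed isomorphism `(energyEquiv d).symm`.
Everything hinges on the invertibility of `transmissionOp D k` for `k ∉ Z`
(`isInvertible_transmissionOp`).

*Off the closed negative half axis* there is `θ` with `re θ > 0` and `re (θ k) > 0`, so that `θ B_k` is
coercive by the Poincaré inequality and Lax–Milgram applies (`bounded_below_of_mem_slitPlane`).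

*On the negative half axis* both `0` and `-1` belong to `Z`: the former because `1/2` is always a
resonance (`isResonance_half`), the latter by the definition of `Z`. For the remaining `k` the operator is
self-adjoint, so it suffices that it is injective and bounded below up to a compact term.
* Injectivity: a function in the kernel is orthogonal to `W₁`, whose gradients vanish on `D`, and to
  `W₂`, whose gradients vanish off `D`. Hence it lies in `W₃`, where it is a resonance function for
  `μ = (1 + k) / (2 (1 - k))`, that is, for `k ∈ Z`.
* The estimate `‖u‖ ≤ C (‖S_k u‖ + ‖u‖_{L²})` with `S_k = transmissionOp D k` is local
  (`LocallyCoercive.aprioriOn`), and needs only local coercivity of `B_k`. Across the interface the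
  coefficient changes sign and `B_k` is indefinite, but it is coercive when tested with a reflected
  function: on the side where the coefficient has larger modulus take `v = w`, on the other side take
  `v = 2 w ∘ R - w`, with a reflection `R` across the interface which is bi-Lipschitz with constants as
  close to `1` as desired, because the boundary is `C¹` (`exists_flattening`, `reflectedTest_coercive`).
  This is where `|k| ≠ 1` enters.

*Analysis on the cell.* The products of cosines form an orthogonal basis of `L²(Y)` of Neumann
eigenfunctions; the boundary terms are avoided by cutoffs, since the normal derivatives vanish on the
faces. From this basis follow the Poincaré inequality, Rellich's theorem, and the density of smooth
functions in `𝓗`.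

*The spectrum.* Once `T_k` is invertible, `B(k)` is compact and holomorphic in `k`, and the weak
formulation identifies its eigenfunctions with those of the Neumann problem. Riesz theory bounds the
algebraic multiplicities of the eigenvalues of modulus at least `r`, so they can be listed by decreasing
modulus. For `k > 0` the operator `B(k)` is symmetric, positive and injective on an infinite dimensional
space, so the list never reaches zero.
-/

/-! ### Compact operators and enumeration of eigenvalues -/

namespace NeumannCell

section Riesz

open Module End

variable {X : Type*} [NormedAddCommGroup X] [NormedSpace ℂ X]

/-- The chain argument of Riesz: a compact operator has no infinite strictly increasing chain of
finite dimensional subspaces `V n` with `(K - g n) V (n + 1) ⊆ V n` and `‖g n‖ ≥ r > 0`, because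
Riesz' lemma would provide a bounded sequence with `r`-separated images. -/
theorem not_exists_chain {K : X →L[ℂ] X} (hK : IsCompactOperator K) {r : ℝ} (hr : 0 < r)
    (V : ℕ → Submodule ℂ X) (hfd : ∀ n, FiniteDimensional ℂ (V n)) (hmono : Monotone V)
    (hinv : ∀ n, ∀ y ∈ V n, K y ∈ V n) (g : ℕ → ℂ) (hg : ∀ n, r ≤ ‖g n‖)
    (hlt : ∀ n, ∃ x ∈ V (n + 1), x ∉ V n)
    (hstep : ∀ n, ∀ y ∈ V (n + 1), K y - g n • y ∈ V n) : False := by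
  have hx : ∀ n, ∃ x ∈ V (n + 1), ‖x‖ ≤ 3 ∧ ∀ y ∈ V n, 1 ≤ ‖x - y‖ := by
    intro n
    have hc : (1 : ℝ) < ‖(2 : ℂ)‖ := by norm_num
    have hR : ‖(2 : ℂ)‖ < 3 := by norm_num
    have h1 : IsClosed ((V n).comap (V (n + 1)).subtype : Set (V (n + 1))) :=
      (V n).closed_of_finiteDimensional.preimage_val
    have h2 : ∃ x : V (n + 1), x ∉ (V n).comap (V (n + 1)).subtype := by
      obtain ⟨x, hx, hx'⟩ := hlt n
      exact ⟨⟨x, hx⟩, hx'⟩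
    obtain ⟨x, hx3, hxy⟩ := riesz_lemma_of_norm_lt hc hR h1 h2
    exact ⟨x, x.2, hx3, fun y hy => hxy ⟨y, hmono n.le_succ hy⟩ hy⟩
  choose x hxV hx3 hxd using hx
  have hsep : ∀ m n, m < n → r ≤ ‖K (x n) - K (x m)‖ := by
    intro m n hmn
    have hgn : g n ≠ 0 := norm_pos_iff.1 (hr.trans_le (hg n))
    have hu : -((g n)⁻¹ • ((K (x n) - g n • x n) - K (x m))) ∈ V n :=
      (V n).neg_mem ((V n).smul_mem _ ((V n).sub_mem (hstep n _ (hxV n))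
        (hinv n _ (hmono (Nat.succ_le_of_lt hmn) (hxV m)))))
    have h1 := hxd n _ hu
    have h2 : K (x n) - K (x m) = g n • (x n - -((g n)⁻¹ • ((K (x n) - g n • x n) - K (x m)))) := by
      rw [sub_neg_eq_add, smul_add, smul_inv_smul₀ hgn]
      abel
    rw [h2, norm_smul]
    nlinarith [hg n, norm_nonneg (g n)]
  obtain ⟨C, hC, hC'⟩ := hK.image_closedBall_subset_compact 3
  obtain ⟨y, -, ψ, hψ, hy⟩ := hC.tendsto_subseq
    (fun n => hC' ⟨x n, by simpa using hx3 n, rfl⟩)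
  have hcs := hy.cauchySeq
  rw [Metric.cauchySeq_iff'] at hcs
  obtain ⟨N, hN⟩ := hcs r hr
  have h1 := hN (N + 1) (by omega)
  rw [dist_eq_norm] at h1
  exact absurd h1 (not_lt.2 (hsep _ _ (hψ (Nat.lt_succ_self N))))

/-- The sum of the generalized eigenspaces of a compact operator for all eigenvalues outside a
disc around `0`. -/
def outerEigenspace (K : X →L[ℂ] X) (r : ℝ) : Submodule ℂ X :=
  ⨆ g : {g : ℂ // r ≤ ‖g‖}, maxGenEigenspace (K : X →ₗ[ℂ] X) g

theorem le_outerEigenspace (K : X →L[ℂ] X) {r : ℝ} {g : ℂ} (hg : r ≤ ‖g‖) :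
    maxGenEigenspace (K : X →ₗ[ℂ] X) g ≤ outerEigenspace K r :=
  le_iSup (fun g : {g : ℂ // r ≤ ‖g‖} => maxGenEigenspace (K : X →ₗ[ℂ] X) g.1) ⟨g, hg⟩

/-- A proper finite dimensional invariant subspace of `outerEigenspace K r` can be enlarged by one
dimension, within the chain condition of `not_exists_chain`. -/
theorem exists_invariant_extension (K : X →L[ℂ] X) (r : ℝ) (V : Submodule ℂ X)
    (hfd : FiniteDimensional ℂ V) (hinv : ∀ y ∈ V, K y ∈ V)
    (hne : ¬ outerEigenspace K r ≤ V) :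
    ∃ (V' : Submodule ℂ X) (g : ℂ), FiniteDimensional ℂ V' ∧ (∀ y ∈ V', K y ∈ V') ∧ V ≤ V' ∧
      r ≤ ‖g‖ ∧ (∃ x ∈ V', x ∉ V) ∧ ∀ y ∈ V', K y - g • y ∈ V := by
  obtain ⟨⟨g, hg⟩, hgV⟩ : ∃ g : {g : ℂ // r ≤ ‖g‖},
      ¬ maxGenEigenspace (K : X →ₗ[ℂ] X) g ≤ V := by
    by_contra! h
    exact hne (iSup_le h)
  obtain ⟨x, hx, hxV⟩ := SetLike.not_le_iff_exists.1 hgV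
  obtain ⟨k, hk⟩ := (mem_maxGenEigenspace _ _ _).1 hx
  set N : X →ₗ[ℂ] X := (K : X →ₗ[ℂ] X) - g • (1 : End ℂ X) with hN
  classical
  have hex : ∃ k, (N ^ k) x ∈ V := ⟨k, by rw [hk]; exact V.zero_mem⟩
  obtain ⟨j, hj⟩ : ∃ j, Nat.find hex = j + 1 := by
    refine Nat.exists_eq_succ_of_ne_zero fun h0 => hxV ?_
    have := Nat.find_spec hex
    rw [h0] at this
    simpa using this
  have hy1 : (N ^ j) x ∉ V := Nat.find_min hex (by omega)
  have hy2 : N ((N ^ j) x) ∈ V := by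
    have := Nat.find_spec hex
    rw [hj, pow_succ'] at this
    exact this
  set y := (N ^ j) x
  have hNy : ∀ z, N z = K z - g • z := fun z => by simp [hN]
  have hsub : ∀ z ∈ V ⊔ Submodule.span ℂ {y}, K z - g • z ∈ V := by
    intro z hz
    obtain ⟨v, hv, w, hw, rfl⟩ := Submodule.mem_sup.1 hz
    obtain ⟨c, rfl⟩ := Submodule.mem_span_singleton.1 hw
    have : K (v + c • y) - g • (v + c • y) = (K v - g • v) + c • N y := by
      rw [hNy, map_add, map_smul]; module
    rw [this]
    exact V.add_mem (V.sub_mem (hinv v hv) (V.smul_mem _ hv)) (V.smul_mem _ hy2)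
  refine ⟨V ⊔ Submodule.span ℂ {y}, g, inferInstance, fun z hz => ?_, le_sup_left, hg,
    ⟨y, Submodule.mem_sup_right (Submodule.mem_span_singleton_self y), hy1⟩, hsub⟩
  have := Submodule.add_mem _ (Submodule.mem_sup_left (T := Submodule.span ℂ {y}) (hsub z hz))
    (Submodule.smul_mem _ g hz)
  simpa using this

theorem finiteDimensional_outerEigenspace {K : X →L[ℂ] X} (hK : IsCompactOperator K) {r : ℝ}
    (hr : 0 < r) : FiniteDimensional ℂ (outerEigenspace K r) := by
  by_contra hnot
  have hne : ∀ V : Submodule ℂ X, FiniteDimensional ℂ V → ¬ outerEigenspace K r ≤ V :=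
    fun V hV hle => hnot (Submodule.finiteDimensional_of_le hle)
  let S := {V : Submodule ℂ X // FiniteDimensional ℂ V ∧ ∀ y ∈ V, K y ∈ V}
  have hstep : ∀ V : S, ∃ (V' : S) (g : ℂ), V.1 ≤ V'.1 ∧ r ≤ ‖g‖ ∧ (∃ x ∈ V'.1, x ∉ V.1) ∧
      ∀ y ∈ V'.1, K y - g • y ∈ V.1 := by
    intro V
    obtain ⟨V', g, h1, h2, h3⟩ := exists_invariant_extension K r V.1 V.2.1 V.2.2 (hne _ V.2.1)
    exact ⟨⟨V', h1, h2⟩, g, h3⟩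
  choose next g h1 h2 h3 h4 using hstep
  let s : ℕ → S := fun n => Nat.rec ⟨⊥, inferInstance, by simp⟩ (fun _ V => next V) n
  exact not_exists_chain hK hr (fun n => (s n).1) (fun n => (s n).2.1)
    (monotone_nat_of_le_succ fun n => h1 (s n)) (fun n => (s n).2.2) (fun n => g (s n))
    (fun n => h2 _) (fun n => h3 _) (fun n => h4 _)

theorem finiteDimensional_maxGenEigenspace {K : X →L[ℂ] X} (hK : IsCompactOperator K) {g : ℂ}
    (hg : g ≠ 0) : FiniteDimensional ℂ (maxGenEigenspace (K : X →ₗ[ℂ] X) g) :=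
  have := finiteDimensional_outerEigenspace hK (norm_pos_iff.2 hg)
  Submodule.finiteDimensional_of_le (le_outerEigenspace K le_rfl)

theorem maxGenEigenspace_ne_bot_iff {K : X →ₗ[ℂ] X} {g : ℂ} :
    maxGenEigenspace K g ≠ ⊥ ↔ HasEigenvalue K g := by
  refine ⟨fun h => ?_, fun h hb => h (eq_bot_iff.2 (hb ▸ eigenspace_le_maxGenEigenspace))⟩
  obtain ⟨x, hx, hx0⟩ := Submodule.exists_mem_ne_zero_of_ne_bot h
  obtain ⟨k, hk⟩ := (mem_maxGenEigenspace _ _ _).1 hx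
  intro hbot
  have hinj : Function.Injective (K - g • (1 : End ℂ X)) := by
    rw [← LinearMap.ker_eq_bot, eq_bot_iff, ← hbot]
    intro z hz
    rw [mem_eigenspace_iff]
    simpa [sub_eq_zero] using hz
  have : Function.Injective ((K - g • (1 : End ℂ X)) ^ k) := by
    rw [Module.End.coe_pow]; exact hinj.iterate k
  exact hx0 (this (by rw [hk, map_zero]))

theorem finite_eigenvalues {K : X →L[ℂ] X} (hK : IsCompactOperator K) {r : ℝ} (hr : 0 < r) :
    {g : ℂ | r ≤ ‖g‖ ∧ HasEigenvalue (K : X →ₗ[ℂ] X) g}.Finite := by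
  set S := {g : ℂ | r ≤ ‖g‖ ∧ HasEigenvalue (K : X →ₗ[ℂ] X) g}
  have hex : ∀ g : S, ∃ x, HasEigenvector (K : X →ₗ[ℂ] X) g x := fun g =>
    g.2.2.exists_hasEigenvector
  choose x hx using hex
  have hli := eigenvectors_linearIndependent' (K : X →ₗ[ℂ] X) (fun g : S => (g : ℂ))
    Subtype.val_injective x hx
  have hmem : ∀ g : S, x g ∈ outerEigenspace K r := fun g =>
    le_outerEigenspace K g.2.1 (eigenspace_le_maxGenEigenspace (hx g).1)
  have := finiteDimensional_outerEigenspace hK hr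
  have hli' : LinearIndependent ℂ (fun g : S => (⟨x g, hmem g⟩ : outerEigenspace K r)) :=
    LinearIndependent.of_comp (outerEigenspace K r).subtype hli
  have := hli'.finite
  exact Set.toFinite S

end Riesz

section Enumeration

/-- A family in which only finitely many members lie outside every disc around `0` can be listed
by decreasing modulus. The position of a member is the number of its predecessors for the
lexicographic order given by the modulus and an injection `e` that breaks ties. -/
theorem exists_antitone_enumeration {S : Type*} (f : S → ℂ) (h0 : ∀ s, f s ≠ 0)
    (hfin : ∀ r : ℝ, 0 < r → {s | r ≤ ‖f s‖}.Finite) (e : S → ℕ) (he : Function.Injective e) :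
    ∃ γ : ℕ → ℂ, Antitone (fun j => ‖γ j‖) ∧ Tendsto γ atTop (𝓝 0) ∧
      ∀ g : ℂ, g ≠ 0 → {j | γ j = g}.encard = {s | f s = g}.encard := by
  classical
  let key : S → ℝᵒᵈ ×ₗ ℕ := fun s => toLex (OrderDual.toDual ‖f s‖, e s)
  have hkey : Function.Injective key := fun s t h => he (by
    have := congrArg (fun z => (ofLex z).2) h
    exact this)
  have hkey_le : ∀ s t, key t ≤ key s → ‖f s‖ ≤ ‖f t‖ := by
    intro s t h
    rcases Prod.Lex.le_iff.1 h with h | h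
    · exact le_of_lt h
    · exact le_of_eq (congrArg OrderDual.ofDual h.1).symm
  have hpre : ∀ s, {t | key t < key s}.Finite := fun s =>
    (hfin ‖f s‖ (norm_pos_iff.2 (h0 s))).subset fun t ht => hkey_le s t (le_of_lt ht)
  let rank : S → ℕ := fun s => {t | key t < key s}.ncard
  have hrank : ∀ s t, key s < key t → rank s < rank t := by
    intro s t h
    refine Set.ncard_lt_ncard ⟨fun u hu => lt_trans hu h, fun hsub => ?_⟩ (hpre t)
    exact lt_irrefl (key s) (hsub (show s ∈ {u | key u < key t} from h))
  have hinj : Function.Injective rank := by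
    intro s t h
    rcases lt_trichotomy (key s) (key t) with h1 | h1 | h1
    · exact absurd h (hrank s t h1).ne
    · exact hkey h1
    · exact absurd h (hrank t s h1).ne'
  have hpred : ∀ s n, rank s = n + 1 → ∃ t, rank t = n := by
    intro s n hs
    have hne : {t | key t < key s}.Nonempty := by
      rw [← Set.ncard_pos (hpre s)]
      change 0 < rank s
      omega
    obtain ⟨t, ht, hmax⟩ := Set.exists_max_image _ key (hpre s) hne
    refine ⟨t, ?_⟩
    have heq : {u | key u < key s} = insert t {u | key u < key t} := by
      ext u
      constructor
      · intro hu
        rcases (hmax u hu).lt_or_eq with h | h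
        · exact Or.inr h
        · exact Or.inl (hkey h)
      · rintro (rfl | hu)
        · exact ht
        · exact lt_trans (show key u < key t from hu) (show key t < key s from ht)
    have : rank s = rank t + 1 := by
      change Set.ncard _ = _
      have hnot : t ∉ {u | key u < key t} := fun h => lt_irrefl (key t) h
      rw [heq, Set.ncard_insert_of_notMem hnot (hpre t)]
    omega
  have hlower : ∀ m n, m ≤ n → (∃ s, rank s = n) → ∃ s, rank s = m := by
    intro m n hmn
    induction n, hmn using Nat.le_induction with
    | base => exact id
    | succ n _ ih => rintro ⟨s, hs⟩; exact ih (hpred s n hs)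
  let γ : ℕ → ℂ := fun j => if h : ∃ s, rank s = j then f h.choose else 0
  have hγ : ∀ s, γ (rank s) = f s := by
    intro s
    have h : ∃ t, rank t = rank s := ⟨s, rfl⟩
    simp only [γ, dif_pos h]
    rw [hinj h.choose_spec]
  have hγ0 : ∀ j, γ j ≠ 0 → ∃ s, rank s = j := by
    intro j hj
    by_contra h
    exact hj (dif_neg h)
  have hset : ∀ p : ℂ → Prop, ¬ p 0 → {j | p (γ j)} = rank '' {s | p (f s)} := by
    intro p hp
    ext j
    constructor
    · intro hj
      obtain ⟨s, rfl⟩ := hγ0 j (fun h => hp (h ▸ hj))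
      exact ⟨s, by simpa only [Set.mem_ofPred_eq, hγ] using hj, rfl⟩
    · rintro ⟨s, hs, rfl⟩
      simpa only [Set.mem_ofPred_eq, hγ] using hs
  refine ⟨γ, ?_, ?_, ?_⟩
  · intro i j hij
    change ‖γ j‖ ≤ ‖γ i‖
    by_cases h : γ j = 0
    · rw [h, norm_zero]; exact norm_nonneg _
    · obtain ⟨s, rfl⟩ := hγ0 j h
      obtain ⟨t, rfl⟩ := hlower i _ hij ⟨s, rfl⟩
      rw [hγ, hγ]
      refine hkey_le s t (le_of_not_gt fun hlt => ?_)
      exact absurd hij (not_le.2 (hrank s t hlt))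
  · rw [Metric.tendsto_atTop]
    intro r hr
    have hf : {j | r ≤ ‖γ j‖}.Finite := by
      rw [hset (fun z => r ≤ ‖z‖) (by simpa using hr)]
      exact (hfin r hr).image _
    obtain ⟨N, hN⟩ := hf.bddAbove
    refine ⟨N + 1, fun n hn => ?_⟩
    rw [dist_zero_right]
    by_contra h
    have := hN (show n ∈ {j | r ≤ ‖γ j‖} from not_lt.1 h)
    omega
  · intro g hg
    rw [hset (fun z => z = g) (fun h => hg h.symm)]
    exact hinj.encard_image _

/-- A multiplicity function on `ℂ` whose support accumulates only at `0` is the counting function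
of a sequence of decreasing modulus. -/
theorem exists_sequence_of_multiplicity (m : ℂ → ℕ)
    (hfin : ∀ r : ℝ, 0 < r → {g : ℂ | r ≤ ‖g‖ ∧ m g ≠ 0}.Finite) :
    ∃ γ : ℕ → ℂ, Antitone (fun j => ‖γ j‖) ∧ Tendsto γ atTop (𝓝 0) ∧
      ∀ g : ℂ, g ≠ 0 → {j | γ j = g}.encard = m g := by
  let S := Σ g : {g : ℂ // g ≠ 0}, Fin (m g)
  have hcount : {g : ℂ | g ≠ 0 ∧ m g ≠ 0}.Countable := by
    have : {g : ℂ | g ≠ 0 ∧ m g ≠ 0} ⊆ ⋃ n : ℕ, {g : ℂ | 1 / ((n : ℝ) + 1) ≤ ‖g‖ ∧ m g ≠ 0} := by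
      rintro g ⟨hg, hm⟩
      obtain ⟨n, hn⟩ := exists_nat_one_div_lt (norm_pos_iff.2 hg)
      exact Set.mem_iUnion.2 ⟨n, hn.le, hm⟩
    exact (Set.countable_iUnion fun n => (hfin _ (by positivity)).countable).mono this
  have hval : ∀ s : S, s.1.1 ∈ {g : ℂ | g ≠ 0 ∧ m g ≠ 0} := fun s =>
    ⟨s.1.2, fun h => by have := s.2.2; omega⟩
  have : Countable {g : ℂ | g ≠ 0 ∧ m g ≠ 0} := hcount
  have hcS : Countable S := by
    let F : S → {g : ℂ | g ≠ 0 ∧ m g ≠ 0} × ℕ := fun s => (⟨s.1.1, hval s⟩, s.2.1)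
    refine Function.Injective.countable (f := F) ?_
    rintro ⟨⟨g, hg⟩, i⟩ ⟨⟨g', hg'⟩, i'⟩ h
    simp only [F, Prod.mk.injEq, Subtype.mk.injEq] at h
    obtain ⟨rfl, h2⟩ := h
    rw [Fin.ext h2]
  obtain ⟨e, he⟩ := hcS.exists_injective_nat
  have hfib : ∀ g : ℂ, ∀ hg : g ≠ 0,
      {s : S | s.1.1 = g} = Set.range (fun i : Fin (m g) => (⟨⟨g, hg⟩, i⟩ : S)) := by
    intro g hg
    ext ⟨⟨g', hg'⟩, i⟩
    constructor
    · intro h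
      simp only [Set.mem_ofPred_eq] at h
      subst h
      exact ⟨i, rfl⟩
    · rintro ⟨i', h⟩
      have := congrArg (fun s : S => s.1.1) h
      exact this.symm
  obtain ⟨γ, h1, h2, h3⟩ := exists_antitone_enumeration (fun s : S => s.1.1) (fun s => s.1.2) (by
    intro r hr
    have : {s : S | r ≤ ‖s.1.1‖} ⊆ ⋃ g ∈ {g : ℂ | r ≤ ‖g‖ ∧ m g ≠ 0}, {s : S | s.1.1 = g} := by
      intro s hs
      exact Set.mem_biUnion (x := s.1.1) ⟨hs, (hval s).2⟩ rfl
    refine ((hfin r hr).biUnion fun g hg => ?_).subset this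
    have hg0 : g ≠ 0 := norm_pos_iff.1 (hr.trans_le hg.1)
    rw [hfib g hg0]
    exact Set.finite_range _) e he
  refine ⟨γ, h1, h2, fun g hg => ?_⟩
  rw [h3 g hg, hfib g hg, ← Set.image_univ, Function.Injective.encard_image]
  · simp
  · intro i j hij
    exact eq_of_heq (Sigma.mk.inj hij).2

end Enumeration

section Hilbert

variable {H : Type*} [NormedAddCommGroup H] [InnerProductSpace ℂ H] [CompleteSpace H]

/-- An operator which is bounded below together with its adjoint is invertible. -/
theorem isInvertible_of_bounded_below {S : H →L[ℂ] H} {c : ℝ} (hc : 0 < c)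
    (h1 : ∀ u, c * ‖u‖ ≤ ‖S u‖) (h2 : ∀ u, ContinuousLinearMap.adjoint S u = 0 → u = 0) :
    S.IsInvertible := by
  have hanti : AntilipschitzWith (Real.toNNReal c⁻¹) S := by
    refine ContinuousLinearMap.antilipschitz_of_bound _ fun u => ?_
    rw [Real.coe_toNNReal _ (by positivity)]
    have := h1 u
    rw [inv_mul_eq_div, le_div_iff₀ hc]
    linarith
  have hker : S.ker = ⊥ := LinearMap.ker_eq_bot.2 hanti.injective
  have hcl : IsClosed (S.range : Set H) := by
    rw [LinearMap.coe_range]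
    exact hanti.isClosed_range S.uniformContinuous
  have hrange : S.range = ⊤ := by
    have hcomp : CompleteSpace S.range := hcl.completeSpace_coe
    rw [← Submodule.orthogonal_eq_bot_iff, eq_bot_iff]
    intro u hu
    refine (Submodule.mem_bot ℂ).2 (h2 u (ext_inner_left ℂ fun v => ?_))
    rw [ContinuousLinearMap.adjoint_inner_right, inner_zero_right]
    exact hu _ ⟨v, rfl⟩
  exact ⟨ContinuousLinearEquiv.ofBijective S hker hrange, by ext; rfl⟩

/-- An injective operator satisfying an a priori estimate up to a compact term is bounded
below. -/
theorem bounded_below_of_apriori {X : Type*} [NormedAddCommGroup X] [NormedSpace ℂ X]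
    {S : H →L[ℂ] H} {K : H →L[ℂ] X} (hK : IsCompactOperator K) {C : ℝ}
    (hest : ∀ u, ‖u‖ ≤ C * (‖S u‖ + ‖K u‖)) (hinj : ∀ u, S u = 0 → u = 0) :
    ∃ c : ℝ, 0 < c ∧ ∀ u, c * ‖u‖ ≤ ‖S u‖ := by
  by_contra! hcon
  have hseq : ∀ n : ℕ, ∃ u : H, ‖u‖ = 1 ∧ ‖S u‖ < 1 / ((n : ℝ) + 1) := by
    intro n
    obtain ⟨u, hu⟩ := hcon (1 / ((n : ℝ) + 1)) (by positivity)
    have hu0 : u ≠ 0 := by rintro rfl; simp at hu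
    have hpos := norm_pos_iff.2 hu0
    refine ⟨((‖u‖⁻¹ : ℝ) : ℂ) • u, ?_, ?_⟩
    · rw [norm_smul]; simp [hpos.ne']
    · rw [map_smul, norm_smul]
      simp only [Complex.norm_real, norm_inv, norm_norm]
      rw [inv_mul_lt_iff₀ hpos, mul_comm]
      exact hu
  choose u hu1 huS using hseq
  obtain ⟨Q, hQ, hQ'⟩ := hK.image_closedBall_subset_compact 1
  obtain ⟨y, -, ψ, hψ, hy⟩ := hQ.tendsto_subseq (fun n => hQ' ⟨u n, by simp [hu1], rfl⟩)
  have hS0 : Tendsto (fun n => S (u n)) atTop (𝓝 0) :=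
    squeeze_zero_norm (fun n => (huS n).le) tendsto_one_div_add_atTop_nhds_zero_nat
  have hS1 := hS0.comp hψ.tendsto_atTop
  have hC : 0 ≤ C := by
    by_contra hC
    have := hest (u 0)
    rw [hu1] at this
    nlinarith [norm_nonneg (S (u 0)), norm_nonneg (K (u 0))]
  have hcs : CauchySeq (fun n => u (ψ n)) := by
    rw [Metric.cauchySeq_iff]
    intro ε hε
    have a1 := Metric.cauchySeq_iff.1 hS1.cauchySeq (ε / (2 * (C + 1))) (by positivity)
    have a2 := Metric.cauchySeq_iff.1 hy.cauchySeq (ε / (2 * (C + 1))) (by positivity)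
    obtain ⟨N1, h1⟩ := a1
    obtain ⟨N2, h2⟩ := a2
    refine ⟨max N1 N2, fun m hm n hn => ?_⟩
    have b1 := h1 m (le_of_max_le_left hm) n (le_of_max_le_left hn)
    have b2 := h2 m (le_of_max_le_right hm) n (le_of_max_le_right hn)
    simp only [Function.comp_apply] at b1 b2
    rw [dist_eq_norm, ← map_sub] at b1 b2
    change ‖K (u (ψ m) - u (ψ n))‖ < _ at b2
    rw [dist_eq_norm]
    have b3 := hest (u (ψ m) - u (ψ n))
    have b4 : ‖S (u (ψ m) - u (ψ n))‖ + ‖K (u (ψ m) - u (ψ n))‖ < ε / (C + 1) := by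
      have : ε / (2 * (C + 1)) + ε / (2 * (C + 1)) = ε / (C + 1) := by field_simp; ring
      linarith
    have b5 : (C + 1) * (ε / (C + 1)) = ε := by field_simp
    have b6 : 0 < ε / (C + 1) := by positivity
    nlinarith [norm_nonneg (S (u (ψ m) - u (ψ n))), norm_nonneg (K (u (ψ m) - u (ψ n)))]
  obtain ⟨w, hw⟩ := cauchySeq_tendsto_of_complete hcs
  have hSw : S w = 0 := tendsto_nhds_unique ((S.continuous.tendsto w).comp hw) hS1
  have hw1 : ‖w‖ = 1 := by
    refine tendsto_nhds_unique hw.norm ?_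
    simp [hu1]
  rw [hinj w hSw, norm_zero] at hw1
  exact zero_ne_one hw1

open Module End in
/-- An injective compact symmetric operator on an infinite dimensional space has infinitely many
eigenvalues, counted with multiplicity: the eigenvalues do not all lie in a finite set. -/
theorem infinite_eigenvalues {K : H →L[ℂ] H} (hK : IsCompactOperator K)
    (hsymm : (K : H →ₗ[ℂ] H).IsSymmetric) (hinj : ∀ f, K f = 0 → f = 0)
    (hinf : ¬ FiniteDimensional ℂ H) (s : Set ℂ) (hs : s.Finite) :
    ∃ g, HasEigenvalue (K : H →ₗ[ℂ] H) g ∧ g ∉ s := by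
  by_contra! hcon
  have hle : (⨆ μ, eigenspace (K : End ℂ H) μ) ≤ ⨆ μ : (s \ {0} : Set ℂ), eigenspace (K : End ℂ H) μ := by
    refine iSup_le fun μ => ?_
    by_cases hμ : HasEigenvalue (K : H →ₗ[ℂ] H) μ
    · have hμ0 : μ ≠ 0 := by
        rintro rfl
        obtain ⟨x, hx⟩ := hμ.exists_hasEigenvector
        exact hx.2 (hinj x (by simpa using hx.apply_eq_smul))
      exact le_iSup (fun μ : (s \ {0} : Set ℂ) => eigenspace (K : End ℂ H) μ) ⟨μ, hcon μ hμ, hμ0⟩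
    · rw [HasEigenvalue, HasUnifEigenvalue, not_not] at hμ
      rw [show eigenspace (K : End ℂ H) μ = ⊥ from hμ]
      exact bot_le
  have : Finite (s \ {0} : Set ℂ) := hs.subset Set.sdiff_subset
  have hfd : ∀ μ : (s \ {0} : Set ℂ), FiniteDimensional ℂ (eigenspace (K : End ℂ H) (μ : ℂ)) := by
    intro μ
    have := finiteDimensional_maxGenEigenspace hK μ.2.2
    exact Submodule.finiteDimensional_of_le eigenspace_le_maxGenEigenspace
  have hfd' : FiniteDimensional ℂ (⨆ μ : (s \ {0} : Set ℂ), eigenspace (K : End ℂ H) (μ : ℂ) :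
      Submodule ℂ H) := Submodule.finiteDimensional_iSup _
  have hfd2 : FiniteDimensional ℂ (⨆ μ, eigenspace (K : End ℂ H) μ : Submodule ℂ H) :=
    Submodule.finiteDimensional_of_le hle
  have hbot := ContinuousLinearMap.orthogonalComplement_iSup_eigenspaces_eq_bot hK hsymm
  rw [Submodule.orthogonal_eq_bot_iff] at hbot
  rw [hbot] at hfd2
  exact hinf (Module.Finite.equiv (Submodule.topEquiv (R := ℂ) (M := H)))

end Hilbert

end NeumannCell

/-! ### Weak gradients on the unit cell -/

namespace NeumannCell

instance instIsFiniteMeasureCellMeasure (d : ℕ) : IsFiniteMeasure (cellMeasure d) :=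
  isFiniteMeasure_cellMeasure d

variable {d : ℕ}

theorem unitCell_eq_preimage (d : ℕ) :
    unitCell d = (WithLp.ofLp (p := 2)) ⁻¹' (Set.univ.pi fun _ : Fin d => Set.Ioc (0 : ℝ) 1) := by
  ext x
  simp [unitCell]

theorem measurableSet_unitCell (d : ℕ) : MeasurableSet (unitCell d) := by
  rw [unitCell_eq_preimage]
  exact (PiLp.volume_preserving_ofLp (Fin d)).measurable
    (MeasurableSet.univ_pi fun _ => measurableSet_Ioc)

theorem volume_unitCell (d : ℕ) : volume (unitCell d) = 1 := by
  rw [unitCell_eq_preimage, (PiLp.volume_preserving_ofLp (Fin d)).measure_preimage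
    (MeasurableSet.univ_pi fun _ => measurableSet_Ioc).nullMeasurableSet, volume_pi_pi]
  simp

theorem convex_unitCell (d : ℕ) : Convex ℝ (unitCell d) := by
  intro x hx y hy a b ha hb hab i
  exact convex_Ioc (0 : ℝ) 1 (hx i) (hy i) ha hb hab

theorem ae_mem_interior_unitCell (d : ℕ) : ∀ᵐ x ∂(cellMeasure d), x ∈ interior (unitCell d) := by
  have h := (convex_unitCell d).addHaar_frontier (volume : Measure (EuclideanSpace ℝ (Fin d)))
  rw [ae_restrict_iff' (measurableSet_unitCell d)]
  filter_upwards [measure_eq_zero_iff_ae_notMem.1 h] with x hx hxY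
  by_contra hxi
  exact hx ⟨subset_closure hxY, hxi⟩

theorem integral_cell_const (c : ℂ) : ∫ _x in unitCell d, c = c := by
  simp [Measure.real, volume_unitCell]

/-- The classical gradient of a complex valued function, as a vector field. -/
noncomputable def vgrad (f : EuclideanSpace ℝ (Fin d) → ℂ) (x : EuclideanSpace ℝ (Fin d)) :
    EuclideanSpace ℂ (Fin d) :=
  WithLp.toLp 2 fun i => fderiv ℝ f x (EuclideanSpace.single i 1)

@[simp]
theorem vgrad_apply (f : EuclideanSpace ℝ (Fin d) → ℂ) (x : EuclideanSpace ℝ (Fin d)) (i : Fin d) :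
    vgrad f x i = fderiv ℝ f x (EuclideanSpace.single i 1) := rfl

/-- The `i`-th component of an `L²` vector field. -/
noncomputable def coordL (i : Fin d) : L2Vec d →L[ℂ] L2 d :=
  (EuclideanSpace.proj (𝕜 := ℂ) i).compLpL 2 (cellMeasure d)

theorem coordL_coeFn (i : Fin d) (g : L2Vec d) :
    coordL i g =ᵐ[cellMeasure d] fun x => g x i :=
  (EuclideanSpace.proj (𝕜 := ℂ) i).coeFn_compLpL g

/-- Integration against a real valued square integrable function. -/
noncomputable def pairingL (φ : EuclideanSpace ℝ (Fin d) → ℝ) (hφ : MemLp (fun x => (φ x : ℂ)) 2 (cellMeasure d)) :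
    L2 d →L[ℂ] ℂ :=
  innerSL ℂ (hφ.toLp _)

theorem pairingL_apply (φ : EuclideanSpace ℝ (Fin d) → ℝ)
    (hφ : MemLp (fun x => (φ x : ℂ)) 2 (cellMeasure d)) (u : L2 d) :
    pairingL φ hφ u = ∫ x in unitCell d, φ x • u x := by
  rw [pairingL, innerSL_apply_apply, MeasureTheory.L2.inner_def]
  refine integral_congr_ae ?_
  filter_upwards [hφ.coeFn_toLp] with x hx
  rw [hx]
  simp [mul_comm]

theorem memLp_ofReal_of_test {φ : EuclideanSpace ℝ (Fin d) → ℝ} (hφ : Continuous φ)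
    (hc : HasCompactSupport φ) : MemLp (fun x => (φ x : ℂ)) 2 (cellMeasure d) := by
  have h1 : MemLp φ 2 (cellMeasure d) := hφ.memLp_of_hasCompactSupport hc
  exact h1.ofReal

theorem isClosed_H1 (d : ℕ) : IsClosed (H1 d : Set (WithLp 2 (L2 d × L2Vec d))) := by
  have hset : (H1 d : Set (WithLp 2 (L2 d × L2Vec d))) =
      {w | ∀ φ : EuclideanSpace ℝ (Fin d) → ℝ, ContDiff ℝ ∞ φ → HasCompactSupport φ →
        tsupport φ ⊆ interior (unitCell d) → ∀ i : Fin d,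
      ∫ x in unitCell d, (fderiv ℝ φ x (EuclideanSpace.single i 1)) • w.fst x =
        - ∫ x in unitCell d, φ x • w.snd x i} := rfl
  rw [hset]
  simp only [Set.ofPred_forall]
  refine isClosed_iInter fun φ => isClosed_iInter fun h1 => isClosed_iInter fun h2 =>
    isClosed_iInter fun h3 => isClosed_iInter fun i => ?_
  have m1 : MemLp (fun x => (fderiv ℝ φ x (EuclideanSpace.single i 1) : ℂ)) 2 (cellMeasure d) :=
    memLp_ofReal_of_test ((h1.continuous_fderiv (by simp)).clm_apply continuous_const)
      (h2.fderiv_apply (𝕜 := ℝ) _)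
  have m2 : MemLp (fun x => (φ x : ℂ)) 2 (cellMeasure d) := memLp_ofReal_of_test h1.continuous h2
  have e : ∀ w : WithLp 2 (L2 d × L2Vec d), ∫ x in unitCell d, φ x • w.snd x i =
      pairingL φ m2 (coordL i w.snd) := by
    intro w
    rw [pairingL_apply]
    refine integral_congr_ae ?_
    filter_upwards [coordL_coeFn i w.snd] with x hx
    rw [hx]
  have e' : ∀ w : WithLp 2 (L2 d × L2Vec d),
      ∫ x in unitCell d, (fderiv ℝ φ x (EuclideanSpace.single i 1)) • w.fst x =
      pairingL _ m1 w.fst := fun w => (pairingL_apply _ m1 w.fst).symm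
  simp only [e, e']
  refine isClosed_eq ?_ ?_
  · exact (pairingL _ m1).continuous.comp (WithLp.fstL 2 ℂ (L2 d) (L2Vec d)).continuous
  · exact ((pairingL _ m2).continuous.comp ((coordL i).continuous.comp
      (WithLp.sndL 2 ℂ (L2 d) (L2Vec d)).continuous)).neg

theorem isClosed_L20 (d : ℕ) : IsClosed (L20 d : Set (L2 d)) := by
  have m : MemLp (fun x : EuclideanSpace ℝ (Fin d) => (((1 : ℝ)) : ℂ)) 2 (cellMeasure d) :=
    memLp_const _
  have hset : (L20 d : Set (L2 d)) = {u | pairingL _ m u = 0} := by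
    ext u
    change ∫ x in unitCell d, u x = 0 ↔ _
    simp [pairingL_apply]
  rw [hset]
  exact isClosed_eq (pairingL _ m).continuous continuous_const

instance completeSpace_L20 (d : ℕ) : CompleteSpace (L20 d) := (isClosed_L20 d).completeSpace_coe

instance completeSpace_energySpace (d : ℕ) : CompleteSpace (EnergySpace d) := by
  have h : IsClosed (EnergySpace d : Set (WithLp 2 (L2 d × L2Vec d))) :=
    (isClosed_H1 d).inter ((isClosed_L20 d).preimage (WithLp.fstL 2 ℂ (L2 d) (L2Vec d)).continuous)
  exact h.completeSpace_coe

/-- Weak gradients are local: on an open set where the function vanishes, so does its weak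
gradient. -/
theorem IsWeakGradient.ae_eq_zero {u : L2 d} {g : L2Vec d} (h : IsWeakGradient u g)
    {U : Set (EuclideanSpace ℝ (Fin d))} (hU : IsOpen U)
    (hu : ∀ᵐ x ∂(cellMeasure d), x ∈ U → u x = 0) :
    ∀ᵐ x ∂(cellMeasure d), x ∈ U → g x = 0 := by
  have key : ∀ i, ∀ᵐ x ∂(cellMeasure d), x ∈ U ∩ interior (unitCell d) → g x i = 0 := by
    intro i
    refine (hU.inter isOpen_interior).ae_eq_zero_of_integral_contDiff_smul_eq_zero ?_ ?_
    · have h1 : MemLp (fun x => g x i) 2 (cellMeasure d) :=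
        (EuclideanSpace.proj (𝕜 := ℂ) i).comp_memLp' (Lp.memLp g)
      exact ((h1.integrable one_le_two).locallyIntegrable).locallyIntegrableOn _
    · intro φ h1 h2 h3
      have e := h φ h1 h2 (h3.trans Set.inter_subset_right) i
      rw [← neg_eq_zero, ← e]
      refine integral_eq_zero_of_ae ?_
      filter_upwards [hu] with x hx
      by_cases hxU : x ∈ U
      · simp [hx hxU]
      · have : fderiv ℝ φ x = 0 := by
          by_contra hne
          exact hxU (h3 (support_fderiv_subset ℝ hne)).1
        simp [this]
  filter_upwards [ae_all_iff.2 key, ae_mem_interior_unitCell d] with x hx hxi hxU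
  ext i
  exact hx i ⟨hxU, hxi⟩

theorem IsWeakGradient.eq_zero {g : L2Vec d} (h : IsWeakGradient 0 g) : g = 0 := by
  have h1 := h.ae_eq_zero isOpen_univ (by
    filter_upwards [Lp.coeFn_zero ℂ 2 (cellMeasure d)] with x hx _
    exact hx)
  refine Lp.ext ?_
  filter_upwards [h1, Lp.coeFn_zero (EuclideanSpace ℂ (Fin d)) 2 (cellMeasure d)] with x hx h0
  rw [hx trivial, h0, Pi.zero_apply]

theorem eq_of_fst_eq {u v : H1 d} (h : u.1.fst = v.1.fst) : u = v := by
  have h1 : IsWeakGradient (u - v).1.fst (u - v).1.snd := (u - v).2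
  have h2 : (u - v).1.fst = 0 := by
    change u.1.fst - v.1.fst = 0
    rw [h, sub_self]
  rw [h2] at h1
  have h3 : u.1.snd - v.1.snd = 0 := h1.eq_zero
  refine Subtype.ext ((WithLp.ofLp_injective 2) (Prod.ext h (sub_eq_zero.1 h3)))

/-- The element of `H¹(Y)` underlying an element of `𝓗`. -/
def energyToH1 (u : EnergySpace d) : H1 d := ⟨u.1, u.2.1⟩

theorem energyIncl_injective (d : ℕ) : Function.Injective (energyIncl d) := by
  intro u v h
  have h1 : energyToH1 u = energyToH1 v := eq_of_fst_eq (congrArg (fun w : L20 d => (w : L2 d)) h)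
  exact Subtype.ext (congrArg (fun w : H1 d => w.1) h1)

/-! ### Lipschitz functions as elements of the energy space -/

theorem norm_fderiv_single_le {f : EuclideanSpace ℝ (Fin d) → ℂ} {C : ℝ≥0} (hf : LipschitzWith C f)
    (x : EuclideanSpace ℝ (Fin d)) (i : Fin d) :
    ‖fderiv ℝ f x (EuclideanSpace.single i 1)‖ ≤ C := by
  refine ((fderiv ℝ f x).le_opNorm _).trans ?_
  rw [PiLp.norm_single, norm_one, mul_one]
  exact norm_fderiv_le_of_lipschitz ℝ hf

theorem measurable_vgrad (f : EuclideanSpace ℝ (Fin d) → ℂ) : Measurable (vgrad f) := by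
  refine (PiLp.continuous_toLp 2 _).measurable.comp (measurable_pi_lambda _ fun i => ?_)
  exact measurable_fderiv_apply_const ℝ f _

theorem norm_vgrad_le {f : EuclideanSpace ℝ (Fin d) → ℂ} {C : ℝ≥0} (hf : LipschitzWith C f)
    (x : EuclideanSpace ℝ (Fin d)) : ‖vgrad f x‖ ≤ √(d * (C : ℝ) ^ 2) := by
  rw [EuclideanSpace.norm_eq]
  refine Real.sqrt_le_sqrt ?_
  calc ∑ i, ‖vgrad f x i‖ ^ 2 ≤ ∑ _i : Fin d, (C : ℝ) ^ 2 := by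
        gcongr with i
        exact norm_fderiv_single_le hf x i
    _ = d * (C : ℝ) ^ 2 := by simp

theorem memLp_vgrad {f : EuclideanSpace ℝ (Fin d) → ℂ} {C : ℝ≥0} (hf : LipschitzWith C f) :
    MemLp (vgrad f) 2 (cellMeasure d) :=
  MemLp.of_bound (measurable_vgrad f).aestronglyMeasurable _
    (Eventually.of_forall (norm_vgrad_le hf))

theorem isBounded_unitCell (d : ℕ) : Bornology.IsBounded (unitCell d) := by
  have : unitCell d ⊆ Metric.closedBall 0 √(d : ℝ) := by
    intro x hx
    rw [mem_closedBall_zero_iff, EuclideanSpace.norm_eq]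
    refine Real.sqrt_le_sqrt ?_
    calc ∑ i, ‖x i‖ ^ 2 ≤ ∑ _i : Fin d, (1 : ℝ) := by
          gcongr with i
          rw [Real.norm_eq_abs, sq_abs]
          nlinarith [(hx i).1, (hx i).2]
      _ = d := by simp
  exact Metric.isBounded_closedBall.subset this

theorem isCompact_closure_unitCell (d : ℕ) : IsCompact (closure (unitCell d)) :=
  (isBounded_unitCell d).isCompact_closure

theorem memLp_of_continuous {F : Type*} [NormedAddCommGroup F]
    {f : EuclideanSpace ℝ (Fin d) → F} (hf : Continuous f) :
    MemLp f 2 (cellMeasure d) := by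
  obtain ⟨C, hC⟩ := (isCompact_closure_unitCell d).exists_bound_of_continuousOn hf.continuousOn
  refine MemLp.of_bound hf.aestronglyMeasurable C ?_
  rw [ae_restrict_iff' (measurableSet_unitCell d)]
  exact Eventually.of_forall fun x hx => hC x (subset_closure hx)

/-- Integration by parts of a Lipschitz function against a test function. -/
theorem integral_test_fderiv_of_lipschitz {f : EuclideanSpace ℝ (Fin d) → ℂ} {C : ℝ≥0}
    (hf : LipschitzWith C f) {φ : EuclideanSpace ℝ (Fin d) → ℝ} (h1 : ContDiff ℝ ∞ φ)
    (h2 : HasCompactSupport φ) (v : EuclideanSpace ℝ (Fin d)) :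
    ∫ x, (fderiv ℝ φ x v) • f x = - ∫ x, φ x • fderiv ℝ f x v := by
  obtain ⟨Cφ, hφ⟩ := h1.lipschitzWith_of_hasCompactSupport h2 (by simp)
  -- the identity for the composition of `f` with a real linear functional
  have key : ∀ L : ℂ →L[ℝ] ℝ, L (∫ x, (fderiv ℝ φ x v) • f x) =
      L (- ∫ x, φ x • fderiv ℝ f x v) := by
    intro L
    have hLf : LipschitzWith (‖L‖₊ * C) (fun x => L (f x)) := L.lipschitz.comp hf
    have i1 : Integrable (fun x => (fderiv ℝ φ x v) • f x) := by
      refine Continuous.integrable_of_hasCompactSupport ?_ ?_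
      · exact ((h1.continuous_fderiv (by simp)).clm_apply continuous_const).smul hf.continuous
      · exact (h2.fderiv_apply (𝕜 := ℝ) v).smul_right
    have i2 : Integrable (fun x => φ x • fderiv ℝ f x v) := by
      have hφi : Integrable φ := h1.continuous.integrable_of_hasCompactSupport h2
      refine Integrable.mono' (hφi.norm.mul_const (C * ‖v‖)) ?_ ?_
      · exact h1.continuous.aestronglyMeasurable.smul
          (measurable_fderiv_apply_const ℝ f v).aestronglyMeasurable
      · refine Eventually.of_forall fun x => ?_
        rw [norm_smul]
        gcongr
        exact ((fderiv ℝ f x).le_opNorm _).trans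
          (by gcongr; exact norm_fderiv_le_of_lipschitz ℝ hf)
    rw [map_neg, ← L.integral_comp_comm i1, ← L.integral_comp_comm i2]
    have e := hLf.integral_lineDeriv_mul_eq (μ := volume) hφ h2 v
    have e1 : ∫ x, L (φ x • fderiv ℝ f x v) = ∫ x, lineDeriv ℝ (fun x => L (f x)) x v * φ x := by
      refine integral_congr_ae ?_
      filter_upwards [hf.ae_differentiableAt (μ := volume)] with x hx
      have := (L.hasFDerivAt.comp x hx.hasFDerivAt).differentiableAt.lineDeriv_eq_fderiv (v := v)
      change lineDeriv ℝ (fun x => L (f x)) x v = fderiv ℝ (fun x => L (f x)) x v at this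
      rw [this, show fderiv ℝ (fun x => L (f x)) x = L.comp (fderiv ℝ f x) from
        (L.hasFDerivAt.comp x hx.hasFDerivAt).fderiv, map_smul, smul_eq_mul, mul_comm]
      rfl
    have e2 : ∫ x, L ((fderiv ℝ φ x v) • f x) = - ∫ x, lineDeriv ℝ φ x (-v) * L (f x) := by
      rw [← integral_neg]
      refine integral_congr_ae (Eventually.of_forall fun x => ?_)
      have hd : DifferentiableAt ℝ φ x := (h1.differentiable (by simp)).differentiableAt
      change L ((fderiv ℝ φ x v) • f x) = -(lineDeriv ℝ φ x (-v) * L (f x))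
      rw [hd.lineDeriv_eq_fderiv, map_neg, map_smul, smul_eq_mul]
      ring
    rw [e1, e2, e]
  apply Complex.ext
  · exact key Complex.reCLM
  · exact key Complex.imCLM

theorem isWeakGradient_of_lipschitz {f : EuclideanSpace ℝ (Fin d) → ℂ} {C : ℝ≥0}
    (hf : LipschitzWith C f) :
    IsWeakGradient ((memLp_of_continuous hf.continuous).toLp f) ((memLp_vgrad hf).toLp _) := by
  intro φ h1 h2 h3 i
  have hsub : tsupport φ ⊆ unitCell d := h3.trans interior_subset
  have e1 : ∫ x in unitCell d, (fderiv ℝ φ x (EuclideanSpace.single i 1)) •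
      ((memLp_of_continuous hf.continuous).toLp f : L2 d) x =
      ∫ x, (fderiv ℝ φ x (EuclideanSpace.single i 1)) • f x := by
    rw [← setIntegral_eq_integral_of_forall_compl_eq_zero (s := unitCell d)
      (f := fun x => (fderiv ℝ φ x (EuclideanSpace.single i 1)) • f x)]
    · refine integral_congr_ae ?_
      filter_upwards [(memLp_of_continuous (d := d) hf.continuous).coeFn_toLp] with x hx
      rw [hx]
    · intro x hx
      have : fderiv ℝ φ x = 0 := by
        by_contra hne
        exact hx (hsub (support_fderiv_subset ℝ hne))
      simp [this]
  have e2 : ∫ x in unitCell d, φ x • ((memLp_vgrad hf).toLp _ : L2Vec d) x i =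
      ∫ x, φ x • fderiv ℝ f x (EuclideanSpace.single i 1) := by
    rw [← setIntegral_eq_integral_of_forall_compl_eq_zero (s := unitCell d)
      (f := fun x => φ x • fderiv ℝ f x (EuclideanSpace.single i 1))]
    · refine integral_congr_ae ?_
      filter_upwards [(memLp_vgrad hf).coeFn_toLp] with x hx
      rw [hx, vgrad_apply]
    · intro x hx
      have : φ x = 0 := by
        by_contra hne
        exact hx (hsub (subset_tsupport φ hne))
      simp [this]
  rw [e1, e2]
  exact integral_test_fderiv_of_lipschitz hf h1 h2 _

/-- Lipschitz functions belong to `H¹(Y)`. -/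
theorem exists_H1_of_lipschitz {f : EuclideanSpace ℝ (Fin d) → ℂ} {C : ℝ≥0}
    (hf : LipschitzWith C f) :
    ∃ w : H1 d, w.1.fst =ᵐ[cellMeasure d] f ∧ w.1.snd =ᵐ[cellMeasure d] vgrad f :=
  ⟨⟨WithLp.toLp 2 ((memLp_of_continuous hf.continuous).toLp f, (memLp_vgrad hf).toLp _),
    isWeakGradient_of_lipschitz hf⟩,
    (memLp_of_continuous hf.continuous).coeFn_toLp, (memLp_vgrad hf).coeFn_toLp⟩

theorem integral_cell_sub_mean {f : EuclideanSpace ℝ (Fin d) → ℂ} (hf : Integrable f (cellMeasure d)) :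
    ∫ x in unitCell d, (f x - ∫ y in unitCell d, f y) = 0 := by
  rw [integral_sub hf (integrable_const _), integral_cell_const, sub_self]

theorem vgrad_sub_const (f : EuclideanSpace ℝ (Fin d) → ℂ) (c : ℂ) :
    vgrad (fun x => f x - c) = vgrad f := by
  funext x
  ext i
  simp [vgrad, fderiv_sub_const]

/-- Every Lipschitz function becomes an element of `𝓗` by subtraction of its mean. -/
theorem exists_energy_of_lipschitz {f : EuclideanSpace ℝ (Fin d) → ℂ} {C : ℝ≥0}
    (hf : LipschitzWith C f) :
    ∃ u : EnergySpace d, u.1.fst =ᵐ[cellMeasure d] (fun x => f x - ∫ y in unitCell d, f y) ∧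
      grad u =ᵐ[cellMeasure d] vgrad f := by
  have hf' : LipschitzWith C (fun x => f x - ∫ y in unitCell d, f y) :=
    LipschitzWith.of_dist_le_mul fun x y => by
      rw [dist_sub_right]; exact hf.dist_le_mul x y
  obtain ⟨w, h1, h2⟩ := exists_H1_of_lipschitz hf'
  rw [vgrad_sub_const] at h2
  refine ⟨⟨w.1, w.2, ?_⟩, h1, h2⟩
  change ∫ x in unitCell d, w.1.fst x = 0
  rw [integral_congr_ae h1]
  exact integral_cell_sub_mean ((memLp_of_continuous hf.continuous).integrable one_le_two)

/-- An element of `𝓗` represented by a Lipschitz function has the classical gradient. -/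
theorem grad_eq_vgrad {f : EuclideanSpace ℝ (Fin d) → ℂ} {C : ℝ≥0} (hf : LipschitzWith C f)
    (u : EnergySpace d) (hu : u.1.fst =ᵐ[cellMeasure d] f) : grad u =ᵐ[cellMeasure d] vgrad f := by
  obtain ⟨w, h1, h2⟩ := exists_H1_of_lipschitz hf
  have : energyToH1 u = w := eq_of_fst_eq (Lp.ext (hu.trans h1.symm))
  have h3 : grad u = w.1.snd := congrArg (fun w : H1 d => w.1.snd) this
  rw [h3]
  exact h2

end NeumannCell

/-! ### Integration by parts up to the boundary of the cell -/

namespace NeumannCell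

variable {d : ℕ}

/-- A smooth cutoff function of one variable: it vanishes outside `[1/n, 1 - 1/n]`, and its
derivative vanishes on `[2/n, 1 - 2/n]`. -/
noncomputable def edgeCutoff (n : ℕ) (t : ℝ) : ℝ :=
  Real.smoothTransition (n * t - 1) * Real.smoothTransition (n * (1 - t) - 1)

theorem contDiff_edgeCutoff (n : ℕ) : ContDiff ℝ ∞ (edgeCutoff n) := by
  have h1 : ContDiff ℝ ∞ (fun t : ℝ => (n : ℝ) * t - 1) := by fun_prop
  have h2 : ContDiff ℝ ∞ (fun t : ℝ => (n : ℝ) * (1 - t) - 1) := by fun_prop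
  exact (Real.smoothTransition.contDiff.comp h1).mul (Real.smoothTransition.contDiff.comp h2)

theorem edgeCutoff_nonneg (n : ℕ) (t : ℝ) : 0 ≤ edgeCutoff n t :=
  mul_nonneg (Real.smoothTransition.nonneg _) (Real.smoothTransition.nonneg _)

theorem edgeCutoff_le_one (n : ℕ) (t : ℝ) : edgeCutoff n t ≤ 1 :=
  mul_le_one₀ (Real.smoothTransition.le_one _) (Real.smoothTransition.nonneg _)
    (Real.smoothTransition.le_one _)

theorem edgeCutoff_ne_zero {n : ℕ} {t : ℝ} (h : edgeCutoff n t ≠ 0) : 1 ≤ n * t ∧ 1 ≤ n * (1 - t) := by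
  constructor
  · by_contra h1
    exact h (by rw [edgeCutoff, Real.smoothTransition.zero_of_nonpos (by linarith), zero_mul])
  · by_contra h1
    exact h (by rw [edgeCutoff, Real.smoothTransition.zero_of_nonpos (x := n * (1 - t) - 1)
      (by linarith), mul_zero])

theorem edgeCutoff_eq_one {n : ℕ} {t : ℝ} (h1 : 2 ≤ n * t) (h2 : 2 ≤ n * (1 - t)) :
    edgeCutoff n t = 1 := by
  rw [edgeCutoff, Real.smoothTransition.one_of_one_le (by linarith),
    Real.smoothTransition.one_of_one_le (by linarith), one_mul]

theorem deriv_smoothTransition_eq_zero {s : ℝ} (hs : s ∉ Set.Icc (0 : ℝ) 1) :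
    deriv Real.smoothTransition s = 0 := by
  rw [Set.mem_Icc, not_and_or, not_le, not_le] at hs
  rcases hs with hs | hs
  · have : Real.smoothTransition =ᶠ[𝓝 s] fun _ => 0 := by
      filter_upwards [Iio_mem_nhds hs] with t ht
      exact Real.smoothTransition.zero_of_nonpos (le_of_lt ht)
    rw [this.deriv_eq, deriv_const]
  · have : Real.smoothTransition =ᶠ[𝓝 s] fun _ => 1 := by
      filter_upwards [Ioi_mem_nhds hs] with t ht
      exact Real.smoothTransition.one_of_one_le (le_of_lt ht)
    rw [this.deriv_eq, deriv_const]

theorem exists_bound_deriv_smoothTransition :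
    ∃ B : ℝ, 0 ≤ B ∧ ∀ s, |deriv Real.smoothTransition s| ≤ B := by
  have hc : Continuous (deriv Real.smoothTransition) :=
    (Real.smoothTransition.contDiff (n := 1)).continuous_deriv le_rfl
  obtain ⟨B, hB⟩ := (isCompact_Icc (a := (0 : ℝ)) (b := 1)).exists_bound_of_continuousOn
    hc.continuousOn
  refine ⟨max B 0, le_max_right _ _, fun s => ?_⟩
  by_cases hs : s ∈ Set.Icc (0 : ℝ) 1
  · exact (hB s hs).trans (le_max_left _ _)
  · rw [deriv_smoothTransition_eq_zero hs, abs_zero]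
    exact le_max_right _ _

theorem hasDerivAt_edgeCutoff (n : ℕ) (t : ℝ) :
    HasDerivAt (edgeCutoff n)
      (n * deriv Real.smoothTransition (n * t - 1) * Real.smoothTransition (n * (1 - t) - 1)
        - Real.smoothTransition (n * t - 1) * (n * deriv Real.smoothTransition (n * (1 - t) - 1)))
      t := by
  have hd : ∀ s, HasDerivAt Real.smoothTransition (deriv Real.smoothTransition s) s := fun s =>
    ((Real.smoothTransition.contDiff (n := 1)).differentiable one_ne_zero s).hasDerivAt
  have h1 : HasDerivAt (fun t : ℝ => (n : ℝ) * t - 1) n t := by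
    simpa using ((hasDerivAt_id t).const_mul (n : ℝ)).sub_const 1
  have h2 : HasDerivAt (fun t : ℝ => (n : ℝ) * (1 - t) - 1) (-n) t := by
    simpa using (((hasDerivAt_id t).const_sub 1).const_mul (n : ℝ)).sub_const 1
  have := ((hd _).comp t h1).mul ((hd _).comp t h2)
  refine this.congr_deriv ?_
  simp only [Function.comp_apply]
  ring

/-- A function vanishing linearly at both ends of `[0, 1]` compensates the growth of the derivative
of the cutoff. -/
theorem abs_mul_deriv_edgeCutoff_le {B : ℝ} (hB : ∀ s, |deriv Real.smoothTransition s| ≤ B) {C a t : ℝ}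
    (ht : t ∈ Set.Ioc (0 : ℝ) 1) (h1 : |a| ≤ C * t) (h2 : |a| ≤ C * (1 - t)) (n : ℕ) :
    |a * deriv (edgeCutoff n) t| ≤ 4 * (C * B) := by
  have hB0 : 0 ≤ B := (abs_nonneg _).trans (hB 0)
  have hC : 0 ≤ C := by
    by_contra hC
    nlinarith [abs_nonneg a, ht.1]
  -- for `τ` the distance to one of the ends
  have key : ∀ τ : ℝ, 0 ≤ τ → |a| ≤ C * τ →
      |a| * (n * |deriv Real.smoothTransition (n * τ - 1)|) ≤ 2 * (C * B) := by
    intro τ hτ ha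
    by_cases hs : (n : ℝ) * τ - 1 ∈ Set.Icc (0 : ℝ) 1
    · have h3 : (n : ℝ) * τ ≤ 2 := by linarith [hs.2]
      calc |a| * (n * |deriv Real.smoothTransition (n * τ - 1)|) ≤ (C * τ) * (n * B) := by
            gcongr
            exact hB _
        _ = (n * τ) * (C * B) := by ring
        _ ≤ 2 * (C * B) := by gcongr
    · rw [deriv_smoothTransition_eq_zero hs]
      simp only [abs_zero, mul_zero]
      positivity
  have k1 := key t ht.1.le h1
  have k2 := key (1 - t) (by linarith [ht.2]) h2
  rw [(hasDerivAt_edgeCutoff n t).deriv, mul_sub]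
  refine (abs_sub _ _).trans ?_
  have e1 : |a * (n * deriv Real.smoothTransition (n * t - 1) *
      Real.smoothTransition (n * (1 - t) - 1))| ≤ 2 * (C * B) := by
    rw [abs_mul, abs_mul, abs_mul, Nat.abs_cast, abs_of_nonneg (Real.smoothTransition.nonneg _)]
    refine le_trans ?_ k1
    refine mul_le_mul_of_nonneg_left ?_ (abs_nonneg _)
    exact mul_le_of_le_one_right (mul_nonneg n.cast_nonneg (abs_nonneg _)) (Real.smoothTransition.le_one _)
  have e2 : |a * (Real.smoothTransition (n * t - 1) *
      (n * deriv Real.smoothTransition (n * (1 - t) - 1)))| ≤ 2 * (C * B) := by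
    rw [abs_mul, abs_mul, abs_mul, Nat.abs_cast, abs_of_nonneg (Real.smoothTransition.nonneg _)]
    refine le_trans ?_ k2
    refine mul_le_mul_of_nonneg_left ?_ (abs_nonneg _)
    exact mul_le_of_le_one_left (mul_nonneg n.cast_nonneg (abs_nonneg _)) (Real.smoothTransition.le_one _)
  linarith

theorem deriv_edgeCutoff_eq_zero {n : ℕ} {t : ℝ} (h1 : 2 < n * t) (h2 : 2 < n * (1 - t)) :
    deriv (edgeCutoff n) t = 0 := by
  rw [(hasDerivAt_edgeCutoff n t).deriv, deriv_smoothTransition_eq_zero, deriv_smoothTransition_eq_zero]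
  · simp
  · intro h; linarith [h.2]
  · intro h; linarith [h.2]

/-- The product of the one dimensional cutoffs in all coordinates. -/
noncomputable def cellCutoff (n : ℕ) (x : EuclideanSpace ℝ (Fin d)) : ℝ := ∏ j, edgeCutoff n (x j)

theorem contDiff_cellCutoff (n : ℕ) : ContDiff ℝ ∞ (cellCutoff (d := d) n) := by
  refine contDiff_prod fun j _ => (contDiff_edgeCutoff n).comp ?_
  exact (EuclideanSpace.proj (𝕜 := ℝ) j).contDiff

theorem isOpen_openCell (d : ℕ) :
    IsOpen {x : EuclideanSpace ℝ (Fin d) | ∀ j, x j ∈ Set.Ioo (0 : ℝ) 1} := by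
  rw [show {x : EuclideanSpace ℝ (Fin d) | ∀ j, x j ∈ Set.Ioo (0 : ℝ) 1} =
    ⋂ j, (EuclideanSpace.proj (𝕜 := ℝ) j) ⁻¹' Set.Ioo (0 : ℝ) 1 by ext; simp]
  exact isOpen_iInter_of_finite fun j =>
    isOpen_Ioo.preimage (EuclideanSpace.proj (𝕜 := ℝ) j).continuous

theorem openCell_subset_interior (d : ℕ) :
    {x : EuclideanSpace ℝ (Fin d) | ∀ j, x j ∈ Set.Ioo (0 : ℝ) 1} ⊆ interior (unitCell d) :=
  interior_maximal (fun _ hx j => ⟨(hx j).1, (hx j).2.le⟩) (isOpen_openCell d)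

theorem mem_openCell_of_mem_interior {x : EuclideanSpace ℝ (Fin d)} (hx : x ∈ interior (unitCell d))
    (j : Fin d) : x j ∈ Set.Ioo (0 : ℝ) 1 := by
  refine ⟨(interior_subset hx j).1, lt_of_le_of_ne (interior_subset hx j).2 fun h => ?_⟩
  -- moving a boundary point outwards leaves the cell
  have hc : Tendsto (fun t : ℝ => x + t • EuclideanSpace.single j (1 : ℝ)) (𝓝[>] 0) (𝓝 x) := by
    have : Continuous (fun t : ℝ => x + t • EuclideanSpace.single j (1 : ℝ)) := by fun_prop
    have h2 := this.tendsto 0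
    simp only [zero_smul, add_zero] at h2
    exact h2.mono_left nhdsWithin_le_nhds
  have hev := hc.eventually (isOpen_interior.mem_nhds hx)
  obtain ⟨t, ht, ht0⟩ := (hev.and self_mem_nhdsWithin).exists
  have := (interior_subset ht j).2
  simp [h] at this
  exact absurd this (not_le.2 ht0)

theorem tsupport_cellCutoff_subset {n : ℕ} (hn : 0 < n) :
    tsupport (cellCutoff (d := d) n) ⊆ {x | ∀ j, x j ∈ Set.Ioo (0 : ℝ) 1} := by
  have hsub : tsupport (cellCutoff (d := d) n) ⊆ {x | ∀ j, 1 ≤ n * x j ∧ 1 ≤ n * (1 - x j)} := by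
    refine closure_minimal (fun x hx j => edgeCutoff_ne_zero ?_) ?_
    · exact Finset.prod_ne_zero_iff.1 hx j (Finset.mem_univ j)
    · simp only [Set.ofPred_forall]
      refine isClosed_iInter fun j => ?_
      have hj : Continuous fun x : EuclideanSpace ℝ (Fin d) => x j :=
        (EuclideanSpace.proj (𝕜 := ℝ) j).continuous
      exact (isClosed_le continuous_const (continuous_const.mul hj)).inter
        (isClosed_le continuous_const (continuous_const.mul (continuous_const.sub hj)))
  intro x hx j
  have hn' : (0 : ℝ) < n := by exact_mod_cast hn
  obtain ⟨h1, h2⟩ := hsub hx j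
  constructor
  · by_contra h; nlinarith
  · by_contra h; nlinarith

/-- The derivative of a product in the direction of the `i`-th axis, when the other factor does not
depend on the `i`-th coordinate. -/
theorem fderiv_single_of_line {f : EuclideanSpace ℝ (Fin d) → ℝ} (hf : Differentiable ℝ f)
    (x : EuclideanSpace ℝ (Fin d)) (i : Fin d) {f' : ℝ}
    (h : HasDerivAt (fun t : ℝ => f (x + t • EuclideanSpace.single i 1)) f' 0) :
    fderiv ℝ f x (EuclideanSpace.single i 1) = f' := by
  rw [← (hf x).lineDeriv_eq_fderiv]
  exact h.deriv

theorem prod_line (h : Fin d → ℝ → ℝ) (x : EuclideanSpace ℝ (Fin d)) (i : Fin d) (t : ℝ) :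
    ∏ j, h j ((x + t • EuclideanSpace.single i (1 : ℝ)) j) =
      h i (x i + t) * ∏ j ∈ Finset.univ.erase i, h j (x j) := by
  rw [← Finset.mul_prod_erase Finset.univ _ (Finset.mem_univ i)]
  congr 1
  · simp
  · refine Finset.prod_congr rfl fun j hj => ?_
    have : j ≠ i := Finset.ne_of_mem_erase hj
    simp [this]

theorem hasDerivAt_prod_line {h : Fin d → ℝ → ℝ} (x : EuclideanSpace ℝ (Fin d)) (i : Fin d) {h' : ℝ}
    (hi : HasDerivAt (h i) h' (x i)) :
    HasDerivAt (fun t : ℝ => ∏ j, h j ((x + t • EuclideanSpace.single i (1 : ℝ)) j))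
      (h' * ∏ j ∈ Finset.univ.erase i, h j (x j)) 0 := by
  simp only [prod_line]
  have : HasDerivAt (fun t : ℝ => h i (x i + t)) h' 0 := by
    have h1 : HasDerivAt (fun t : ℝ => x i + t) 1 0 := (hasDerivAt_id 0).const_add _
    have h2 : HasDerivAt (h i) h' (x i + 0) := by rwa [add_zero]
    have h3 := h2.comp 0 h1
    rw [mul_one] at h3
    exact h3
  exact this.mul_const _

theorem fderiv_cellCutoff (n : ℕ) (x : EuclideanSpace ℝ (Fin d)) (i : Fin d) :
    fderiv ℝ (cellCutoff n) x (EuclideanSpace.single i 1) =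
      deriv (edgeCutoff n) (x i) * ∏ j ∈ Finset.univ.erase i, edgeCutoff n (x j) := by
  refine fderiv_single_of_line ((contDiff_cellCutoff n).differentiable (by simp)) x i ?_
  exact hasDerivAt_prod_line (h := fun _ => edgeCutoff n) x i
    (((contDiff_edgeCutoff n).differentiable (by simp)).differentiableAt.hasDerivAt)

theorem cellCutoff_mem_Icc (n : ℕ) (x : EuclideanSpace ℝ (Fin d)) :
    cellCutoff n x ∈ Set.Icc (0 : ℝ) 1 :=
  ⟨Finset.prod_nonneg fun _ _ => edgeCutoff_nonneg _ _,
    Finset.prod_le_one (fun _ _ => edgeCutoff_nonneg _ _) fun _ _ => edgeCutoff_le_one _ _⟩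

theorem eventually_edge {x : EuclideanSpace ℝ (Fin d)} (hx : ∀ j, x j ∈ Set.Ioo (0 : ℝ) 1) :
    ∀ᶠ n : ℕ in atTop, ∀ j, 2 < n * x j ∧ 2 < n * (1 - x j) := by
  rw [eventually_all]
  intro j
  have h1 : Tendsto (fun n : ℕ => (n : ℝ) * x j) atTop atTop :=
    tendsto_natCast_atTop_atTop.atTop_mul_const (hx j).1
  have h2 : Tendsto (fun n : ℕ => (n : ℝ) * (1 - x j)) atTop atTop :=
    tendsto_natCast_atTop_atTop.atTop_mul_const (sub_pos.2 (hx j).2)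
  exact (h1.eventually_gt_atTop 2).and (h2.eventually_gt_atTop 2)

/-- Integration by parts in the direction of the `i`-th axis against functions which vanish on the
two faces of the cell orthogonal to that axis, but not necessarily on the other faces. -/
theorem IsWeakGradient.integral_of_vanishing {u : L2 d} {g : L2Vec d} (h : IsWeakGradient u g)
    {ψ : EuclideanSpace ℝ (Fin d) → ℝ} (hψ : ContDiff ℝ ∞ ψ) (i : Fin d) {C : ℝ}
    (h1 : ∀ x ∈ unitCell d, |ψ x| ≤ C * x i) (h2 : ∀ x ∈ unitCell d, |ψ x| ≤ C * (1 - x i)) :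
    ∫ x in unitCell d, (fderiv ℝ ψ x (EuclideanSpace.single i 1)) • u x =
      - ∫ x in unitCell d, ψ x • g x i := by
  obtain ⟨B, hB0, hB⟩ := exists_bound_deriv_smoothTransition
  have hdψ : Continuous fun x => fderiv ℝ ψ x (EuclideanSpace.single i 1) :=
    (hψ.continuous_fderiv (by simp)).clm_apply continuous_const
  obtain ⟨M1, hM1⟩ := (isCompact_closure_unitCell d).exists_bound_of_continuousOn hdψ.continuousOn
  obtain ⟨M2, hM2⟩ := (isCompact_closure_unitCell d).exists_bound_of_continuousOn
    hψ.continuous.continuousOn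
  let φ : ℕ → EuclideanSpace ℝ (Fin d) → ℝ := fun n x => cellCutoff n x * ψ x
  have hφ : ∀ n, ContDiff ℝ ∞ (φ n) := fun n => (contDiff_cellCutoff n).mul hψ
  have hdφ : ∀ n x, fderiv ℝ (φ n) x (EuclideanSpace.single i 1) =
      cellCutoff n x * fderiv ℝ ψ x (EuclideanSpace.single i 1) +
      (ψ x * deriv (edgeCutoff n) (x i)) * ∏ j ∈ Finset.univ.erase i, edgeCutoff n (x j) := by
    intro n x
    have e := fderiv_fun_mul (((contDiff_cellCutoff n).differentiable (by simp)) x)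
      (hψ.differentiable (by simp) x)
    change fderiv ℝ (fun x => cellCutoff n x * ψ x) x _ = _
    rw [e]
    simp only [add_apply, smul_apply, smul_eq_mul,
      fderiv_cellCutoff]
    ring
  have hu : Integrable u (cellMeasure d) := (Lp.memLp u).integrable one_le_two
  have hg : Integrable (fun x => g x i) (cellMeasure d) :=
    ((EuclideanSpace.proj (𝕜 := ℂ) i).comp_memLp' (Lp.memLp g)).integrable one_le_two
  have hprod : ∀ n (x : EuclideanSpace ℝ (Fin d)),
      |∏ j ∈ Finset.univ.erase i, edgeCutoff n (x j)| ≤ 1 := fun n x => by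
    rw [abs_of_nonneg (Finset.prod_nonneg fun _ _ => edgeCutoff_nonneg _ _)]
    exact Finset.prod_le_one (fun _ _ => edgeCutoff_nonneg _ _) fun _ _ => edgeCutoff_le_one _ _
  have heq : ∀ᶠ n : ℕ in atTop,
      ∫ x in unitCell d, (fderiv ℝ (φ n) x (EuclideanSpace.single i 1)) • u x =
        - ∫ x in unitCell d, φ n x • g x i := by
    filter_upwards [eventually_gt_atTop 0] with n hn
    have hts : tsupport (φ n) ⊆ {x | ∀ j, x j ∈ Set.Ioo (0 : ℝ) 1} :=
      (tsupport_mul_subset_left (f := cellCutoff n) (g := ψ)).trans (tsupport_cellCutoff_subset hn)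
    have hsub := hts.trans (openCell_subset_interior d)
    refine h (φ n) (hφ n) ?_ hsub i
    exact (isCompact_closure_unitCell d).of_isClosed_subset (isClosed_tsupport _)
      (hsub.trans (interior_subset.trans subset_closure))
  have hL : Tendsto (fun n : ℕ =>
      ∫ x in unitCell d, (fderiv ℝ (φ n) x (EuclideanSpace.single i 1)) • u x) atTop
      (𝓝 (∫ x in unitCell d, (fderiv ℝ ψ x (EuclideanSpace.single i 1)) • u x)) := by
    refine tendsto_integral_of_dominated_convergence (fun x => (M1 + 4 * (C * B)) * ‖u x‖) ?_ ?_ ?_ ?_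
    · intro n
      exact (((hφ n).continuous_fderiv (by simp)).clm_apply
        continuous_const).aestronglyMeasurable.smul hu.aestronglyMeasurable
    · exact hu.norm.const_mul _
    · intro n
      rw [ae_restrict_iff' (measurableSet_unitCell d)]
      refine Eventually.of_forall fun x hx => ?_
      rw [norm_smul]
      gcongr
      rw [hdφ, Real.norm_eq_abs]
      refine (abs_add_le _ _).trans (add_le_add ?_ ?_)
      · rw [abs_mul, abs_of_nonneg (cellCutoff_mem_Icc n x).1]
        exact (mul_le_of_le_one_left (abs_nonneg _) (cellCutoff_mem_Icc n x).2).trans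
          (hM1 x (subset_closure hx))
      · rw [abs_mul]
        exact (mul_le_of_le_one_right (abs_nonneg _) (hprod n x)).trans
          (abs_mul_deriv_edgeCutoff_le hB (hx i) (h1 x hx) (h2 x hx) n)
    · filter_upwards [ae_mem_interior_unitCell d] with x hx
      refine tendsto_const_nhds.congr' ?_
      filter_upwards [eventually_edge (mem_openCell_of_mem_interior hx)] with n hn
      rw [hdφ, deriv_edgeCutoff_eq_zero (hn i).1 (hn i).2,
        show cellCutoff n x = 1 from Finset.prod_eq_one fun j _ =>
          edgeCutoff_eq_one (hn j).1.le (hn j).2.le]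
      simp
  have hR : Tendsto (fun n : ℕ => - ∫ x in unitCell d, φ n x • g x i) atTop
      (𝓝 (- ∫ x in unitCell d, ψ x • g x i)) := by
    refine Tendsto.neg ?_
    refine tendsto_integral_of_dominated_convergence (fun x => M2 * ‖g x i‖) ?_ ?_ ?_ ?_
    · intro n
      exact (hφ n).continuous.aestronglyMeasurable.smul hg.aestronglyMeasurable
    · exact hg.norm.const_mul _
    · intro n
      rw [ae_restrict_iff' (measurableSet_unitCell d)]
      refine Eventually.of_forall fun x hx => ?_
      rw [norm_smul]
      gcongr
      change |cellCutoff n x * ψ x| ≤ _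
      rw [abs_mul, abs_of_nonneg (cellCutoff_mem_Icc n x).1]
      exact (mul_le_of_le_one_left (abs_nonneg _) (cellCutoff_mem_Icc n x).2).trans
        (hM2 x (subset_closure hx))
    · filter_upwards [ae_mem_interior_unitCell d] with x hx
      refine tendsto_const_nhds.congr' ?_
      filter_upwards [eventually_edge (mem_openCell_of_mem_interior hx)] with n hn
      change _ = (cellCutoff n x * ψ x) • g x i
      rw [show cellCutoff n x = 1 from Finset.prod_eq_one fun j _ =>
          edgeCutoff_eq_one (hn j).1.le (hn j).2.le, one_mul]
  exact tendsto_nhds_unique (hL.congr' heq) hR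

end NeumannCell

/-! ### The Neumann eigenfunctions of the cell: products of cosines -/

namespace NeumannCell

variable {d : ℕ}

theorem norm_le_of_mem_unitCell {x : EuclideanSpace ℝ (Fin d)} (hx : x ∈ unitCell d) :
    ‖x‖ ≤ √(d : ℝ) := by
  rw [EuclideanSpace.norm_eq]
  refine Real.sqrt_le_sqrt ?_
  calc ∑ i, ‖x i‖ ^ 2 ≤ ∑ _i : Fin d, (1 : ℝ) := by
        gcongr with i
        rw [Real.norm_eq_abs, sq_abs]
        nlinarith [(hx i).1, (hx i).2]
    _ = d := by simp

/-- On the cell, every smooth function agrees with a smooth function of compact support. -/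
theorem exists_compactSupport_extension {f : EuclideanSpace ℝ (Fin d) → ℂ} (hf : ContDiff ℝ ∞ f) :
    ∃ f' : EuclideanSpace ℝ (Fin d) → ℂ, ContDiff ℝ ∞ f' ∧ HasCompactSupport f' ∧
      ∀ x ∈ unitCell d, f' x = f x ∧ vgrad f' x = vgrad f x := by
  let χ : ContDiffBump (0 : EuclideanSpace ℝ (Fin d)) :=
    ⟨√(d : ℝ) + 1, √(d : ℝ) + 2, by positivity, by linarith⟩
  refine ⟨fun x => χ x • f x, χ.contDiff.smul hf, χ.hasCompactSupport.smul_right, fun x hx => ?_⟩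
  have hev : (fun x => χ x • f x) =ᶠ[𝓝 x] f := by
    have hball : Metric.ball (0 : EuclideanSpace ℝ (Fin d)) (√(d : ℝ) + 1) ∈ 𝓝 x := by
      refine Metric.isOpen_ball.mem_nhds ?_
      rw [mem_ball_zero_iff]
      linarith [norm_le_of_mem_unitCell hx]
    filter_upwards [hball] with y hy
    rw [χ.one_of_mem_closedBall (Metric.ball_subset_closedBall hy), one_smul]
  refine ⟨hev.eq_of_nhds, ?_⟩
  ext i
  simp only [vgrad_apply, hev.fderiv_eq]

theorem exists_H1_of_contDiff {f : EuclideanSpace ℝ (Fin d) → ℂ} (hf : ContDiff ℝ ∞ f) :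
    ∃ w : H1 d, w.1.fst =ᵐ[cellMeasure d] f ∧ w.1.snd =ᵐ[cellMeasure d] vgrad f := by
  obtain ⟨f', h1, h2, h3⟩ := exists_compactSupport_extension hf
  obtain ⟨C, hC⟩ := h1.lipschitzWith_of_hasCompactSupport h2 (by simp)
  obtain ⟨w, hw1, hw2⟩ := exists_H1_of_lipschitz hC
  refine ⟨w, hw1.trans ?_, hw2.trans ?_⟩
  · exact (ae_restrict_iff' (measurableSet_unitCell d)).2 (Eventually.of_forall fun x hx => (h3 x hx).1)
  · exact (ae_restrict_iff' (measurableSet_unitCell d)).2 (Eventually.of_forall fun x hx => (h3 x hx).2)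

/-- The product of cosines `∏ cos (π m_j x_j)`. -/
noncomputable def cosProd (m : Fin d → ℤ) (x : EuclideanSpace ℝ (Fin d)) : ℝ :=
  ∏ j, Real.cos (Real.pi * m j * x j)

theorem contDiff_coord (j : Fin d) : ContDiff ℝ ∞ fun x : EuclideanSpace ℝ (Fin d) => x j :=
  (EuclideanSpace.proj (𝕜 := ℝ) j).contDiff

theorem contDiff_cosProd (m : Fin d → ℤ) : ContDiff ℝ ∞ (cosProd m) :=
  contDiff_prod fun j _ => Real.contDiff_cos.comp (contDiff_const.mul (contDiff_coord j))

theorem cosProd_zero : cosProd (0 : Fin d → ℤ) = fun _ => 1 := by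
  funext x
  simp [cosProd]

/-- Minus the derivative of `cosProd m` in the direction of the `i`-th axis. -/
noncomputable def cosProdDeriv (m : Fin d → ℤ) (i : Fin d) (x : EuclideanSpace ℝ (Fin d)) : ℝ :=
  ∏ j, if j = i then (Real.pi * m j) * Real.sin (Real.pi * m j * x j)
    else Real.cos (Real.pi * m j * x j)

theorem contDiff_cosProdDeriv (m : Fin d → ℤ) (i : Fin d) : ContDiff ℝ ∞ (cosProdDeriv m i) := by
  refine contDiff_prod fun j _ => ?_
  split_ifs
  · exact contDiff_const.mul (Real.contDiff_sin.comp (contDiff_const.mul (contDiff_coord j)))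
  · exact Real.contDiff_cos.comp (contDiff_const.mul (contDiff_coord j))

theorem hasDerivAt_cos_mul (a t : ℝ) :
    HasDerivAt (fun t => Real.cos (a * t)) (-(a * Real.sin (a * t))) t := by
  have h1 : HasDerivAt (fun t : ℝ => a * t) a t := by simpa using (hasDerivAt_id t).const_mul a
  refine ((Real.hasDerivAt_cos (a * t)).comp t h1).congr_deriv ?_
  ring

theorem hasDerivAt_sin_mul (a t : ℝ) :
    HasDerivAt (fun t => a * Real.sin (a * t)) (a ^ 2 * Real.cos (a * t)) t := by
  have h1 : HasDerivAt (fun t : ℝ => a * t) a t := by simpa using (hasDerivAt_id t).const_mul a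
  refine (((Real.hasDerivAt_sin (a * t)).comp t h1).const_mul a).congr_deriv ?_
  ring

theorem fderiv_cosProd (m : Fin d → ℤ) (i : Fin d) (x : EuclideanSpace ℝ (Fin d)) :
    fderiv ℝ (cosProd m) x (EuclideanSpace.single i 1) = - cosProdDeriv m i x := by
  have h := hasDerivAt_prod_line (h := fun j t => Real.cos (Real.pi * m j * t)) x i
    (hasDerivAt_cos_mul (Real.pi * m i) (x i))
  rw [fderiv_single_of_line ((contDiff_cosProd m).differentiable (by simp)) x i h, cosProdDeriv,
    ← Finset.mul_prod_erase Finset.univ _ (Finset.mem_univ i), if_pos rfl, neg_mul]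
  congr 2
  exact Finset.prod_congr rfl fun j hj => (if_neg (Finset.ne_of_mem_erase hj)).symm

theorem fderiv_cosProdDeriv (m : Fin d → ℤ) (i : Fin d) (x : EuclideanSpace ℝ (Fin d)) :
    fderiv ℝ (cosProdDeriv m i) x (EuclideanSpace.single i 1) =
      (Real.pi * m i) ^ 2 * cosProd m x := by
  have h := hasDerivAt_prod_line (h := fun j t => if j = i then (Real.pi * m j) *
    Real.sin (Real.pi * m j * t) else Real.cos (Real.pi * m j * t)) x i
    (h' := (Real.pi * m i) ^ 2 * Real.cos (Real.pi * m i * x i)) (by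
      simpa using hasDerivAt_sin_mul (Real.pi * m i) (x i))
  rw [fderiv_single_of_line ((contDiff_cosProdDeriv m i).differentiable (by simp)) x i h, cosProd,
    ← Finset.mul_prod_erase Finset.univ _ (Finset.mem_univ i), mul_assoc]
  congr 2
  exact Finset.prod_congr rfl fun j hj => if_neg (Finset.ne_of_mem_erase hj)

theorem abs_cosProdDeriv_le (m : Fin d → ℤ) (i : Fin d) (x : EuclideanSpace ℝ (Fin d)) :
    |cosProdDeriv m i x| ≤ |Real.pi * m i| * |Real.sin (Real.pi * m i * x i)| := by
  rw [cosProdDeriv, ← Finset.mul_prod_erase Finset.univ _ (Finset.mem_univ i), if_pos rfl, abs_mul,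
    abs_mul]
  refine mul_le_of_le_one_right (by positivity) ?_
  rw [Finset.abs_prod]
  refine Finset.prod_le_one (fun _ _ => abs_nonneg _) fun j hj => ?_
  rw [if_neg (Finset.ne_of_mem_erase hj)]
  exact Real.abs_cos_le_one _

theorem cosProdDeriv_vanishing (m : Fin d → ℤ) (i : Fin d) {x : EuclideanSpace ℝ (Fin d)}
    (hx : x ∈ unitCell d) :
    |cosProdDeriv m i x| ≤ (Real.pi * m i) ^ 2 * x i ∧
      |cosProdDeriv m i x| ≤ (Real.pi * m i) ^ 2 * (1 - x i) := by
  have h0 := abs_cosProdDeriv_le m i x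
  have key : ∀ t : ℝ, 0 ≤ t → |Real.pi * m i| * |Real.sin (Real.pi * m i * t)| ≤
      (Real.pi * m i) ^ 2 * t := by
    intro t ht
    have h1 : |Real.sin (Real.pi * m i * t)| ≤ |Real.pi * m i| * t := by
      refine Real.abs_sin_le_abs.trans ?_
      rw [abs_mul, abs_of_nonneg ht]
    calc |Real.pi * m i| * |Real.sin (Real.pi * m i * t)|
        ≤ |Real.pi * m i| * (|Real.pi * m i| * t) := by gcongr
      _ = (Real.pi * m i) ^ 2 * t := by rw [← mul_assoc, abs_mul_abs_self, sq]
  refine ⟨h0.trans (key _ (hx i).1.le), h0.trans ?_⟩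
  have h2 : |Real.sin (Real.pi * m i * x i)| = |Real.sin (Real.pi * m i * (1 - x i))| := by
    have := Real.sin_int_mul_pi_sub (Real.pi * m i * x i) (m i)
    rw [show Real.pi * m i * (1 - x i) = m i * Real.pi - Real.pi * m i * x i by ring, this, abs_neg,
      abs_mul, abs_zpow, abs_neg, abs_one, one_zpow, one_mul]
  rw [h2]
  exact key _ (by linarith [(hx i).2])

theorem vgrad_ofReal {F : EuclideanSpace ℝ (Fin d) → ℝ} (hF : Differentiable ℝ F)
    (x : EuclideanSpace ℝ (Fin d)) (i : Fin d) :
    vgrad (fun x => (F x : ℂ)) x i = (fderiv ℝ F x (EuclideanSpace.single i 1) : ℝ) := by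
  rw [vgrad_apply]
  have : HasFDerivAt (fun x => (F x : ℂ)) (Complex.ofRealCLM.comp (fderiv ℝ F x)) x :=
    Complex.ofRealCLM.hasFDerivAt.comp x (hF x).hasFDerivAt
  rw [this.fderiv]
  rfl

theorem contDiff_cosProd_complex (m : Fin d → ℤ) :
    ContDiff ℝ ∞ fun x : EuclideanSpace ℝ (Fin d) => (cosProd m x : ℂ) :=
  Complex.ofRealCLM.contDiff.comp (contDiff_cosProd m)

/-- The product of cosines as an element of `H¹(Y)`. -/
noncomputable def cosH1 (m : Fin d → ℤ) : H1 d :=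
  (exists_H1_of_contDiff (contDiff_cosProd_complex m)).choose

theorem cosH1_fst (m : Fin d → ℤ) :
    (cosH1 m).1.fst =ᵐ[cellMeasure d] fun x => (cosProd m x : ℂ) :=
  (exists_H1_of_contDiff (contDiff_cosProd_complex m)).choose_spec.1

theorem cosH1_snd (m : Fin d → ℤ) :
    (cosH1 m).1.snd =ᵐ[cellMeasure d] vgrad fun x => (cosProd m x : ℂ) :=
  (exists_H1_of_contDiff (contDiff_cosProd_complex m)).choose_spec.2

theorem inner_cosH1_fst (m : Fin d → ℤ) (u : L2 d) :
    inner ℂ (cosH1 m).1.fst u = ∫ x in unitCell d, cosProd m x • u x := by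
  rw [MeasureTheory.L2.inner_def]
  refine integral_congr_ae ?_
  filter_upwards [cosH1_fst m] with x hx
  rw [hx]
  simp [mul_comm]

/-- The weak form of `-∂ᵢ² cos = (π mᵢ)² cos` with Neumann conditions: no boundary terms arise
because `∂ᵢ cosProd m` vanishes on the faces orthogonal to the `i`-th axis. -/
theorem inner_coord_cosH1 (m : Fin d → ℤ) (u : H1 d) (i : Fin d) :
    inner ℂ (coordL i (cosH1 m).1.snd) (coordL i u.1.snd) =
      ((Real.pi * m i) ^ 2 : ℝ) * inner ℂ (cosH1 m).1.fst u.1.fst := by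
  have h := u.2.integral_of_vanishing (contDiff_cosProdDeriv m i) i
    (fun x hx => (cosProdDeriv_vanishing m i hx).1) (fun x hx => (cosProdDeriv_vanishing m i hx).2)
  rw [inner_cosH1_fst, MeasureTheory.L2.inner_def]
  have e1 : ∫ x in unitCell d, (fderiv ℝ (cosProdDeriv m i) x (EuclideanSpace.single i 1)) •
      u.1.fst x = ((Real.pi * m i) ^ 2 : ℝ) * ∫ x in unitCell d, cosProd m x • u.1.fst x := by
    rw [← integral_const_mul]
    refine integral_congr_ae (Eventually.of_forall fun x => ?_)
    simp only [fderiv_cosProdDeriv, Complex.real_smul]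
    push_cast
    ring
  rw [← e1, h, ← integral_neg]
  refine integral_congr_ae ?_
  filter_upwards [coordL_coeFn i (cosH1 m).1.snd, coordL_coeFn i u.1.snd, cosH1_snd m] with x h1 h2 h3
  rw [h1, h2, h3, vgrad_ofReal ((contDiff_cosProd m).differentiable (by simp)), fderiv_cosProd]
  simp only [RCLike.inner_apply, Complex.conj_ofReal, Complex.real_smul]
  push_cast
  ring

theorem inner_L2Vec (g h : L2Vec d) : inner ℂ g h = ∑ i, inner ℂ (coordL i g) (coordL i h) := by
  simp only [MeasureTheory.L2.inner_def]
  rw [← integral_finsetSum _ fun i _ => MeasureTheory.L2.integrable_inner _ _]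
  refine integral_congr_ae ?_
  filter_upwards [ae_all_iff.2 fun i => coordL_coeFn i g, ae_all_iff.2 fun i => coordL_coeFn i h]
    with x h1 h2
  simp only [PiLp.inner_apply, h1, h2]

/-- The eigenvalue of the Neumann Laplacian for the eigenfunction `cosProd m`. -/
noncomputable def cosEigenvalue (m : Fin d → ℤ) : ℝ := ∑ i, (Real.pi * m i) ^ 2

theorem inner_snd_cosH1 (m : Fin d → ℤ) (u : H1 d) :
    inner ℂ (cosH1 m).1.snd u.1.snd = cosEigenvalue m * inner ℂ (cosH1 m).1.fst u.1.fst := by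
  rw [inner_L2Vec, cosEigenvalue, Complex.ofReal_sum, Finset.sum_mul]
  exact Finset.sum_congr rfl fun i _ => inner_coord_cosH1 m u i

theorem inner_cosH1_ofReal (m n : Fin d → ℤ) : ∃ a : ℝ, inner ℂ (cosH1 m).1.fst (cosH1 n).1.fst = a := by
  refine ⟨∫ x in unitCell d, cosProd m x * cosProd n x, ?_⟩
  rw [inner_cosH1_fst, ← integral_complex_ofReal]
  refine integral_congr_ae ?_
  filter_upwards [cosH1_fst n] with x hx
  rw [hx]
  simp

theorem inner_cosH1_eq_zero {m n : Fin d → ℤ} (i : Fin d) (h : (m i) ^ 2 ≠ (n i) ^ 2) :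
    inner ℂ (cosH1 m).1.fst (cosH1 n).1.fst = 0 := by
  have h1 := inner_coord_cosH1 m (cosH1 n) i
  have h2 := inner_coord_cosH1 n (cosH1 m) i
  rw [← inner_conj_symm, h1, map_mul, Complex.conj_ofReal, inner_conj_symm] at h2
  obtain ⟨a, ha⟩ := inner_cosH1_ofReal m n
  obtain ⟨b, hb⟩ := inner_cosH1_ofReal n m
  have hab : b = a := by
    have := inner_conj_symm (𝕜 := ℂ) (cosH1 m).1.fst (cosH1 n).1.fst
    rw [ha, hb, Complex.conj_ofReal] at this
    exact_mod_cast this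
  rw [hb, hab] at h2
  rw [ha]
  have h3 : (Real.pi * m i) ^ 2 * a = (Real.pi * n i) ^ 2 * a := by exact_mod_cast h2
  have h4 : (Real.pi * m i) ^ 2 - (Real.pi * n i) ^ 2 ≠ 0 := by
    rw [mul_pow, mul_pow, ← mul_sub]
    refine mul_ne_zero (pow_ne_zero _ Real.pi_ne_zero) (sub_ne_zero.2 ?_)
    exact_mod_cast h
  have h5 : a = 0 := by
    have : ((Real.pi * m i) ^ 2 - (Real.pi * n i) ^ 2) * a = 0 := by linarith
    exact (mul_eq_zero.1 this).resolve_left h4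
  rw [h5, Complex.ofReal_zero]

theorem closure_unitCell_subset (d : ℕ) :
    closure (unitCell d) ⊆ {x | ∀ j, x j ∈ Set.Icc (0 : ℝ) 1} := by
  refine closure_minimal (fun x hx j => ⟨(hx j).1.le, (hx j).2⟩) ?_
  simp only [Set.ofPred_forall]
  exact isClosed_iInter fun j => isClosed_Icc.preimage (EuclideanSpace.proj (𝕜 := ℝ) j).continuous

theorem cosH1_fst_ne_zero (m : Fin d → ℤ) : (cosH1 m).1.fst ≠ 0 := by
  intro h0
  -- near the corner `0` of the cell the product of cosines is positive
  let M : ℝ := ∑ j, |(m j : ℝ)|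
  have hM : 0 ≤ M := Finset.sum_nonneg fun _ _ => abs_nonneg _
  let s : ℝ := 1 / (2 * (M + 1))
  have hs : 0 < s := by positivity
  have hs1 : s < 1 := by
    rw [div_lt_one (by positivity)]
    linarith
  let p : EuclideanSpace ℝ (Fin d) := WithLp.toLp 2 fun _ => s
  have hp : cosProd m p ≠ 0 := by
    refine Finset.prod_ne_zero_iff.2 fun j _ => (Real.cos_pos_of_mem_Ioo ?_).ne'
    have h1 : |(m j : ℝ) * s| < 1 / 2 := by
      rw [abs_mul, abs_of_pos hs]
      have h2 : |(m j : ℝ)| ≤ M :=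
        Finset.single_le_sum (f := fun j => |(m j : ℝ)|) (fun _ _ => abs_nonneg _) (Finset.mem_univ j)
      have h3 : (M + 1) * s = 1 / 2 := by simp only [s]; field_simp
      nlinarith
    have h4 := abs_lt.1 h1
    change Real.pi * m j * s ∈ _
    constructor
    · nlinarith [Real.pi_pos]
    · nlinarith [Real.pi_pos]
  let U := {x : EuclideanSpace ℝ (Fin d) | ∀ j, x j ∈ Set.Ioo (0 : ℝ) 1} ∩ {x | cosProd m x ≠ 0}
  have hU : IsOpen U := (isOpen_openCell d).inter
    (isOpen_ne_fun (contDiff_cosProd m).continuous continuous_const)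
  have hne : U.Nonempty := ⟨p, fun j => ⟨hs, hs1⟩, hp⟩
  have hae : ∀ᵐ x ∂(cellMeasure d), cosProd m x = 0 := by
    filter_upwards [cosH1_fst m, Lp.coeFn_zero ℂ 2 (cellMeasure d)] with x h1 h2
    rw [h0, h2, Pi.zero_apply] at h1
    exact_mod_cast h1.symm
  rw [ae_restrict_iff' (measurableSet_unitCell d)] at hae
  refine (hU.measure_pos volume hne).ne' (measure_mono_null ?_ (mem_ae_iff.1 hae))
  rintro x ⟨hx1, hx2⟩ hx3
  exact hx2 (hx3 (interior_subset (openCell_subset_interior d hx1)))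

/-! ### Completeness of the cosines -/

/-- `cosProd m` as a bundled continuous function. -/
noncomputable def cosC (m : Fin d → ℤ) : C(EuclideanSpace ℝ (Fin d), ℝ) :=
  ⟨cosProd m, (contDiff_cosProd m).continuous⟩

/-- The addition formula: the span of the products of cosines is stable under multiplication by
the generators `cos (π x_j)`. -/
theorem cosC_mul (j : Fin d) (m : Fin d → ℤ) :
    cosC (Pi.single j 1) * cosC m =
      (1 / 2 : ℝ) • (cosC (m + Pi.single j 1) + cosC (m - Pi.single j 1)) := by
  ext x
  change cosProd _ x * cosProd _ x = (1 / 2 : ℝ) * (cosProd _ x + cosProd _ x)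
  simp only [cosProd, ← Finset.mul_prod_erase Finset.univ _ (Finset.mem_univ j)]
  have e1 : ∏ i ∈ Finset.univ.erase j, Real.cos (Real.pi * (Pi.single j 1 : Fin d → ℤ) i * x i) = 1 :=
    Finset.prod_eq_one fun i hi => by simp [Pi.single_eq_of_ne (Finset.ne_of_mem_erase hi)]
  have e2 : ∏ i ∈ Finset.univ.erase j, Real.cos (Real.pi * ((m + Pi.single j 1 : Fin d → ℤ) i : ℤ) * x i) =
      ∏ i ∈ Finset.univ.erase j, Real.cos (Real.pi * m i * x i) :=
    Finset.prod_congr rfl fun i hi => by simp [Pi.single_eq_of_ne (Finset.ne_of_mem_erase hi)]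
  have e3 : ∏ i ∈ Finset.univ.erase j, Real.cos (Real.pi * ((m - Pi.single j 1 : Fin d → ℤ) i : ℤ) * x i) =
      ∏ i ∈ Finset.univ.erase j, Real.cos (Real.pi * m i * x i) :=
    Finset.prod_congr rfl fun i hi => by simp [Pi.single_eq_of_ne (Finset.ne_of_mem_erase hi)]
  simp only [Pi.add_apply, Pi.sub_apply, Pi.single_eq_same] at e1 e2 e3 ⊢
  rw [e1, e2, e3]
  push_cast
  rw [← add_mul,
    show Real.pi * ((m j : ℝ) + 1) * x j = Real.pi * m j * x j + Real.pi * x j by ring,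
    show Real.pi * ((m j : ℝ) - 1) * x j = Real.pi * m j * x j - Real.pi * x j by ring, Real.cos_add,
    Real.cos_sub]
  simp only [mul_one]
  ring

/-- The algebra generated by the functions `cos (π x_j)`. -/
noncomputable def cosAlgebra (d : ℕ) : Subalgebra ℝ C(EuclideanSpace ℝ (Fin d), ℝ) :=
  Algebra.adjoin ℝ (Set.range fun j : Fin d => cosC (Pi.single j 1))

theorem cosAlgebra_le_span (d : ℕ) {f : C(EuclideanSpace ℝ (Fin d), ℝ)} (hf : f ∈ cosAlgebra d) :
    f ∈ Submodule.span ℝ (Set.range (cosC (d := d))) := by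
  have key : ∀ g ∈ Submodule.span ℝ (Set.range (cosC (d := d))),
      f * g ∈ Submodule.span ℝ (Set.range (cosC (d := d))) := by
    refine Algebra.adjoin_induction (p := fun f _ =>
      ∀ g ∈ Submodule.span ℝ (Set.range (cosC (d := d))),
        f * g ∈ Submodule.span ℝ (Set.range (cosC (d := d)))) ?_ ?_ ?_ ?_ hf
    · rintro _ ⟨j, rfl⟩ g hg
      induction hg using Submodule.span_induction with
      | mem g hg =>
        obtain ⟨m, rfl⟩ := hg
        rw [cosC_mul]
        exact Submodule.smul_mem _ _ (Submodule.add_mem _ (Submodule.subset_span ⟨_, rfl⟩)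
          (Submodule.subset_span ⟨_, rfl⟩))
      | zero => rw [mul_zero]; exact Submodule.zero_mem _
      | add g h _ _ hg hh => rw [mul_add]; exact Submodule.add_mem _ hg hh
      | smul c g _ hg => rw [mul_smul_comm]; exact Submodule.smul_mem _ _ hg
    · intro r g hg
      rw [← Algebra.smul_def]
      exact Submodule.smul_mem _ _ hg
    · intro f1 f2 _ _ h1 h2 g hg
      rw [add_mul]
      exact Submodule.add_mem _ (h1 g hg) (h2 g hg)
    · intro f1 f2 _ _ h1 h2 g hg
      rw [mul_assoc]
      exact h1 _ (h2 g hg)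
  have h1 : (1 : C(EuclideanSpace ℝ (Fin d), ℝ)) ∈ Submodule.span ℝ (Set.range (cosC (d := d))) := by
    refine Submodule.subset_span ⟨0, ?_⟩
    ext x
    change cosProd 0 x = 1
    rw [cosProd_zero]
  simpa using key 1 h1

theorem exists_cosAlgebra_near (f : C(EuclideanSpace ℝ (Fin d), ℝ)) {ε : ℝ} (hε : 0 < ε) :
    ∃ g ∈ cosAlgebra d, ∀ x ∈ unitCell d, |g x - f x| < ε := by
  let K := closure (unitCell d)
  have hK : CompactSpace K := isCompact_iff_compactSpace.1 (isCompact_closure_unitCell d)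
  let res : C(EuclideanSpace ℝ (Fin d), ℝ) →⋆ₐ[ℝ] C(K, ℝ) :=
    ContinuousMap.compStarAlgHom' ℝ ℝ ⟨Subtype.val, continuous_subtype_val⟩
  let A : Subalgebra ℝ C(K, ℝ) := (cosAlgebra d).map res
  have hsep : A.SeparatesPoints := by
    intro x y hxy
    obtain ⟨j, hj⟩ : ∃ j, x.1 j ≠ y.1 j := by
      by_contra! h
      exact hxy (Subtype.ext (PiLp.ext h))
    refine ⟨_, ⟨res (cosC (Pi.single j 1)), ⟨_, Algebra.subset_adjoin ⟨j, rfl⟩, rfl⟩, rfl⟩, ?_⟩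
    have hval : ∀ z : K, res (cosC (Pi.single j 1)) z = Real.cos (Real.pi * z.1 j) := by
      intro z
      change cosProd _ z.1 = _
      rw [cosProd, Finset.prod_eq_single j]
      · simp
      · intro i _ hi
        simp [Pi.single_eq_of_ne hi]
      · simp
    change res (cosC (Pi.single j 1)) x ≠ res (cosC (Pi.single j 1)) y
    rw [hval, hval]
    intro h
    have hmem : ∀ z : K, Real.pi * z.1 j ∈ Set.Icc 0 Real.pi := by
      intro z
      have := closure_unitCell_subset d z.2 j
      exact ⟨mul_nonneg Real.pi_pos.le this.1, mul_le_of_le_one_right Real.pi_pos.le this.2⟩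
    exact hj (mul_left_cancel₀ Real.pi_ne_zero (Real.injOn_cos (hmem x) (hmem y) h))
  obtain ⟨g, hg⟩ := ContinuousMap.exists_mem_subalgebra_near_continuousMap_of_separatesPoints A hsep
    (res f) ε hε
  obtain ⟨g', hg', hgg⟩ := Subalgebra.mem_map.1 g.2
  refine ⟨g', hg', fun x hx => ?_⟩
  have h1 := (ContinuousMap.norm_lt_iff _ hε).1 hg ⟨x, subset_closure hx⟩
  rw [← hgg] at h1
  exact h1

/-- Completeness of the cosines: a square integrable function orthogonal to all of them is zero. -/
theorem eq_zero_of_inner_cosH1 (w : L2 d) (hw : ∀ m : Fin d → ℤ, inner ℂ (cosH1 m).1.fst w = 0) :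
    w = 0 := by
  have hwi : Integrable w (cellMeasure d) := (Lp.memLp w).integrable one_le_two
  have hint : ∀ f : C(EuclideanSpace ℝ (Fin d), ℝ),
      Integrable (fun x => f x • w x) (cellMeasure d) := fun f =>
    memLp_one_iff_integrable.1 ((Lp.memLp w).smul (p := 2) (q := 2) (r := 1)
      (memLp_of_continuous f.continuous))
  have hspan : ∀ f ∈ Submodule.span ℝ (Set.range (cosC (d := d))),
      ∫ x in unitCell d, f x • w x = 0 := by
    intro f hf
    induction hf using Submodule.span_induction with
    | mem f hf =>
      obtain ⟨m, rfl⟩ := hf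
      rw [← hw m, inner_cosH1_fst]
      rfl
    | zero => simp
    | add f g _ _ hf hg =>
      have : ∫ x in unitCell d, (f + g) x • w x =
          (∫ x in unitCell d, f x • w x) + ∫ x in unitCell d, g x • w x := by
        rw [← integral_add (hint f) (hint g)]
        simp only [ContinuousMap.add_apply, add_smul]
      rw [this, hf, hg, add_zero]
    | smul c f _ hf =>
      have : ∫ x in unitCell d, (c • f) x • w x = c • ∫ x in unitCell d, f x • w x := by
        rw [← integral_smul]
        simp only [ContinuousMap.smul_apply, smul_eq_mul, mul_smul]
      rw [this, hf, smul_zero]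
  have hzero : ∀ f : C(EuclideanSpace ℝ (Fin d), ℝ), ∫ x in unitCell d, f x • w x = 0 := by
    intro f
    by_contra hne
    have hpos := norm_pos_iff.2 hne
    set I := ∫ x in unitCell d, ‖w x‖
    have hI : 0 ≤ I := integral_nonneg fun _ => norm_nonneg _
    have hε : 0 < ‖∫ x in unitCell d, f x • w x‖ / (I + 1) := by positivity
    obtain ⟨g, hg, hgf⟩ := exists_cosAlgebra_near f hε
    have h0 := hspan g (cosAlgebra_le_span d hg)
    have h1 : ∫ x in unitCell d, f x • w x = - ∫ x in unitCell d, (g x - f x) • w x := by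
      have : ∫ x in unitCell d, (g x - f x) • w x =
          (∫ x in unitCell d, g x • w x) - ∫ x in unitCell d, f x • w x := by
        rw [← integral_sub (hint g) (hint f)]
        simp only [sub_smul]
      rw [this, h0, zero_sub, neg_neg]
    have h2 : ‖∫ x in unitCell d, f x • w x‖ ≤
        (‖∫ x in unitCell d, f x • w x‖ / (I + 1)) * I := by
      conv_lhs => rw [h1, norm_neg]
      rw [← integral_const_mul]
      refine norm_integral_le_of_norm_le (hwi.norm.const_mul _) ?_
      rw [ae_restrict_iff' (measurableSet_unitCell d)]
      refine Eventually.of_forall fun x hx => ?_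
      rw [norm_smul]
      exact mul_le_mul_of_nonneg_right (hgf x hx).le (norm_nonneg _)
    have h3 : (‖∫ x in unitCell d, f x • w x‖ / (I + 1)) * I < ‖∫ x in unitCell d, f x • w x‖ := by
      rw [div_mul_eq_mul_div, div_lt_iff₀ (by positivity)]
      nlinarith
    exact absurd h2 (not_le.2 h3)
  have hae := ae_eq_zero_of_integral_contDiff_smul_eq_zero hwi.locallyIntegrable
    (fun φ hφ _ => hzero ⟨φ, hφ.continuous⟩)
  refine Lp.ext ?_
  filter_upwards [hae, Lp.coeFn_zero ℂ 2 (cellMeasure d)] with x h1 h2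
  rw [h1, h2, Pi.zero_apply]

end NeumannCell

/-! ### Poincaré inequality, Rellich's theorem and density of smooth functions -/

namespace NeumannCell

variable {d : ℕ}

/-- The products of cosines with natural frequencies, normalized in `L²(Y)`. -/
noncomputable def cosBasisVec (m : Fin d → ℕ) : L2 d :=
  ((‖(cosH1 fun i => (m i : ℤ)).1.fst‖⁻¹ : ℝ) : ℂ) • (cosH1 fun i => (m i : ℤ)).1.fst

theorem inner_cosH1_nat_eq_zero {m n : Fin d → ℕ} (h : m ≠ n) :
    inner ℂ (cosH1 fun i => (m i : ℤ)).1.fst (cosH1 fun i => (n i : ℤ)).1.fst = 0 := by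
  obtain ⟨i, hi⟩ := Function.ne_iff.1 h
  refine inner_cosH1_eq_zero i fun h' => hi ?_
  have h2 : (m i) ^ 2 = (n i) ^ 2 := by exact_mod_cast h'
  exact Nat.pow_left_injective two_ne_zero h2

theorem orthonormal_cosBasisVec : Orthonormal ℂ (cosBasisVec (d := d)) := by
  refine ⟨fun m => ?_, fun m n h => ?_⟩
  · rw [cosBasisVec, norm_smul, Complex.norm_real, norm_inv, norm_norm]
    exact inv_mul_cancel₀ (norm_ne_zero_iff.2 (cosH1_fst_ne_zero _))
  · simp only [cosBasisVec, inner_smul_left, inner_smul_right, inner_cosH1_nat_eq_zero h, mul_zero]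

theorem cosProd_natAbs (m : Fin d → ℤ) : cosProd (fun i => ((m i).natAbs : ℤ)) = cosProd m := by
  funext x
  refine Finset.prod_congr rfl fun j _ => ?_
  rcases Int.natAbs_eq (m j) with h | h
  · change Real.cos (Real.pi * (((m j).natAbs : ℤ) : ℝ) * x j) = _
    rw [← h]
  · change Real.cos (Real.pi * (((m j).natAbs : ℤ) : ℝ) * x j) = _
    have : (((m j).natAbs : ℤ) : ℝ) = -(m j : ℝ) := by
      conv_rhs => rw [h]
      push_cast
      ring
    rw [this, mul_neg, neg_mul, Real.cos_neg]

theorem span_cosBasisVec_orthogonal :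
    (Submodule.span ℂ (Set.range (cosBasisVec (d := d))))ᗮ = ⊥ := by
  rw [eq_bot_iff]
  intro w hw
  refine (Submodule.mem_bot ℂ).2 (eq_zero_of_inner_cosH1 w fun m => ?_)
  have h1 := (Submodule.mem_orthogonal _ _).1 hw (cosBasisVec fun i => (m i).natAbs)
    (Submodule.subset_span ⟨_, rfl⟩)
  rw [cosBasisVec, inner_smul_left] at h1
  have h2 := (mul_eq_zero.1 h1).resolve_left (by
    simpa using cosH1_fst_ne_zero (fun i => ((m i).natAbs : ℤ)))
  rw [inner_cosH1_fst, cosProd_natAbs] at h2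
  rw [inner_cosH1_fst, h2]

/-- The Hilbert basis of `L²(Y)` formed by the products of cosines. -/
noncomputable def cosBasis (d : ℕ) : HilbertBasis (Fin d → ℕ) ℂ (L2 d) :=
  HilbertBasis.mkOfOrthogonalEqBot orthonormal_cosBasisVec span_cosBasisVec_orthogonal

theorem hasSum_inner_cosBasisVec (w : L2 d) :
    HasSum (fun m => ‖inner ℂ (cosBasisVec m) w‖ ^ 2) (‖w‖ ^ 2) := by
  have h := (cosBasis d).hasSum_inner_mul_inner w w
  have hb : ∀ m, cosBasis d m = cosBasisVec m := fun m => by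
    rw [cosBasis, HilbertBasis.coe_mkOfOrthogonalEqBot]
  have h2 := h.mapL Complex.reCLM
  have e : Complex.reCLM (inner ℂ w w) = ‖w‖ ^ 2 := by
    rw [inner_self_eq_norm_sq_to_K]
    change (((‖w‖ : ℝ) : ℂ) ^ 2).re = _
    rw [← Complex.ofReal_pow, Complex.ofReal_re]
  rw [e] at h2
  refine h2.congr_fun fun m => ?_
  rw [hb]
  change _ = (inner ℂ w (cosBasisVec m) * inner ℂ (cosBasisVec m) w).re
  rw [← inner_conj_symm w (cosBasisVec m), mul_comm, Complex.mul_conj, Complex.ofReal_re, Complex.normSq_eq_norm_sq]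

theorem sq_le_cosEigenvalue (m : Fin d → ℕ) {N : ℕ} (i : Fin d) (h : N ≤ m i) :
    (N : ℝ) ^ 2 ≤ cosEigenvalue fun i => (m i : ℤ) := by
  have h1 : (Real.pi * ((m i : ℤ) : ℝ)) ^ 2 ≤ cosEigenvalue fun i => (m i : ℤ) :=
    Finset.single_le_sum (f := fun i => (Real.pi * ((m i : ℤ) : ℝ)) ^ 2)
      (fun _ _ => sq_nonneg _) (Finset.mem_univ i)
  refine le_trans ?_ h1
  have h2 : (N : ℝ) ≤ m i := by exact_mod_cast h
  have h3 : (1 : ℝ) ≤ Real.pi := by linarith [Real.two_le_pi]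
  have h4 : (N : ℝ) ≤ Real.pi * ((m i : ℤ) : ℝ) := by
    push_cast
    nlinarith [(Nat.cast_nonneg (m i) : (0 : ℝ) ≤ m i)]
  exact pow_le_pow_left₀ N.cast_nonneg h4 2

/-- Bessel's inequality for the gradients of the cosines, which are orthogonal in `L²` with norms
determined by the eigenvalues of the Neumann Laplacian. -/
theorem sum_inner_cosBasisVec_le (u : H1 d) (s : Finset (Fin d → ℕ)) {Λ : ℝ} (hΛ : 0 < Λ)
    (hs : ∀ m ∈ s, Λ ≤ cosEigenvalue fun i => (m i : ℤ)) :
    ∑ m ∈ s, ‖inner ℂ (cosBasisVec m) u.1.fst‖ ^ 2 ≤ ‖u.1.snd‖ ^ 2 / Λ := by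
  let c : (Fin d → ℕ) → H1 d := fun m => cosH1 fun i => (m i : ℤ)
  let lam : (Fin d → ℕ) → ℝ := fun m => cosEigenvalue fun i => (m i : ℤ)
  let a : (Fin d → ℕ) → ℝ := fun m => (√(lam m))⁻¹ * ‖(c m).1.fst‖⁻¹
  have hlam : ∀ m : s, 0 < lam m := fun m => hΛ.trans_le (hs m m.2)
  have hinner : ∀ m (w : H1 d), inner ℂ ((a m : ℂ) • (c m).1.snd) w.1.snd =
      (a m * lam m : ℝ) * inner ℂ (c m).1.fst w.1.fst := by
    intro m w
    rw [inner_smul_left, inner_snd_cosH1, Complex.conj_ofReal]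
    push_cast
    ring
  have hon : Orthonormal ℂ (fun m : s => (a m : ℂ) • (c m).1.snd) := by
    constructor
    · intro m
      have hne : ‖(c m).1.fst‖ ≠ 0 := norm_ne_zero_iff.2 (cosH1_fst_ne_zero _)
      have h1 : ‖(a m : ℂ) • (c m).1.snd‖ ^ 2 = 1 := by
        have h2 := hinner m (c m)
        rw [← inner_self_eq_norm_sq (𝕜 := ℂ), inner_smul_right, h2, inner_self_eq_norm_sq_to_K]
        have : (a m : ℂ) * (((a m * lam m : ℝ) : ℂ) * ((‖(c m).1.fst‖ : ℝ) : ℂ) ^ 2) =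
            ((a m * (a m * lam m * ‖(c m).1.fst‖ ^ 2) : ℝ) : ℂ) := by push_cast; ring
        change ((a m : ℂ) * (((a m * lam m : ℝ) : ℂ) * ((‖(c m).1.fst‖ : ℝ) : ℂ) ^ 2)).re = 1
        rw [this, Complex.ofReal_re]
        have h3 : √(lam m) ^ 2 = lam m := Real.sq_sqrt (hlam m).le
        have h4 : √(lam m) ≠ 0 := (Real.sqrt_pos.2 (hlam m)).ne'
        simp only [a]
        conv_lhs => enter [2, 1, 2]; rw [← h3]
        field_simp
      nlinarith [norm_nonneg ((a m : ℂ) • (c m).1.snd)]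
    · intro m n hmn
      change inner ℂ ((a m : ℂ) • (c m).1.snd) ((a n : ℂ) • (c n).1.snd) = 0
      rw [inner_smul_right, hinner, inner_cosH1_nat_eq_zero fun h => hmn (Subtype.ext h), mul_zero,
        mul_zero]
  have hb := hon.sum_inner_products_le u.1.snd (s := Finset.univ)
  rw [le_div_iff₀ hΛ]
  refine le_trans ?_ hb
  rw [Finset.sum_mul, Finset.univ_eq_attach, ← Finset.sum_attach s]
  refine Finset.sum_le_sum fun m _ => ?_
  rw [hinner, cosBasisVec, inner_smul_left, Complex.conj_ofReal, norm_mul, norm_mul, mul_pow, mul_pow,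
    Complex.norm_real, Complex.norm_real, Real.norm_eq_abs, Real.norm_eq_abs, sq_abs, sq_abs]
  have h3 : √(lam m) ^ 2 = lam m := Real.sq_sqrt (hlam m).le
  have h4 : √(lam m) ≠ 0 := (Real.sqrt_pos.2 (hlam m)).ne'
  have h5 : (a m * lam m) ^ 2 = lam m * (‖(c m).1.fst‖⁻¹) ^ 2 := by
    have h6 : ∀ r t L : ℝ, r ≠ 0 → r ^ 2 = L → (r⁻¹ * t⁻¹ * L) ^ 2 = L * t⁻¹ ^ 2 := by
      rintro r t _ hr rfl
      field_simp
    exact h6 _ _ _ h4 h3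
  rw [h5]
  have h6 : Λ ≤ lam m := hs m m.2
  have h7 : 0 ≤ (‖(c m).1.fst‖⁻¹) ^ 2 * ‖inner ℂ (c m).1.fst u.1.fst‖ ^ 2 := by positivity
  change (‖(c m).1.fst‖⁻¹) ^ 2 * ‖inner ℂ (c m).1.fst u.1.fst‖ ^ 2 * Λ ≤ _
  nlinarith

/-- If the low frequencies of `w` vanish, and the other ones are those of `u`, then `w` is small in
terms of the gradient of `u`. -/
theorem norm_sq_le_of_tail (u : H1 d) (w : L2 d) (F : Set (Fin d → ℕ)) {Λ : ℝ} (hΛ : 0 < Λ)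
    (hF : ∀ m, m ∉ F → Λ ≤ cosEigenvalue fun i => (m i : ℤ))
    (h0 : ∀ m ∈ F, inner ℂ (cosBasisVec m) w = 0)
    (h1 : ∀ m, m ∉ F → inner ℂ (cosBasisVec m) w = inner ℂ (cosBasisVec m) u.1.fst) :
    ‖w‖ ^ 2 ≤ ‖u.1.snd‖ ^ 2 / Λ := by
  classical
  refine hasSum_le_of_sum_le (hasSum_inner_cosBasisVec w) fun s => ?_
  have : ∑ m ∈ s, ‖inner ℂ (cosBasisVec m) w‖ ^ 2 =
      ∑ m ∈ s.filter (· ∉ F), ‖inner ℂ (cosBasisVec m) u.1.fst‖ ^ 2 := by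
    rw [Finset.sum_filter]
    refine Finset.sum_congr rfl fun m _ => ?_
    by_cases hm : m ∈ F
    · simp [hm, h0 m hm]
    · simp [hm, h1 m hm]
  rw [this]
  exact sum_inner_cosBasisVec_le u _ hΛ fun m hm => hF m (Finset.mem_filter.1 hm).2

theorem inner_cosH1_zero (w : L2 d) : inner ℂ (cosH1 0).1.fst w = ∫ x in unitCell d, w x := by
  rw [inner_cosH1_fst, cosProd_zero]
  simp

theorem inner_cosBasisVec_zero_of_mem {w : L2 d} (hw : w ∈ L20 d) :
    inner ℂ (cosBasisVec 0) w = 0 := by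
  rw [cosBasisVec, inner_smul_left]
  have h : inner ℂ (cosH1 fun i : Fin d => (((0 : Fin d → ℕ) i : ℕ) : ℤ)).1.fst w = 0 := by
    rw [show (fun i : Fin d => (((0 : Fin d → ℕ) i : ℕ) : ℤ)) = 0 from rfl, inner_cosH1_zero]
    exact hw
  rw [h, mul_zero]

/-- The Poincaré inequality on the cell. -/
theorem poincare (u : EnergySpace d) : ‖u.1.fst‖ ≤ ‖grad u‖ := by
  have h := norm_sq_le_of_tail (energyToH1 u) u.1.fst {0} one_pos ?_ ?_ (fun _ _ => rfl)
  · rw [div_one] at h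
    exact le_of_sq_le_sq h (norm_nonneg _)
  · intro m hm
    obtain ⟨i, hi⟩ := Function.ne_iff.1 (show m ≠ 0 from hm)
    have := sq_le_cosEigenvalue m i (Nat.one_le_iff_ne_zero.2 hi)
    simpa using this
  · rintro m rfl
    exact inner_cosBasisVec_zero_of_mem u.2.2

theorem norm_energy_sq (u : EnergySpace d) : ‖u‖ ^ 2 = ‖u.1.fst‖ ^ 2 + ‖grad u‖ ^ 2 :=
  WithLp.prod_norm_sq_eq_of_L2 u.1

theorem norm_grad_le (u : EnergySpace d) : ‖grad u‖ ≤ ‖u‖ := by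
  refine le_of_sq_le_sq ?_ (norm_nonneg _)
  rw [norm_energy_sq]
  nlinarith [sq_nonneg ‖u.1.fst‖]

theorem norm_energy_sq_le (u : EnergySpace d) : ‖u‖ ^ 2 ≤ 2 * ‖grad u‖ ^ 2 := by
  rw [norm_energy_sq]
  have := poincare u
  nlinarith [norm_nonneg u.1.fst]

/-- The orthogonal projection of `L²(Y)` onto the low frequencies. -/
noncomputable def lowFrequency (d N : ℕ) : L2 d →L[ℂ] L2 d :=
  ∑ m ∈ Fintype.piFinset (fun _ : Fin d => Finset.range N),
    (ContinuousLinearMap.toSpanSingleton ℂ (cosBasisVec m)).comp (innerSL ℂ (cosBasisVec m))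

theorem lowFrequency_apply (N : ℕ) (w : L2 d) :
    lowFrequency d N w = ∑ m ∈ Fintype.piFinset (fun _ : Fin d => Finset.range N),
      inner ℂ (cosBasisVec m) w • cosBasisVec m := by
  simp [lowFrequency]

theorem inner_sub_lowFrequency (N : ℕ) (w : L2 d) (m : Fin d → ℕ) :
    inner ℂ (cosBasisVec m) (w - lowFrequency d N w) =
      if m ∈ Fintype.piFinset (fun _ : Fin d => Finset.range N) then 0
      else inner ℂ (cosBasisVec m) w := by
  rw [inner_sub_right, lowFrequency_apply]
  split_ifs with hm
  · rw [orthonormal_cosBasisVec.inner_right_sum _ hm, sub_self]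
  · rw [inner_sum, Finset.sum_eq_zero, sub_zero]
    intro n hn
    rw [inner_smul_right, orthonormal_cosBasisVec.2 (show m ≠ n from fun h => hm (by rw [h]; exact hn)),
      mul_zero]

theorem norm_sub_lowFrequency_le (u : EnergySpace d) {N : ℕ} (hN : 0 < N) :
    ‖u.1.fst - lowFrequency d N u.1.fst‖ ≤ 1 / N * ‖u‖ := by
  have hN' : (0 : ℝ) < N := by exact_mod_cast hN
  have h := norm_sq_le_of_tail (energyToH1 u) (u.1.fst - lowFrequency d N u.1.fst)
    {m | m ∈ Fintype.piFinset (fun _ : Fin d => Finset.range N)} (Λ := (N : ℝ) ^ 2) (by positivity)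
    ?_ ?_ ?_
  · have h2 : ‖(energyToH1 u).1.snd‖ ≤ ‖u‖ := norm_grad_le u
    refine le_of_sq_le_sq (h.trans ?_) (by positivity)
    rw [mul_pow, one_div, inv_pow, inv_mul_eq_div]
    gcongr
  · intro m hm
    have hm' : ¬ ∀ i, m i < N := by simpa [Fintype.mem_piFinset] using hm
    push Not at hm'
    obtain ⟨i, hi⟩ := hm'
    exact sq_le_cosEigenvalue m i hi
  · intro m hm
    rw [inner_sub_lowFrequency, if_pos (show m ∈ Fintype.piFinset (fun _ : Fin d => Finset.range N) from hm)]
  · intro m hm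
    rw [inner_sub_lowFrequency, if_neg (show m ∉ Fintype.piFinset (fun _ : Fin d => Finset.range N) from hm)]
    rfl

theorem isCompactOperator_lowFrequency (d N : ℕ) : IsCompactOperator (lowFrequency d N) := by
  have h : lowFrequency d N ∈ compactOperator (RingHom.id ℂ) (L2 d) (L2 d) := by
    refine Submodule.sum_mem _ fun m _ => ?_
    have h0 : IsCompactOperator (ContinuousLinearMap.toSpanSingleton ℂ (cosBasisVec m)) :=
      isCompactOperator_of_locallyCompactSpace_rng
        (ContinuousLinearMap.toSpanSingleton ℂ (cosBasisVec m))
    exact h0.comp_clm _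
  exact h

/-- The inclusion of `𝓗` into `L²(Y)`. -/
noncomputable def energyToL2 (d : ℕ) : EnergySpace d →L[ℂ] L2 d :=
  (WithLp.fstL 2 ℂ (L2 d) (L2Vec d)).comp (EnergySpace d).subtypeL

/-- Rellich's theorem: by the spectral gap estimate for high frequencies, the inclusion is a norm
limit of operators of finite rank. -/
theorem isCompactOperator_energyToL2 (d : ℕ) : IsCompactOperator (energyToL2 d) := by
  refine isCompactOperator_of_tendsto (l := atTop)
    (F := fun N : ℕ => (lowFrequency d N).comp (energyToL2 d)) ?_
    (Eventually.of_forall fun N => (isCompactOperator_lowFrequency d N).comp_clm _)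
  refine (tendsto_iff_norm_sub_tendsto_zero (E := EnergySpace d →L[ℂ] L2 d)).2 ?_
  refine squeeze_zero' (Eventually.of_forall fun N =>
    norm_nonneg ((lowFrequency d N).comp (energyToL2 d) - energyToL2 d)) ?_
    tendsto_one_div_atTop_nhds_zero_nat
  filter_upwards [eventually_gt_atTop 0] with N hN
  refine ContinuousLinearMap.opNorm_le_bound _ (by positivity) fun u => ?_
  rw [← norm_neg]
  have := norm_sub_lowFrequency_le u hN
  refine le_trans (le_of_eq (congrArg norm ?_)) this
  rw [sub_apply, neg_sub]
  rfl

theorem isCompactOperator_energyIncl (d : ℕ) : IsCompactOperator (energyIncl d) := by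
  have h := isCompactOperator_energyToL2 d
  exact h.codRestrict (V := L20 d) (fun u => u.2.2) (isClosed_L20 d)

theorem cosH1_mem_energySpace {m : Fin d → ℕ} (hm : m ≠ 0) :
    (cosH1 fun i => (m i : ℤ)).1 ∈ EnergySpace d := by
  refine ⟨(cosH1 fun i => (m i : ℤ)).2, ?_⟩
  change ∫ x in unitCell d, (cosH1 fun i => (m i : ℤ)).1.fst x = 0
  rw [← inner_cosH1_zero]
  exact inner_cosH1_nat_eq_zero (m := 0) hm.symm

/-- The non-constant products of cosines as elements of `𝓗`. -/
noncomputable def cosEnergy (m : {m : Fin d → ℕ // m ≠ 0}) : EnergySpace d :=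
  ⟨(cosH1 fun i => (m.1 i : ℤ)).1, cosH1_mem_energySpace m.2⟩

theorem inner_energy (u v : EnergySpace d) :
    inner ℂ u v = inner ℂ u.1.fst v.1.fst + inner ℂ (grad u) (grad v) :=
  WithLp.prod_inner_apply u.1 v.1

theorem cosEigenvalue_nonneg (m : Fin d → ℤ) : 0 ≤ cosEigenvalue m :=
  Finset.sum_nonneg fun _ _ => sq_nonneg _

/-- The products of cosines span a dense subspace of `𝓗`: as eigenfunctions, they are orthogonal
to `w` in `H¹` only if they are so in `L²`. -/
theorem span_cosEnergy_dense :
    (Submodule.span ℂ (Set.range (cosEnergy (d := d)))).topologicalClosure = ⊤ := by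
  rw [Submodule.topologicalClosure_eq_top_iff, eq_bot_iff]
  intro w hw
  refine (Submodule.mem_bot ℂ).2 (energyIncl_injective d (Subtype.ext ?_))
  rw [map_zero]
  change w.1.fst = 0
  have hzero : ∀ m : Fin d → ℕ, inner ℂ (cosH1 fun i => (m i : ℤ)).1.fst w.1.fst = 0 := by
    intro m
    by_cases hm : m = 0
    · subst hm
      rw [show (fun i : Fin d => (((0 : Fin d → ℕ) i : ℕ) : ℤ)) = 0 from rfl, inner_cosH1_zero]
      exact w.2.2
    · have h1 := (Submodule.mem_orthogonal _ _).1 hw (cosEnergy ⟨m, hm⟩)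
        (Submodule.subset_span ⟨_, rfl⟩)
      rw [inner_energy] at h1
      have h2 : inner ℂ (grad (cosEnergy ⟨m, hm⟩)) (grad w) = _ :=
        inner_snd_cosH1 (fun i => (m i : ℤ)) (energyToH1 w)
      rw [h2] at h1
      change inner ℂ (cosH1 fun i => (m i : ℤ)).1.fst w.1.fst + _ *
        inner ℂ (cosH1 fun i => (m i : ℤ)).1.fst w.1.fst = 0 at h1
      have h3 : (1 + (cosEigenvalue fun i => (m i : ℤ) : ℂ)) *
          inner ℂ (cosH1 fun i => (m i : ℤ)).1.fst w.1.fst = 0 := by linear_combination h1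
      refine (mul_eq_zero.1 h3).resolve_left ?_
      have := cosEigenvalue_nonneg (fun i => (m i : ℤ))
      have h4 : (1 + cosEigenvalue fun i => (m i : ℤ)) ≠ 0 := by positivity
      exact_mod_cast h4
  refine eq_zero_of_inner_cosH1 _ fun m => ?_
  have := hzero fun i => (m i).natAbs
  rw [inner_cosH1_fst, cosProd_natAbs] at this
  rw [inner_cosH1_fst, this]

/-- Smooth functions of compact support in `ℝ^d`, restricted to the cell, are dense in `𝓗`. -/
theorem exists_smooth_near (u : EnergySpace d) {ε : ℝ} (hε : 0 < ε) :
    ∃ (v : EnergySpace d) (f : EuclideanSpace ℝ (Fin d) → ℂ), ContDiff ℝ ∞ f ∧ HasCompactSupport f ∧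
      v.1.fst =ᵐ[cellMeasure d] f ∧ ‖u - v‖ < ε := by
  have hu : u ∈ (Submodule.span ℂ (Set.range (cosEnergy (d := d)))).topologicalClosure := by
    rw [span_cosEnergy_dense]; trivial
  obtain ⟨v, hv, huv⟩ := Metric.mem_closure_iff.1 hu ε hε
  have hsmooth : ∀ v ∈ Submodule.span ℂ (Set.range (cosEnergy (d := d))),
      ∃ f : EuclideanSpace ℝ (Fin d) → ℂ, ContDiff ℝ ∞ f ∧ v.1.fst =ᵐ[cellMeasure d] f := by
    intro v hv
    induction hv using Submodule.span_induction with
    | mem v hv =>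
      obtain ⟨m, rfl⟩ := hv
      exact ⟨_, contDiff_cosProd_complex _, cosH1_fst _⟩
    | zero => exact ⟨fun _ => 0, contDiff_const, Lp.coeFn_zero ℂ 2 (cellMeasure d)⟩
    | add v w _ _ hv hw =>
      obtain ⟨f, hf, hf'⟩ := hv
      obtain ⟨g, hg, hg'⟩ := hw
      refine ⟨fun x => f x + g x, hf.add hg, ?_⟩
      filter_upwards [Lp.coeFn_add v.1.fst w.1.fst, hf', hg'] with x h1 h2 h3
      rw [← h2, ← h3]
      exact h1
    | smul c v _ hv =>
      obtain ⟨f, hf, hf'⟩ := hv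
      refine ⟨fun x => c * f x, contDiff_const.mul hf, ?_⟩
      filter_upwards [Lp.coeFn_smul c v.1.fst, hf'] with x h1 h2
      rw [← h2]
      exact h1
  obtain ⟨f, hf, hf'⟩ := hsmooth v hv
  obtain ⟨g, hg, hg', hfg⟩ := exists_compactSupport_extension hf
  refine ⟨v, g, hg, hg', hf'.trans ?_, by rwa [← dist_eq_norm]⟩
  exact (ae_restrict_iff' (measurableSet_unitCell d)).2
    (Eventually.of_forall fun x hx => (hfg x hx).1.symm)

theorem not_finiteDimensional_L20 (hd : 0 < d) : ¬ FiniteDimensional ℂ (L20 d) := by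
  intro hfd
  have hmem : ∀ m : {m : Fin d → ℕ // m ≠ 0}, cosBasisVec m.1 ∈ L20 d := fun m =>
    (L20 d).smul_mem _ (cosH1_mem_energySpace m.2).2
  have hli : LinearIndependent ℂ (fun m : {m : Fin d → ℕ // m ≠ 0} =>
      (⟨cosBasisVec m.1, hmem m⟩ : L20 d)) := by
    refine LinearIndependent.of_comp (L20 d).subtype ?_
    exact (orthonormal_cosBasisVec.linearIndependent).comp _ Subtype.val_injective
  have hfin := hli.finite
  have hinj : Function.Injective (fun n : ℕ => (⟨fun _ => n + 1, fun h => by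
      have := congrFun h ⟨0, hd⟩; simp at this⟩ : {m : Fin d → ℕ // m ≠ 0})) := by
    intro a b h
    have := congrFun (congrArg Subtype.val h) ⟨0, hd⟩
    simpa using this
  exact not_finite_iff_infinite.2 (Infinite.of_injective _ hinj) hfin

end NeumannCell

/-! ### The operators associated with the Dirichlet forms -/

namespace NeumannCell

variable {d : ℕ}

/-- The weak gradient as a bounded operator. -/
noncomputable def gradL (d : ℕ) : EnergySpace d →L[ℂ] L2Vec d :=
  (WithLp.sndL 2 ℂ (L2 d) (L2Vec d)).comp (EnergySpace d).subtypeL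

theorem gradL_apply (u : EnergySpace d) : gradL d u = grad u := rfl

/-- The weak gradient, restricted to a subset of the cell. -/
noncomputable def gradOnL (A : Set (EuclideanSpace ℝ (Fin d))) :
    EnergySpace d →L[ℂ] Lp (EuclideanSpace ℂ (Fin d)) 2 ((cellMeasure d).restrict A) :=
  (LpToLpRestrictCLM (EuclideanSpace ℝ (Fin d)) (EuclideanSpace ℂ (Fin d)) ℂ (cellMeasure d) 2 A).comp
    (gradL d)

/-- The operator on `𝓗`, relative to the `H¹` inner product, of the form `∫_A ∇u · ∇v̄`. -/
noncomputable def dirichletOp (A : Set (EuclideanSpace ℝ (Fin d))) :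
    EnergySpace d →L[ℂ] EnergySpace d :=
  (ContinuousLinearMap.adjoint (gradOnL A)).comp (gradOnL A)

theorem inner_dirichletOp (A : Set (EuclideanSpace ℝ (Fin d))) (u v : EnergySpace d) :
    inner ℂ v (dirichletOp A u) = inner ℂ (gradOnL A v) (gradOnL A u) := by
  rw [dirichletOp, ContinuousLinearMap.comp_apply, ContinuousLinearMap.adjoint_inner_right]

theorem cellMeasure_restrict {A : Set (EuclideanSpace ℝ (Fin d))} (hA : MeasurableSet A)
    (hAY : A ⊆ unitCell d) : (cellMeasure d).restrict A = volume.restrict A := by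
  rw [Measure.restrict_restrict hA, Set.inter_eq_left.2 hAY]

theorem gradOnL_coeFn (A : Set (EuclideanSpace ℝ (Fin d))) (u : EnergySpace d) :
    gradOnL A u =ᵐ[(cellMeasure d).restrict A] grad u :=
  LpToLpRestrictCLM_coeFn ℂ A (grad u)

theorem gradFormOn_eq_inner {A : Set (EuclideanSpace ℝ (Fin d))} (hA : MeasurableSet A)
    (hAY : A ⊆ unitCell d) (u v : EnergySpace d) :
    gradFormOn A u v = inner ℂ v (dirichletOp A u) := by
  rw [inner_dirichletOp, MeasureTheory.L2.inner_def, gradFormOn, ← cellMeasure_restrict hA hAY]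
  refine integral_congr_ae ?_
  filter_upwards [gradOnL_coeFn A u, gradOnL_coeFn A v] with x h1 h2
  rw [h1, h2, PiLp.inner_apply]
  rfl

theorem adjoint_dirichletOp (A : Set (EuclideanSpace ℝ (Fin d))) :
    ContinuousLinearMap.adjoint (dirichletOp A) = dirichletOp A := by
  rw [dirichletOp, ContinuousLinearMap.adjoint_comp, ContinuousLinearMap.adjoint_adjoint]

theorem inner_dirichletOp_self (A : Set (EuclideanSpace ℝ (Fin d))) (u : EnergySpace d) :
    inner ℂ u (dirichletOp A u) = ((‖gradOnL A u‖ ^ 2 : ℝ) : ℂ) := by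
  rw [inner_dirichletOp, inner_self_eq_norm_sq_to_K]
  exact (Complex.ofReal_pow _ _).symm

theorem norm_gradOnL_unitCell (u : EnergySpace d) : ‖gradOnL (unitCell d) u‖ = ‖grad u‖ := by
  have h1 : ((‖gradOnL (unitCell d) u‖ ^ 2 : ℝ) : ℂ) = ((‖grad u‖ ^ 2 : ℝ) : ℂ) := by
    rw [← inner_dirichletOp_self, ← gradFormOn_eq_inner (measurableSet_unitCell d) le_rfl,
      Complex.ofReal_pow]
    refine Eq.trans ?_ (inner_self_eq_norm_sq_to_K (𝕜 := ℂ) (grad u))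
    rw [MeasureTheory.L2.inner_def, gradFormOn]
    refine integral_congr_ae (Eventually.of_forall fun x => ?_)
    simp only [PiLp.inner_apply]
    rfl
  have h2 : ‖gradOnL (unitCell d) u‖ ^ 2 = ‖grad u‖ ^ 2 := by exact_mod_cast h1
  exact (pow_left_inj₀ (norm_nonneg _) (norm_nonneg _) two_ne_zero).1 h2

/-- An operator whose form dominates the square of the norm, after multiplication by a constant, is
bounded below. -/
theorem bounded_below_of_re_inner {H : Type*} [NormedAddCommGroup H] [InnerProductSpace ℂ H]
    {S : H →L[ℂ] H} {c : ℝ} (θ : ℂ) (h : ∀ u, c * ‖u‖ ^ 2 ≤ (θ * inner ℂ u (S u)).re) (u : H) :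
    c * ‖u‖ ≤ ‖θ‖ * ‖S u‖ := by
  by_cases hu : u = 0
  · simp [hu]
  have hpos := norm_pos_iff.2 hu
  have h1 : (θ * inner ℂ u (S u)).re ≤ ‖θ‖ * (‖u‖ * ‖S u‖) := by
    refine (Complex.re_le_norm _).trans ?_
    rw [norm_mul]
    gcongr
    exact norm_inner_le_norm u (S u)
  have h2 := (h u).trans h1
  by_contra hcon
  nlinarith

theorem isInvertible_dirichletOp_unitCell (d : ℕ) : (dirichletOp (unitCell d)).IsInvertible := by
  have h : ∀ u : EnergySpace d, (1 / 2 : ℝ) * ‖u‖ ≤ ‖dirichletOp (unitCell d) u‖ := by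
    intro u
    have := bounded_below_of_re_inner (S := dirichletOp (unitCell d)) (c := 1 / 2) 1 (fun u => by
      rw [one_mul, inner_dirichletOp_self, Complex.ofReal_re, norm_gradOnL_unitCell]
      linarith [norm_energy_sq_le u]) u
    simpa using this
  refine isInvertible_of_bounded_below (by norm_num) h fun u hu => ?_
  rw [adjoint_dirichletOp] at hu
  have := h u
  rw [hu, norm_zero] at this
  exact norm_eq_zero.1 (le_antisymm (by linarith) (norm_nonneg u))

/-- The isomorphism of `𝓗` which relates the `H¹` inner product to the gradient inner product. -/
noncomputable def energyEquiv (d : ℕ) : EnergySpace d ≃L[ℂ] EnergySpace d :=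
  (isInvertible_dirichletOp_unitCell d).choose

theorem energyEquiv_apply (u : EnergySpace d) : energyEquiv d u = dirichletOp (unitCell d) u :=
  congrArg (fun T : EnergySpace d →L[ℂ] EnergySpace d => T u)
    (isInvertible_dirichletOp_unitCell d).choose_spec

theorem gradForm_eq_inner (u v : EnergySpace d) : gradForm u v = inner ℂ v (energyEquiv d u) := by
  rw [energyEquiv_apply, gradForm, gradFormOn_eq_inner (measurableSet_unitCell d) le_rfl]

theorem gradForm_symm_apply (u v : EnergySpace d) :
    gradForm ((energyEquiv d).symm u) v = inner ℂ v u := by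
  rw [gradForm_eq_inner, ContinuousLinearEquiv.apply_symm_apply]

theorem gradForm_right_cancel {u u' : EnergySpace d} (h : ∀ v, gradForm u v = gradForm u' v) :
    u = u' := by
  refine (energyEquiv d).injective (ext_inner_left ℂ fun v => ?_)
  rw [← gradForm_eq_inner, ← gradForm_eq_inner, h]

theorem gradForm_self (u : EnergySpace d) : gradForm u u = ((‖grad u‖ ^ 2 : ℝ) : ℂ) := by
  rw [gradForm_eq_inner, energyEquiv_apply, inner_dirichletOp_self, norm_gradOnL_unitCell]

theorem grad_ne_zero {u : EnergySpace d} (hu : u ≠ 0) : 0 < ‖grad u‖ := by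
  have h1 := norm_energy_sq_le u
  have h2 := norm_pos_iff.2 hu
  by_contra h
  have h3 : ‖grad u‖ = 0 := le_antisymm (not_lt.1 h) (norm_nonneg _)
  rw [h3] at h1
  nlinarith

/-- The operator of the transmission form `B_k`, relative to the `H¹` inner product. -/
noncomputable def transmissionOp (D : Set (EuclideanSpace ℝ (Fin d))) (k : ℂ) :
    EnergySpace d →L[ℂ] EnergySpace d :=
  k • dirichletOp (unitCell d \ D) + dirichletOp D

theorem transmissionForm_eq_inner {D : Set (EuclideanSpace ℝ (Fin d))}
    (hD : IsInclusionDomain D) (k : ℂ) (u v : EnergySpace d) :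
    transmissionForm D k u v = inner ℂ v (transmissionOp D k u) := by
  rw [transmissionForm, gradFormOn_eq_inner ((measurableSet_unitCell d).diff hD.isOpen.measurableSet)
    Set.sdiff_subset, gradFormOn_eq_inner hD.isOpen.measurableSet hD.subset_unitCell, transmissionOp,
    add_apply, smul_apply, inner_add_right, inner_smul_right]

theorem isFormOperator_iff {D : Set (EuclideanSpace ℝ (Fin d))}
    (hD : IsInclusionDomain D) (k : ℂ) (T : EnergySpace d →L[ℂ] EnergySpace d) :
    IsFormOperator D k T ↔
      T = ((energyEquiv d).symm : EnergySpace d →L[ℂ] EnergySpace d).comp (transmissionOp D k) := by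
  have hT : ∀ u v, gradForm ((energyEquiv d).symm (transmissionOp D k u)) v =
      transmissionForm D k u v := fun u v => by
    rw [gradForm_symm_apply, transmissionForm_eq_inner hD]
  constructor
  · intro h
    ext1 u
    exact gradForm_right_cancel fun v => (h u v).trans (hT u v).symm
  · rintro rfl u v
    exact hT u v

theorem formOperator_eq {D : Set (EuclideanSpace ℝ (Fin d))}
    (hD : IsInclusionDomain D) (k : ℂ) : formOperator D k =
    ((energyEquiv d).symm : EnergySpace d →L[ℂ] EnergySpace d).comp (transmissionOp D k) := by
  have hex : ∃ T, IsFormOperator D k T := ⟨_, (isFormOperator_iff hD k _).2 rfl⟩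
  rw [formOperator, dif_pos hex]
  exact (isFormOperator_iff hD k _).1 hex.choose_spec

theorem gradForm_formOperator {D : Set (EuclideanSpace ℝ (Fin d))}
    (hD : IsInclusionDomain D) (k : ℂ) (u v : EnergySpace d) :
    gradForm (formOperator D k u) v = transmissionForm D k u v :=
  (isFormOperator_iff hD k _).2 (formOperator_eq hD k) u v

theorem isInvertible_formOperator {D : Set (EuclideanSpace ℝ (Fin d))}
    (hD : IsInclusionDomain D) {k : ℂ} (h : (transmissionOp D k).IsInvertible) :
    (formOperator D k).IsInvertible := by
  rw [formOperator_eq hD]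
  exact (ContinuousLinearMap.isInvertible_equiv (f := (energyEquiv d).symm)).comp h

/-- The adjoint of the transmission operator has the conjugate coefficient. -/
theorem adjoint_transmissionOp (D : Set (EuclideanSpace ℝ (Fin d))) (k : ℂ) :
    ContinuousLinearMap.adjoint (transmissionOp D k) =
    transmissionOp D ((starRingEnd ℂ) k) := by
  rw [transmissionOp, map_add, adjoint_dirichletOp, transmissionOp]
  congr 1
  rw [← adjoint_dirichletOp (unitCell d \ D)]
  simp only [map_smulₛₗ, adjoint_dirichletOp]

theorem norm_gradOnL_split {D : Set (EuclideanSpace ℝ (Fin d))}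
    (hD : IsInclusionDomain D) (u : EnergySpace d) :
    ‖gradOnL (unitCell d \ D) u‖ ^ 2 + ‖gradOnL D u‖ ^ 2 = ‖grad u‖ ^ 2 := by
  have hmeas : MeasurableSet (unitCell d \ D) :=
    (measurableSet_unitCell d).diff hD.isOpen.measurableSet
  have h1 : gradFormOn (unitCell d) u u = gradFormOn (unitCell d \ D) u u + gradFormOn D u u := by
    have hi : Integrable (fun x => ∑ i, grad u x i * (starRingEnd ℂ) (grad u x i)) (cellMeasure d) := by
      refine (MeasureTheory.L2.integrable_inner (𝕜 := ℂ) (grad u) (grad u)).congr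
        (Eventually.of_forall fun x => ?_)
      simp only [PiLp.inner_apply]
      rfl
    have := integral_inter_add_sdiff (μ := volume) (s := unitCell d) hD.isOpen.measurableSet hi
    rw [Set.inter_eq_right.2 hD.subset_unitCell] at this
    rw [add_comm] at this
    exact this.symm
  rw [gradFormOn_eq_inner (measurableSet_unitCell d) le_rfl, gradFormOn_eq_inner hmeas
    Set.sdiff_subset, gradFormOn_eq_inner hD.isOpen.measurableSet hD.subset_unitCell,
    inner_dirichletOp_self, inner_dirichletOp_self, inner_dirichletOp_self,
    norm_gradOnL_unitCell] at h1
  exact_mod_cast h1.symm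

theorem cellInner_eq_inner (f g : L20 d) : cellInner f g = inner ℂ g f := by
  change _ = inner ℂ g.1 f.1
  rw [MeasureTheory.L2.inner_def]
  rfl

theorem isNeumannSolution_iff (A : L20 d →L[ℂ] EnergySpace d) :
    IsNeumannSolution A ↔ A = ((energyEquiv d).symm : EnergySpace d →L[ℂ] EnergySpace d).comp
      (ContinuousLinearMap.adjoint (energyIncl d)) := by
  have hT : ∀ f v, gradForm ((energyEquiv d).symm (ContinuousLinearMap.adjoint (energyIncl d) f)) v =
      cellInner f (energyIncl d v) := fun u v => by
    rw [gradForm_symm_apply, cellInner_eq_inner, ContinuousLinearMap.adjoint_inner_right]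
  constructor
  · intro h
    ext1 u
    exact gradForm_right_cancel fun v => (h u v).trans (hT u v).symm
  · rintro rfl u v
    exact hT u v

theorem invNeumannLaplacian_eq (d : ℕ) : invNeumannLaplacian d =
    ((energyEquiv d).symm : EnergySpace d →L[ℂ] EnergySpace d).comp
      (ContinuousLinearMap.adjoint (energyIncl d)) := by
  have hex : ∃ A : L20 d →L[ℂ] EnergySpace d, IsNeumannSolution A :=
    ⟨_, (isNeumannSolution_iff _).2 rfl⟩
  rw [invNeumannLaplacian, dif_pos hex]
  exact (isNeumannSolution_iff _).1 hex.choose_spec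

theorem gradForm_invNeumannLaplacian (f : L20 d) (v : EnergySpace d) :
    gradForm (invNeumannLaplacian d f) v = cellInner f (energyIncl d v) :=
  (isNeumannSolution_iff _).2 (invNeumannLaplacian_eq d) f v

end NeumannCell

/-! ### Flattening the boundary and reflecting across it -/

namespace NeumannCell

variable {d : ℕ}

/-- Near a boundary point, an open set with `C¹` boundary is the negativity set of a function which
differs from a linear function of norm one by an arbitrarily small Lipschitz constant. -/
theorem HasHolderBoundary.exists_flattening {γ : ℝ≥0} {D : Set (EuclideanSpace ℝ (Fin d))}
    (hD : HasHolderBoundary γ D) {p : EuclideanSpace ℝ (Fin d)} (hp : p ∈ frontier D)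
    {ε : ℝ≥0} (hε : 0 < ε) :
    ∃ (n : EuclideanSpace ℝ (Fin d)) (τ : EuclideanSpace ℝ (Fin d) → ℝ) (ρ : ℝ),
      ‖n‖ = 1 ∧ LipschitzWith ε τ ∧ 0 < ρ ∧
        ∀ x ∈ Metric.ball p ρ, x ∈ D ↔ inner ℝ n x + τ x < 0 := by
  obtain ⟨e, r, g, he, hr, hinv, hg, -, hgr⟩ := hD p hp
  set s' : EuclideanSpace ℝ (Fin d) →L[ℝ] ℝ := innerSL ℝ e - fderiv ℝ g p with hs'
  have hs : HasStrictFDerivAt (fun x => inner ℝ e x - g x) s' p :=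
    ((innerSL ℝ e).hasStrictFDerivAt).sub (hg.contDiffAt.hasStrictFDerivAt (by simp))
  -- the graph function is constant along `e`, so the derivative of `s` along `e` is `1`
  have hge : fderiv ℝ g p e = 0 := by
    have h1 : HasDerivAt (fun t : ℝ => g (p + t • e)) (fderiv ℝ g p e) 0 := by
      have h2 : HasFDerivAt g (fderiv ℝ g p) (p + (0 : ℝ) • e) := by
        rw [zero_smul, add_zero]
        exact (hg.differentiable (by simp) p).hasFDerivAt
      have h3 : HasDerivAt (fun t : ℝ => p + t • e) e 0 := by
        simpa using ((hasDerivAt_id (0 : ℝ)).smul_const e).const_add p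
      exact h2.comp_hasDerivAt 0 h3
    have h4 : (fun t : ℝ => g (p + t • e)) = fun _ => g p := funext fun t => hinv p t
    rw [h4] at h1
    exact h1.unique (hasDerivAt_const _ _)
  have hs'e : s' e = 1 := by
    rw [hs', sub_apply, hge, sub_zero, innerSL_apply_apply, real_inner_self_eq_norm_sq, he, one_pow]
  have hne : s' ≠ 0 := by
    intro h
    rw [h] at hs'e
    simp at hs'e
  set L : ℝ := ‖s'‖ with hL
  have hLpos : 0 < L := norm_pos_iff.2 hne
  set m := (InnerProductSpace.toDual ℝ (EuclideanSpace ℝ (Fin d))).symm s' with hm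
  have hmnorm : ‖m‖ = L := by rw [hm, LinearIsometryEquiv.norm_map]
  have hmapply : ∀ x, inner ℝ m x = s' x := fun x => by
    rw [hm, InnerProductSpace.toDual_symm_apply]
  obtain ⟨S, hS, happ⟩ := hs.approximates_deriv_on_nhds
    (c := ε * L.toNNReal) (Or.inr (mul_pos hε (Real.toNNReal_pos.2 hLpos)))
  obtain ⟨ρ, hρ, hρS⟩ := Metric.mem_nhds_iff.1 hS
  have hlip : LipschitzOnWith ε
      (fun x => L⁻¹ * (inner ℝ e x - g x) - inner ℝ (L⁻¹ • m) x) (Metric.ball p ρ) := by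
    refine LipschitzOnWith.of_dist_le_mul fun x hx y hy => ?_
    have h1 := happ x (hρS hx) y (hρS hy)
    rw [Real.dist_eq, dist_eq_norm]
    have h2 : L⁻¹ * (inner ℝ e x - g x) - inner ℝ (L⁻¹ • m) x -
        (L⁻¹ * (inner ℝ e y - g y) - inner ℝ (L⁻¹ • m) y) =
        L⁻¹ * (inner ℝ e x - g x - (inner ℝ e y - g y) - s' (x - y)) := by
      rw [real_inner_smul_left, real_inner_smul_left, hmapply, hmapply, map_sub]
      ring
    rw [h2, abs_mul, abs_of_pos (inv_pos.2 hLpos), inv_mul_le_iff₀ hLpos]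
    refine h1.trans (le_of_eq ?_)
    rw [NNReal.coe_mul, Real.coe_toNNReal _ hLpos.le]
    ring
  obtain ⟨τ, hτ, hτeq⟩ := hlip.extend_real
  refine ⟨L⁻¹ • m, τ, min ρ r, ?_, hτ, lt_min hρ hr, fun x hx => ?_⟩
  · rw [norm_smul, hmnorm, norm_inv, Real.norm_eq_abs, abs_of_pos hLpos, inv_mul_cancel₀ hLpos.ne']
  · have h1 := hτeq (Metric.ball_subset_ball (min_le_left _ _) hx)
    rw [hgr x (Metric.ball_subset_ball (min_le_right _ _) hx), ← h1, add_sub_cancel]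
    constructor
    · intro h
      exact mul_neg_of_pos_of_neg (inv_pos.2 hLpos) (by linarith)
    · intro h
      have := (pos_iff_neg_of_mul_neg h).1 (inv_pos.2 hLpos)
      linarith

section Reflection

variable {n : EuclideanSpace ℝ (Fin d)} {τ : EuclideanSpace ℝ (Fin d) → ℝ} {ε : ℝ≥0}

/-- The height of a point relative to the hypersurface `⟨n, x⟩ + τ x = 0`. -/
noncomputable def height (n : EuclideanSpace ℝ (Fin d)) (τ : EuclideanSpace ℝ (Fin d) → ℝ)
    (x : EuclideanSpace ℝ (Fin d)) : ℝ := inner ℝ n x + τ x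

/-- The reflection across the hypersurface of height zero, in the direction `n`. -/
noncomputable def reflect (n : EuclideanSpace ℝ (Fin d)) (τ : EuclideanSpace ℝ (Fin d) → ℝ)
    (x : EuclideanSpace ℝ (Fin d)) : EuclideanSpace ℝ (Fin d) := x - (2 * height n τ x) • n

/-- The folding map, which reflects the points of negative height. -/
noncomputable def fold (n : EuclideanSpace ℝ (Fin d)) (τ : EuclideanSpace ℝ (Fin d) → ℝ)
    (x : EuclideanSpace ℝ (Fin d)) : EuclideanSpace ℝ (Fin d) := x - (2 * min (height n τ x) 0) • n

theorem fold_of_nonneg {x : EuclideanSpace ℝ (Fin d)} (h : 0 ≤ height n τ x) : fold n τ x = x := by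
  rw [fold, min_eq_right h, mul_zero, zero_smul, sub_zero]

theorem fold_of_nonpos {x : EuclideanSpace ℝ (Fin d)} (h : height n τ x ≤ 0) :
    fold n τ x = reflect n τ x := by
  rw [fold, min_eq_left h, reflect]

theorem lipschitzWith_height (hn : ‖n‖ = 1) (hτ : LipschitzWith ε τ) :
    LipschitzWith (1 + ε) (height n τ) := by
  refine LipschitzWith.add ?_ hτ
  refine LipschitzWith.of_dist_le_mul fun x y => ?_
  rw [Real.dist_eq, ← inner_sub_right, dist_eq_norm, NNReal.coe_one, one_mul]
  have := abs_real_inner_le_norm n (x - y)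
  rwa [hn, one_mul] at this

theorem lipschitzWith_fold (hn : ‖n‖ = 1) (hτ : LipschitzWith ε τ) :
    LipschitzWith (1 + 2 * (1 + ε)) (fold n τ) := by
  refine LipschitzWith.sub LipschitzWith.id ?_
  have h1 : LipschitzWith (1 + ε) (fun x => min (height n τ x) 0) :=
    (lipschitzWith_height hn hτ).min_const 0
  refine LipschitzWith.of_dist_le_mul fun x y => ?_
  rw [dist_eq_norm, ← sub_smul, norm_smul, hn, mul_one, ← mul_sub, norm_mul, ← dist_eq_norm (min _ _)]
  have := h1.dist_le_mul x y
  rw [Real.norm_eq_abs, abs_two]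
  push_cast at this ⊢
  linarith

/-- The reflection differs from an isometry by a small Lipschitz map. -/
theorem reflect_sub (hn : ‖n‖ = 1) (hτ : LipschitzWith ε τ) (x y : EuclideanSpace ℝ (Fin d)) :
    (1 - 2 * ε) * dist x y ≤ dist (reflect n τ x) (reflect n τ y) ∧
      dist (reflect n τ x) (reflect n τ y) ≤ (1 + 2 * ε) * dist x y := by
  have h1 : reflect n τ x - reflect n τ y =
      ((x - y) - (2 * inner ℝ n (x - y)) • n) - (2 * (τ x - τ y)) • n := by
    rw [reflect, reflect, height, height, inner_sub_right]
    module
  have h2 : ‖(x - y) - (2 * inner ℝ n (x - y)) • n‖ = ‖x - y‖ := by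
    rw [← pow_left_inj₀ (norm_nonneg _) (norm_nonneg _) two_ne_zero, norm_sub_sq_real, norm_smul,
      hn, inner_smul_right, real_inner_comm n, Real.norm_eq_abs, mul_one, sq_abs]
    ring
  have h3 : ‖(2 * (τ x - τ y)) • n‖ ≤ 2 * ε * ‖x - y‖ := by
    rw [norm_smul, hn, mul_one, norm_mul, ← dist_eq_norm (τ x), ← dist_eq_norm]
    have := hτ.dist_le_mul x y
    rw [Real.norm_eq_abs, abs_two]
    linarith
  rw [dist_eq_norm, dist_eq_norm, h1]
  have h4 := norm_sub_le ((x - y) - (2 * inner ℝ n (x - y)) • n) ((2 * (τ x - τ y)) • n)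
  have h5 := norm_sub_norm_le ((x - y) - (2 * inner ℝ n (x - y)) • n) ((2 * (τ x - τ y)) • n)
  rw [h2] at h4 h5
  constructor <;> linarith

theorem lipschitzWith_reflect (hn : ‖n‖ = 1) (hτ : LipschitzWith ε τ) :
    LipschitzWith (1 + 2 * ε) (reflect n τ) :=
  LipschitzWith.of_dist_le_mul fun x y => by
    push_cast
    exact (reflect_sub hn hτ x y).2

theorem antilipschitzWith_reflect (hn : ‖n‖ = 1) (hτ : LipschitzWith ε τ) (hε : (ε : ℝ) < 1 / 2) :
    AntilipschitzWith (1 - 2 * ε)⁻¹ (reflect n τ) := by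
  refine AntilipschitzWith.of_le_mul_dist fun x y => ?_
  have h1 : 2 * ε ≤ 1 := by
    rw [← NNReal.coe_le_coe]
    push_cast
    linarith
  rw [NNReal.coe_inv, NNReal.coe_sub h1, ← div_eq_inv_mul, le_div_iff₀ (by push_cast; linarith)]
  have := (reflect_sub hn hτ x y).1
  push_cast
  linarith

/-- The reflection carries points of negative height to points of positive height. -/
theorem height_reflect_pos (hn : ‖n‖ = 1) (hτ : LipschitzWith ε τ) (hε : (ε : ℝ) < 1 / 2)
    {x : EuclideanSpace ℝ (Fin d)} (hx : height n τ x < 0) : 0 < height n τ (reflect n τ x) := by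
  have h1 : height n τ (reflect n τ x) = -height n τ x + (τ (reflect n τ x) - τ x) := by
    rw [height, reflect, inner_sub_right, inner_smul_right, real_inner_self_eq_norm_sq, hn]
    rw [height]
    ring
  have h2 : |τ (reflect n τ x) - τ x| ≤ ε * (2 * -height n τ x) := by
    have := hτ.dist_le_mul (reflect n τ x) x
    rw [Real.dist_eq] at this
    refine this.trans (le_of_eq ?_)
    rw [dist_eq_norm, reflect, sub_sub_cancel_left, norm_neg, norm_smul, hn, mul_one,
      Real.norm_eq_abs, abs_mul, abs_two, abs_of_neg hx]
  have h3 := (abs_le.1 h2).1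
  rw [h1]
  nlinarith

theorem volume_height_eq_zero (hn : ‖n‖ = 1) (hτ : LipschitzWith ε τ) (hε : (ε : ℝ) < 1 / 2) :
    volume {x | height n τ x = 0} = 0 := by
  -- different translates of the hypersurface along `n` are disjoint
  refine Measure.addHaar_eq_zero_of_disjoint_translates volume
    (fun m : ℕ => ((m : ℝ) + 1)⁻¹ • n) ?_ ?_ ?_
  · rw [isBounded_iff_forall_norm_le]
    refine ⟨1, ?_⟩
    rintro _ ⟨m, rfl⟩
    rw [norm_smul, hn, mul_one, Real.norm_of_nonneg (by positivity)]
    exact inv_le_one_of_one_le₀ (by linarith [(Nat.cast_nonneg m : (0 : ℝ) ≤ m)])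
  · intro i j hij
    refine Set.disjoint_left.2 ?_
    rintro x hx hx'
    simp only [Set.singleton_add] at hx hx'
    obtain ⟨y, hy, hyx⟩ := hx
    obtain ⟨z, hz, hzx⟩ := hx'
    have hy' : inner ℝ n y + τ y = 0 := hy
    have hz' : inner ℝ n z + τ z = 0 := hz
    simp only at hyx hzx
    set a : ℝ := ((i : ℝ) + 1)⁻¹
    set b : ℝ := ((j : ℝ) + 1)⁻¹
    have hab : a ≠ b := by
      intro h
      have := inv_injective h
      exact hij (by exact_mod_cast add_right_cancel this)
    have h1 : y - z = (b - a) • n := by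
      rw [sub_smul, sub_eq_sub_iff_add_eq_add, add_comm y, hyx, ← hzx]
    have h2 : inner ℝ n y - inner ℝ n z = b - a := by
      rw [← inner_sub_right, h1, inner_smul_right, real_inner_self_eq_norm_sq, hn]
      ring
    have h3 := hτ.dist_le_mul y z
    rw [Real.dist_eq, dist_eq_norm, h1, norm_smul, hn, mul_one, Real.norm_eq_abs] at h3
    have h4 : τ y - τ z = -(b - a) := by linarith
    rw [h4, abs_neg] at h3
    have h5 : 0 < |b - a| := abs_pos.2 (sub_ne_zero.2 hab.symm)
    nlinarith
  · exact measurableSet_eq_fun (lipschitzWith_height hn hτ).continuous.measurable measurable_const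

end Reflection

/-- A map with Lipschitz inverse distorts Lebesgue measure by a bounded factor. -/
theorem map_volume_le_of_antilipschitz {K : ℝ≥0} {R : EuclideanSpace ℝ (Fin d) → EuclideanSpace ℝ (Fin d)}
    (hR : AntilipschitzWith K R) (hc : Continuous R) :
    Measure.map R volume ≤ ((K ^ d : ℝ≥0) : ℝ≥0∞) • (volume : Measure (EuclideanSpace ℝ (Fin d))) := by
  have : (Measure.hausdorffMeasure (d : ℝ) : Measure (EuclideanSpace ℝ (Fin d))).IsAddHaarMeasure := by
    simpa using MeasureTheory.isAddHaarMeasure_hausdorffMeasure (E := EuclideanSpace ℝ (Fin d))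
  have hvol := Measure.isAddLeftInvariant_eq_smul (volume : Measure (EuclideanSpace ℝ (Fin d)))
    (Measure.hausdorffMeasure (d : ℝ))
  refine Measure.le_iff.2 fun S hS => ?_
  rw [Measure.map_apply hc.measurable hS, hvol]
  simp only [Measure.smul_apply, smul_eq_mul, ENNReal.smul_def]
  have h := hR.hausdorffMeasure_preimage_le (d := (d : ℝ)) (Nat.cast_nonneg d) S
  rw [ENNReal.rpow_natCast, ← ENNReal.coe_pow] at h
  calc _ ≤ _ := mul_le_mul_right h _
    _ = _ := by ring

theorem integral_comp_le_of_antilipschitz {K : ℝ≥0}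
    {R : EuclideanSpace ℝ (Fin d) → EuclideanSpace ℝ (Fin d)}
    (hR : AntilipschitzWith K R) (hc : Continuous R) {f : EuclideanSpace ℝ (Fin d) → ℝ}
    (hf : Integrable f) (h0 : ∀ x, 0 ≤ f x) :
    Integrable (fun x => f (R x)) ∧ ∫ x, f (R x) ≤ K ^ d * ∫ x, f x := by
  have hle := map_volume_le_of_antilipschitz hR hc
  have hint : Integrable f (((K ^ d : ℝ≥0) : ℝ≥0∞) • (volume : Measure (EuclideanSpace ℝ (Fin d)))) :=
    hf.smul_measure ENNReal.coe_ne_top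
  have hmap := hint.mono_measure hle
  refine ⟨hmap.comp_measurable hc.measurable, ?_⟩
  rw [← integral_map hc.aemeasurable hmap.aestronglyMeasurable]
  refine (integral_mono_measure hle (Eventually.of_forall h0) hint).trans (le_of_eq ?_)
  rw [integral_smul_measure, ENNReal.coe_toReal, smul_eq_mul, NNReal.coe_pow]

/-- The Euclidean norm of the gradient is submultiplicative under composition. -/
theorem sum_norm_comp_sq_le (A : EuclideanSpace ℝ (Fin d) →L[ℝ] ℂ)
    (M : EuclideanSpace ℝ (Fin d) →L[ℝ] EuclideanSpace ℝ (Fin d)) :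
    ∑ i, ‖A (M (EuclideanSpace.single i 1))‖ ^ 2 ≤
      ‖M‖ ^ 2 * ∑ i, ‖A (EuclideanSpace.single i 1)‖ ^ 2 := by
  have hnorm : ∀ a : EuclideanSpace ℝ (Fin d) →L[ℝ] ℝ,
      ∑ i, (a (EuclideanSpace.single i 1)) ^ 2 = ‖a‖ ^ 2 := by
    intro a
    set v := (InnerProductSpace.toDual ℝ (EuclideanSpace ℝ (Fin d))).symm a with hv
    have h1 : ‖a‖ = ‖v‖ := by rw [hv, LinearIsometryEquiv.norm_map]
    rw [h1, EuclideanSpace.real_norm_sq_eq]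
    refine Finset.sum_congr rfl fun i _ => ?_
    rw [← InnerProductSpace.toDual_symm_apply, ← hv, EuclideanSpace.inner_single_right]
    simp
  have key : ∀ a : EuclideanSpace ℝ (Fin d) →L[ℝ] ℝ,
      ∑ i, (a (M (EuclideanSpace.single i 1))) ^ 2 ≤
        ‖M‖ ^ 2 * ∑ i, (a (EuclideanSpace.single i 1)) ^ 2 := by
    intro a
    have h1 := hnorm (a.comp M)
    simp only [ContinuousLinearMap.comp_apply] at h1
    rw [h1, hnorm, ← mul_pow, mul_comm]
    gcongr
    exact ContinuousLinearMap.opNorm_comp_le a M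
  have hsq : ∀ z : ℂ, ‖z‖ ^ 2 = z.re ^ 2 + z.im ^ 2 := fun z => by
    rw [Complex.sq_norm, Complex.normSq_apply]; ring
  have h1 := key (Complex.reCLM.comp A)
  have h2 := key (Complex.imCLM.comp A)
  simp only [ContinuousLinearMap.comp_apply, Complex.reCLM_apply, Complex.imCLM_apply] at h1 h2
  simp only [hsq, Finset.sum_add_distrib]
  linarith

theorem norm_vgrad_comp_le {f : EuclideanSpace ℝ (Fin d) → ℂ}
    {R : EuclideanSpace ℝ (Fin d) → EuclideanSpace ℝ (Fin d)} {L : ℝ≥0} (hR : LipschitzWith L R)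
    {x : EuclideanSpace ℝ (Fin d)} (hf : DifferentiableAt ℝ f (R x)) (hx : DifferentiableAt ℝ R x) :
    ‖vgrad (fun y => f (R y)) x‖ ≤ L * ‖vgrad f (R x)‖ := by
  have h1 : fderiv ℝ (fun y => f (R y)) x = (fderiv ℝ f (R x)).comp (fderiv ℝ R x) :=
    fderiv_comp x hf hx
  have h2 := sum_norm_comp_sq_le (fderiv ℝ f (R x)) (fderiv ℝ R x)
  have h3 : ‖fderiv ℝ R x‖ ≤ L := norm_fderiv_le_of_lipschitz ℝ hR
  refine abs_le_of_sq_le_sq' ?_ (by positivity) |>.2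
  rw [mul_pow, EuclideanSpace.norm_sq_eq, EuclideanSpace.norm_sq_eq]
  simp only [vgrad_apply, h1, ContinuousLinearMap.comp_apply]
  refine h2.trans ?_
  gcongr

end NeumannCell

/-! ### Local coercivity with reflected test functions -/

namespace NeumannCell

variable {d : ℕ}

theorem continuous_vgrad {f : EuclideanSpace ℝ (Fin d) → ℂ} (hf : ContDiff ℝ ∞ f) :
    Continuous (vgrad f) := by
  refine (PiLp.continuous_toLp 2 _).comp (continuous_pi fun i => ?_)
  exact (hf.continuous_fderiv (by simp)).clm_apply continuous_const

theorem vgrad_eq_zero_of_notMem_tsupport {f : EuclideanSpace ℝ (Fin d) → ℂ}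
    {x : EuclideanSpace ℝ (Fin d)} (hx : x ∉ tsupport f) : vgrad f x = 0 := by
  have h : fderiv ℝ f x = 0 := by
    by_contra hne
    exact hx (support_fderiv_subset ℝ hne)
  ext i
  simp [h]

theorem hasCompactSupport_vgrad {f : EuclideanSpace ℝ (Fin d) → ℂ} (hf : HasCompactSupport f) :
    HasCompactSupport (vgrad f) :=
  HasCompactSupport.intro hf fun _ hx => vgrad_eq_zero_of_notMem_tsupport hx

theorem integrable_norm_sq_of_compactSupport {F : Type*} [NormedAddCommGroup F]
    {f : EuclideanSpace ℝ (Fin d) → F} (hf : Continuous f) (hc : HasCompactSupport f) :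
    Integrable (fun x => ‖f x‖ ^ 2) := by
  refine (hf.norm.pow 2).integrable_of_hasCompactSupport ?_
  refine HasCompactSupport.intro hc fun x hx => ?_
  simp [image_eq_zero_of_notMem_tsupport hx]

theorem vgrad_congr {f g : EuclideanSpace ℝ (Fin d) → ℂ} {x : EuclideanSpace ℝ (Fin d)}
    (h : f =ᶠ[𝓝 x] g) : vgrad f x = vgrad g x := by
  ext i
  simp [h.fderiv_eq]

theorem vgrad_sub {f g : EuclideanSpace ℝ (Fin d) → ℂ} {x : EuclideanSpace ℝ (Fin d)}
    (hf : DifferentiableAt ℝ f x) (hg : DifferentiableAt ℝ g x) :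
    vgrad (fun y => f y - g y) x = vgrad f x - vgrad g x := by
  ext i
  simp [fderiv_fun_sub hf hg]

theorem vgrad_const_mul {f : EuclideanSpace ℝ (Fin d) → ℂ} {x : EuclideanSpace ℝ (Fin d)}
    (hf : DifferentiableAt ℝ f x) (c : ℂ) :
    vgrad (fun y => c * f y) x = c • vgrad f x := by
  ext i
  simp [fderiv_const_mul hf c]

/-- The coefficient of the transmission problem: `1` in `D` and `k` elsewhere. -/
noncomputable def coeff (D : Set (EuclideanSpace ℝ (Fin d))) (k : ℂ) (x : EuclideanSpace ℝ (Fin d)) : ℂ :=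
  open Classical in if x ∈ D then 1 else k

theorem coeff_of_mem {D : Set (EuclideanSpace ℝ (Fin d))} {k : ℂ} {x : EuclideanSpace ℝ (Fin d)}
    (h : x ∈ D) : coeff D k x = 1 := if_pos h

theorem coeff_of_notMem {D : Set (EuclideanSpace ℝ (Fin d))} {k : ℂ} {x : EuclideanSpace ℝ (Fin d)}
    (h : x ∉ D) : coeff D k x = k := if_neg h

theorem norm_coeff_le (D : Set (EuclideanSpace ℝ (Fin d))) (k : ℂ) (x : EuclideanSpace ℝ (Fin d)) :
    ‖coeff D k x‖ ≤ 1 + ‖k‖ := by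
  by_cases h : x ∈ D
  · rw [coeff_of_mem h, norm_one]; linarith [norm_nonneg k]
  · rw [coeff_of_notMem h]; linarith

theorem measurable_coeff {D : Set (EuclideanSpace ℝ (Fin d))} (hD : MeasurableSet D) (k : ℂ) :
    Measurable (coeff D k) := by
  classical
  have : coeff D k = fun x => if x ∈ D then 1 else k := by
    funext x
    by_cases h : x ∈ D
    · rw [coeff_of_mem h, if_pos h]
    · rw [coeff_of_notMem h, if_neg h]
  rw [this]
  exact Measurable.ite hD measurable_const measurable_const

section Reflection

variable {n : EuclideanSpace ℝ (Fin d)} {τ : EuclideanSpace ℝ (Fin d) → ℝ} {ε : ℝ≥0}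
  {w : EuclideanSpace ℝ (Fin d) → ℂ}

/-- The reflected test function: it equals `w` where the height is positive, and minus `w` plus twice
the reflection of `w` where the height is negative. -/
noncomputable def reflectedTest (n : EuclideanSpace ℝ (Fin d)) (τ : EuclideanSpace ℝ (Fin d) → ℝ)
    (w : EuclideanSpace ℝ (Fin d) → ℂ) (x : EuclideanSpace ℝ (Fin d)) : ℂ :=
  2 * w (fold n τ x) - w x

theorem exists_lipschitz_reflectedTest (hn : ‖n‖ = 1) (hτ : LipschitzWith ε τ) {C : ℝ≥0}
    (hw : LipschitzWith C w) : ∃ C', LipschitzWith C' (reflectedTest n τ w) := by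
  refine ⟨_, LipschitzWith.sub (Kf := 2 * (C * (1 + 2 * (1 + ε)))) (LipschitzWith.of_dist_le_mul fun x y => ?_) hw⟩
  have := (hw.comp (lipschitzWith_fold hn hτ)).dist_le_mul x y
  simp only [Function.comp_apply] at this
  rw [dist_eq_norm, ← mul_sub, norm_mul, ← dist_eq_norm (w _), Complex.norm_ofNat]
  push_cast at this ⊢
  linarith

theorem norm_reflectedTest_le (x : EuclideanSpace ℝ (Fin d)) :
    ‖reflectedTest n τ w x‖ ≤ ‖w x‖ + 2 * ‖w (reflect n τ x)‖ := by
  rw [reflectedTest]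
  rcases le_total 0 (height n τ x) with h | h
  · rw [fold_of_nonneg h]
    have : 2 * w x - w x = w x := by ring
    rw [this]
    linarith [norm_nonneg (w (reflect n τ x))]
  · rw [fold_of_nonpos h]
    refine (norm_sub_le _ _).trans ?_
    rw [norm_mul, Complex.norm_ofNat]
    linarith

theorem vgrad_reflectedTest_of_pos (hn : ‖n‖ = 1) (hτ : LipschitzWith ε τ)
    {x : EuclideanSpace ℝ (Fin d)} (hx : 0 < height n τ x) :
    vgrad (reflectedTest n τ w) x = vgrad w x := by
  refine vgrad_congr ?_
  filter_upwards [(lipschitzWith_height hn hτ).continuous.continuousAt.eventually (lt_mem_nhds hx)]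
    with y hy
  rw [reflectedTest, fold_of_nonneg hy.le]
  ring

theorem ae_norm_vgrad_reflectedTest_add_le (hn : ‖n‖ = 1) (hτ : LipschitzWith ε τ)
    (hw : Differentiable ℝ w) : ∀ᵐ x, height n τ x < 0 →
    ‖vgrad (reflectedTest n τ w) x + vgrad w x‖ ≤ 2 * ((1 + 2 * ε) * ‖vgrad w (reflect n τ x)‖) := by
  filter_upwards [(lipschitzWith_reflect hn hτ).ae_differentiableAt (μ := volume)] with x hx hneg
  have h1 : reflectedTest n τ w =ᶠ[𝓝 x] fun y => 2 * w (reflect n τ y) - w y := by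
    filter_upwards [(lipschitzWith_height hn hτ).continuous.continuousAt.eventually (gt_mem_nhds hneg)]
      with y hy
    rw [reflectedTest, fold_of_nonpos (le_of_lt hy)]
  have h2 : DifferentiableAt ℝ (fun y => w (reflect n τ y)) x := (hw _).comp x hx
  rw [vgrad_congr h1, vgrad_sub (h2.const_mul 2) (hw x), vgrad_const_mul h2, sub_add_cancel, norm_smul,
    Complex.norm_ofNat]
  have := norm_vgrad_comp_le (lipschitzWith_reflect hn hτ) (hw _) hx
  push_cast at this
  gcongr

theorem ae_height_ne_zero (hn : ‖n‖ = 1) (hτ : LipschitzWith ε τ) (hε : (ε : ℝ) < 1 / 2) :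
    ∀ᵐ x, height n τ x ≠ 0 :=
  measure_eq_zero_iff_ae_notMem.1 (volume_height_eq_zero hn hτ hε)

theorem ae_norm_vgrad_reflectedTest_le (hn : ‖n‖ = 1) (hτ : LipschitzWith ε τ) (hε : (ε : ℝ) < 1 / 2)
    (hw : Differentiable ℝ w) : ∀ᵐ x, ‖vgrad (reflectedTest n τ w) x‖ ≤
      ‖vgrad w x‖ + 2 * ((1 + 2 * ε) * ‖vgrad w (reflect n τ x)‖) := by
  filter_upwards [ae_norm_vgrad_reflectedTest_add_le hn hτ hw, ae_height_ne_zero hn hτ hε] with x h1 h2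
  rcases h2.lt_or_gt with h | h
  · have := norm_add_le (vgrad (reflectedTest n τ w) x + vgrad w x) (-vgrad w x)
    rw [add_neg_cancel_right, norm_neg] at this
    linarith [h1 h]
  · rw [vgrad_reflectedTest_of_pos hn hτ h]
    have : 0 ≤ 2 * ((1 + 2 * (ε : ℝ)) * ‖vgrad w (reflect n τ x)‖) := by positivity
    linarith

/-- An `L²` bound for a function dominated by `F` and its reflection. -/
theorem integral_sq_le_of_reflect {F' : Type*} [NormedAddCommGroup F'] {G' : Type*}
    [NormedAddCommGroup G']
    (hn : ‖n‖ = 1) (hτ : LipschitzWith ε τ) (hε : (ε : ℝ) < 1 / 2)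
    {F : EuclideanSpace ℝ (Fin d) → F'} (hF : Continuous F) (hc : HasCompactSupport F)
    {G : EuclideanSpace ℝ (Fin d) → G'} (hG : AEStronglyMeasurable G) {M : ℝ}
    (h : ∀ᵐ x, ‖G x‖ ≤ ‖F x‖ + M * ‖F (reflect n τ x)‖) :
    Integrable (fun x => ‖G x‖ ^ 2) ∧
      ∫ x, ‖G x‖ ^ 2 ≤ (2 + 2 * M ^ 2 * (((1 - 2 * ε)⁻¹ : ℝ≥0) : ℝ) ^ d) * ∫ x, ‖F x‖ ^ 2 := by
  have hi := integrable_norm_sq_of_compactSupport hF hc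
  obtain ⟨h1, h2⟩ := integral_comp_le_of_antilipschitz (antilipschitzWith_reflect hn hτ hε)
    (lipschitzWith_reflect hn hτ).continuous hi (fun x => by positivity)
  have h3 : Integrable (fun x => 2 * ‖F x‖ ^ 2 + 2 * M ^ 2 * ‖F (reflect n τ x)‖ ^ 2) :=
    (hi.const_mul 2).add (h1.const_mul _)
  have h4 : ∀ᵐ x, ‖G x‖ ^ 2 ≤ 2 * ‖F x‖ ^ 2 + 2 * M ^ 2 * ‖F (reflect n τ x)‖ ^ 2 := by
    filter_upwards [h] with x hx
    have := pow_le_pow_left₀ (norm_nonneg _) hx 2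
    nlinarith [sq_nonneg (‖F x‖ - M * ‖F (reflect n τ x)‖)]
  have h5 : Integrable (fun x => ‖G x‖ ^ 2) := by
    refine h3.mono' (hG.norm.pow 2) ?_
    filter_upwards [h4] with x hx
    rwa [Real.norm_of_nonneg (by positivity)]
  refine ⟨h5, (integral_mono_ae h5 h3 h4).trans ?_⟩
  rw [integral_add (hi.const_mul 2) (h1.const_mul _), integral_const_mul, integral_const_mul, add_mul]
  have : 0 ≤ 2 * M ^ 2 := by positivity
  nlinarith [mul_le_mul_of_nonneg_left h2 this]

/-- With the reflected test function, the form with weight `α` above and `-β` below the hypersurface is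
coercive, provided that `β < α` up to the distortion of the reflection. -/
theorem reflectedTest_coercive (hn : ‖n‖ = 1) (hτ : LipschitzWith ε τ) (hε : (ε : ℝ) < 1 / 2)
    (hw : ContDiff ℝ ∞ w) (hwc : HasCompactSupport w) {α β s c : ℝ} (hβ : 0 < β) (hs : 0 < s)
    (hcα : c ≤ α - β * s⁻¹ * (1 + 2 * ε) ^ 2 * (((1 - 2 * ε)⁻¹ : ℝ≥0) : ℝ) ^ d)
    (hcβ : c ≤ β * (1 - s)) {a : EuclideanSpace ℝ (Fin d) → ℝ}
    (hpos : ∀ x ∈ tsupport w, 0 < height n τ x → a x = α)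
    (hneg : ∀ x ∈ tsupport w, height n τ x < 0 → a x = -β)
    (hint : Integrable fun x => a x * (inner ℂ (vgrad (reflectedTest n τ w) x) (vgrad w x)).re) :
    c * ∫ x, ‖vgrad w x‖ ^ 2 ≤
      ∫ x, a x * (inner ℂ (vgrad (reflectedTest n τ w) x) (vgrad w x)).re := by
  set v := reflectedTest n τ w with hv
  set h := height n τ with hh
  have hhc : Continuous h := (lipschitzWith_height hn hτ).continuous
  have hmP : MeasurableSet {x | 0 < h x} := measurableSet_lt measurable_const hhc.measurable
  have hmN : MeasurableSet {x | h x < 0} := measurableSet_lt hhc.measurable measurable_const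
  have hi := integrable_norm_sq_of_compactSupport (continuous_vgrad hw) (hasCompactSupport_vgrad hwc)
  set f : EuclideanSpace ℝ (Fin d) → ℝ := Set.indicator {x | 0 < h x} fun x => ‖vgrad w x‖ ^ 2 with hf
  set g : EuclideanSpace ℝ (Fin d) → ℝ := Set.indicator {x | h x < 0} fun x => ‖vgrad w x‖ ^ 2 with hg
  have hf0 : ∀ x, 0 ≤ f x := fun x => Set.indicator_nonneg (fun _ _ => by positivity) x
  have hg0 : ∀ x, 0 ≤ g x := fun x => Set.indicator_nonneg (fun _ _ => by positivity) x
  have hfi : Integrable f := hi.indicator hmP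
  have hgi : Integrable g := hi.indicator hmN
  obtain ⟨hRi, hRle⟩ := integral_comp_le_of_antilipschitz (antilipschitzWith_reflect hn hτ hε)
    (lipschitzWith_reflect hn hτ).continuous hfi hf0
  have hsum : ∀ᵐ x, ‖vgrad w x‖ ^ 2 = f x + g x := by
    filter_upwards [ae_height_ne_zero hn hτ hε] with x hx
    rcases hx.lt_or_gt with hx | hx
    · have h1 : x ∉ {x | 0 < h x} := not_lt.2 (le_of_lt hx)
      have h2 : x ∈ {x | h x < 0} := hx
      simp [f, g, Set.indicator_of_notMem h1, Set.indicator_of_mem h2]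
    · have h1 : x ∈ {x | 0 < h x} := hx
      have h2 : x ∉ {x | h x < 0} := not_lt.2 (le_of_lt hx)
      simp [f, g, Set.indicator_of_mem h1, Set.indicator_of_notMem h2]
  -- the pointwise lower bound, by Young's inequality with parameter `s`
  have hpt : ∀ᵐ x, α * f x + β * (1 - s) * g x - β * s⁻¹ * (1 + 2 * ε) ^ 2 * f (reflect n τ x) ≤
      a x * (inner ℂ (vgrad v x) (vgrad w x)).re := by
    filter_upwards [ae_height_ne_zero hn hτ hε,
      ae_norm_vgrad_reflectedTest_add_le hn hτ (hw.differentiable (by simp))] with x hx hgrad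
    by_cases hxs : x ∈ tsupport w
    swap
    · have h0 : vgrad w x = 0 := vgrad_eq_zero_of_notMem_tsupport hxs
      have hf0' : f x = 0 := by simp [f, Set.indicator_apply, h0]
      have hg0' : g x = 0 := by simp [g, Set.indicator_apply, h0]
      rw [hf0', hg0', h0, inner_zero_right, Complex.zero_re, mul_zero, mul_zero, mul_zero]
      have := hf0 (reflect n τ x)
      have : 0 ≤ β * s⁻¹ * (1 + 2 * (ε : ℝ)) ^ 2 * f (reflect n τ x) := by positivity
      linarith
    rcases hx.lt_or_gt with hx | hx
    · have h1 : x ∉ {x | 0 < h x} := not_lt.2 (le_of_lt hx)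
      have h2 : x ∈ {x | h x < 0} := hx
      have h3 : reflect n τ x ∈ {x | 0 < h x} := height_reflect_pos hn hτ hε hx
      have e1 : f x = 0 := Set.indicator_of_notMem h1 _
      have e2 : g x = ‖vgrad w x‖ ^ 2 := Set.indicator_of_mem h2 _
      have e3 : f (reflect n τ x) = ‖vgrad w (reflect n τ x)‖ ^ 2 := Set.indicator_of_mem h3 _
      rw [e1, e2, e3, hneg x hxs hx]
      have hb := hgrad hx
      set p := ‖vgrad w x‖
      set q := (1 + 2 * (ε : ℝ)) * ‖vgrad w (reflect n τ x)‖ with hq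
      have h4 : (inner ℂ (vgrad v x) (vgrad w x)).re ≤ 2 * q * p - p ^ 2 := by
        have h5 : inner ℂ (vgrad v x) (vgrad w x) =
            inner ℂ (vgrad v x + vgrad w x) (vgrad w x) - inner ℂ (vgrad w x) (vgrad w x) := by
          rw [inner_add_left]; ring
        have h6 : (inner ℂ (vgrad w x) (vgrad w x)).re = p ^ 2 := by
          rw [inner_self_eq_norm_sq_to_K]
          norm_cast
        rw [h5, Complex.sub_re, h6]
        have h7 := (Complex.re_le_norm _).trans (norm_inner_le_norm (𝕜 := ℂ) (vgrad v x + vgrad w x) (vgrad w x))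
        have h8 : ‖vgrad v x + vgrad w x‖ * ‖vgrad w x‖ ≤ 2 * q * p :=
          mul_le_mul_of_nonneg_right hb (norm_nonneg _)
        linarith
      have h9 : 2 * q * p ≤ s * p ^ 2 + s⁻¹ * q ^ 2 := by
        have : 0 ≤ s⁻¹ * (q - s * p) ^ 2 := by positivity
        have e : s⁻¹ * (q - s * p) ^ 2 = s⁻¹ * q ^ 2 - 2 * q * p + s * p ^ 2 := by
          field_simp
          ring
        linarith
      have h10 : s⁻¹ * (1 + 2 * (ε : ℝ)) ^ 2 * ‖vgrad w (reflect n τ x)‖ ^ 2 = s⁻¹ * q ^ 2 := by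
        rw [hq]; ring
      have h11 : (inner ℂ (vgrad v x) (vgrad w x)).re ≤ s * p ^ 2 + s⁻¹ * q ^ 2 - p ^ 2 := by linarith
      have h12 := mul_le_mul_of_nonneg_left h11 hβ.le
      have h13 : β * s⁻¹ * (1 + 2 * (ε : ℝ)) ^ 2 * ‖vgrad w (reflect n τ x)‖ ^ 2 = β * (s⁻¹ * q ^ 2) := by
        rw [← h10]; ring
      rw [h13]
      linarith
    · have h1 : x ∈ {x | 0 < h x} := hx
      have h2 : x ∉ {x | h x < 0} := not_lt.2 (le_of_lt hx)
      have e1 : f x = ‖vgrad w x‖ ^ 2 := Set.indicator_of_mem h1 _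
      have e2 : g x = 0 := Set.indicator_of_notMem h2 _
      have e3 : (inner ℂ (vgrad v x) (vgrad w x)).re = ‖vgrad w x‖ ^ 2 := by
        rw [hv, vgrad_reflectedTest_of_pos hn hτ hx, inner_self_eq_norm_sq_to_K]
        norm_cast
      rw [e1, e2, e3, hpos x hxs hx]
      have := hf0 (reflect n τ x)
      have : 0 ≤ β * s⁻¹ * (1 + 2 * (ε : ℝ)) ^ 2 * f (reflect n τ x) := by positivity
      linarith
  have hli : Integrable fun x => α * f x + β * (1 - s) * g x -
      β * s⁻¹ * (1 + 2 * ε) ^ 2 * f (reflect n τ x) :=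
    ((hfi.const_mul _).add (hgi.const_mul _)).sub (hRi.const_mul _)
  refine le_trans ?_ (integral_mono_ae hli hint hpt)
  have hadd : Integrable fun x => α * f x + β * (1 - s) * g x :=
    (hfi.const_mul _).add (hgi.const_mul _)
  rw [integral_sub hadd (hRi.const_mul _),
    integral_add (hfi.const_mul _) (hgi.const_mul _), integral_const_mul, integral_const_mul,
    integral_const_mul, integral_congr_ae hsum, integral_add hfi hgi]
  have hF : 0 ≤ ∫ x, f x := integral_nonneg hf0
  have hG : 0 ≤ ∫ x, g x := integral_nonneg hg0
  have h1 : 0 ≤ β * s⁻¹ * (1 + 2 * (ε : ℝ)) ^ 2 := by positivity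
  have h2 := mul_le_mul_of_nonneg_left hRle h1
  have h3 := mul_le_mul_of_nonneg_right hcα hF
  have h4 := mul_le_mul_of_nonneg_right hcβ hG
  linarith

end Reflection

end NeumannCell

/-! ### Local coercivity at every point of the closed cell -/

namespace NeumannCell

variable {d : ℕ}

/-- The transmission form is locally coercive at `p`: every smooth function `w` supported near `p` has
a test function `v`, controlled by `w`, such that `B_k(v, w)` dominates the Dirichlet integral of `w`. -/
def LocallyCoercive (D : Set (EuclideanSpace ℝ (Fin d))) (k : ℂ) (p : EuclideanSpace ℝ (Fin d)) : Prop :=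
  ∃ ρ c C : ℝ, 0 < ρ ∧ 0 < c ∧ 0 ≤ C ∧ ∀ w : EuclideanSpace ℝ (Fin d) → ℂ, ContDiff ℝ ∞ w →
    tsupport w ⊆ Metric.ball p ρ → ∃ v : EuclideanSpace ℝ (Fin d) → ℂ,
      (∃ L : ℝ≥0, LipschitzWith L v) ∧ (∃ M : ℝ, ∀ x, ‖v x‖ ≤ M) ∧
      ∫ x in unitCell d, ‖v x‖ ^ 2 ≤ C * ∫ x in unitCell d, ‖w x‖ ^ 2 ∧
      ∫ x in unitCell d, ‖vgrad v x‖ ^ 2 ≤ C * ∫ x in unitCell d, ‖vgrad w x‖ ^ 2 ∧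
      c * ∫ x in unitCell d, ‖vgrad w x‖ ^ 2 ≤
        ‖∫ x in unitCell d, coeff D k x * inner ℂ (vgrad w x) (vgrad v x)‖

theorem hasCompactSupport_of_tsupport_subset_ball {w : EuclideanSpace ℝ (Fin d) → ℂ}
    {p : EuclideanSpace ℝ (Fin d)} {ρ : ℝ} (h : tsupport w ⊆ Metric.ball p ρ) : HasCompactSupport w :=
  (isCompact_closedBall p ρ).of_isClosed_subset (isClosed_tsupport w)
    (h.trans Metric.ball_subset_closedBall)

theorem locallyCoercive_of_coeff_eq {D : Set (EuclideanSpace ℝ (Fin d))} {k κ : ℂ}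
    {p : EuclideanSpace ℝ (Fin d)} {ρ : ℝ} (hρ : 0 < ρ) (hκ : κ ≠ 0)
    (h : ∀ x ∈ Metric.ball p ρ, coeff D k x = κ) : LocallyCoercive D k p := by
  refine ⟨ρ, ‖κ‖, 1, hρ, norm_pos_iff.2 hκ, zero_le_one, fun w hw hws => ?_⟩
  have hwc := hasCompactSupport_of_tsupport_subset_ball hws
  obtain ⟨L, hL⟩ := hw.lipschitzWith_of_hasCompactSupport hwc (by simp)
  obtain ⟨M, hM⟩ := hw.continuous.bounded_above_of_compact_support hwc
  refine ⟨w, ⟨L, hL⟩, ⟨M, hM⟩, by rw [one_mul], by rw [one_mul], le_of_eq ?_⟩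
  have e : ∀ x, coeff D k x * inner ℂ (vgrad w x) (vgrad w x) = κ * ((‖vgrad w x‖ ^ 2 : ℝ) : ℂ) := by
    intro x
    have h1 : inner ℂ (vgrad w x) (vgrad w x) = ((‖vgrad w x‖ ^ 2 : ℝ) : ℂ) := by
      rw [inner_self_eq_norm_sq_to_K]
      exact (Complex.ofReal_pow _ _).symm
    rw [h1]
    by_cases hx : x ∈ tsupport w
    · rw [h x (hws hx)]
    · simp [vgrad_eq_zero_of_notMem_tsupport hx]
  simp_rw [e]
  rw [integral_const_mul, integral_complex_ofReal, norm_mul, Complex.norm_real,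
    Real.norm_of_nonneg (integral_nonneg fun x => by positivity)]

theorem exists_small_distortion (d : ℕ) {α β : ℝ} (h : β < α) :
    ∃ ε : ℝ≥0, 0 < ε ∧ (ε : ℝ) < 1 / 2 ∧
      β * (1 + 2 * ε) ^ 2 * (((1 - 2 * ε)⁻¹ : ℝ≥0) : ℝ) ^ d < α := by
  have hc : ContinuousAt (fun t : ℝ => β * (1 + 2 * t) ^ 2 * ((1 - 2 * t)⁻¹) ^ d) 0 := by
    have : ContinuousAt (fun t : ℝ => (1 - 2 * t)⁻¹) 0 :=
      ContinuousAt.inv₀ (by fun_prop) (by norm_num)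
    exact ContinuousAt.mul (by fun_prop) (this.pow d)
  have h1 : ∀ᶠ t in 𝓝[>] (0 : ℝ), β * (1 + 2 * t) ^ 2 * ((1 - 2 * t)⁻¹) ^ d < α :=
    nhdsWithin_le_nhds (hc.eventually (gt_mem_nhds (by simpa using h)))
  have h2 : ∀ᶠ t in 𝓝[>] (0 : ℝ), t < 1 / 2 :=
    nhdsWithin_le_nhds (gt_mem_nhds (by norm_num))
  obtain ⟨t, ⟨ht1, ht2⟩, ht3⟩ := ((h1.and h2).and self_mem_nhdsWithin).exists
  have ht : (0 : ℝ) < t := ht3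
  have hle : 2 * t.toNNReal ≤ 1 := by
    rw [← NNReal.coe_le_coe]
    push_cast
    rw [Real.coe_toNNReal _ ht.le]
    linarith
  refine ⟨t.toNNReal, Real.toNNReal_pos.2 ht, by rwa [Real.coe_toNNReal _ ht.le], ?_⟩
  rw [NNReal.coe_inv, NNReal.coe_sub hle]
  push_cast
  rw [Real.coe_toNNReal _ ht.le]
  exact ht1

theorem integrable_coeff_inner {D : Set (EuclideanSpace ℝ (Fin d))} (hD : MeasurableSet D) (k : ℂ)
    {V W : EuclideanSpace ℝ (Fin d) → EuclideanSpace ℂ (Fin d)}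
    (hV : MemLp V 2 (cellMeasure d)) (hW : MemLp W 2 (cellMeasure d)) :
    Integrable (fun x => coeff D k x * inner ℂ (V x) (W x)) (cellMeasure d) := by
  have h1 : Integrable (fun x => inner ℂ (V x) (W x)) (cellMeasure d) := by
    refine (MeasureTheory.L2.integrable_inner (𝕜 := ℂ) (hV.toLp V) (hW.toLp W)).congr ?_
    filter_upwards [hV.coeFn_toLp, hW.coeFn_toLp] with x h1 h2
    rw [h1, h2]
  exact h1.bdd_mul (measurable_coeff hD k).aestronglyMeasurable
    (Eventually.of_forall (norm_coeff_le D k))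

/-- Local coercivity where the coefficient takes values of opposite signs and different moduli above
and below a hypersurface which is nearly flat. -/
theorem locallyCoercive_of_height {D : Set (EuclideanSpace ℝ (Fin d))} (hD : MeasurableSet D) {k : ℝ}
    {p : EuclideanSpace ℝ (Fin d)} {ρ : ℝ} (hρ : 0 < ρ) (hball : Metric.ball p ρ ⊆ unitCell d)
    {n : EuclideanSpace ℝ (Fin d)} {τ : EuclideanSpace ℝ (Fin d) → ℝ} {ε : ℝ≥0}
    (hn : ‖n‖ = 1) (hτ : LipschitzWith ε τ) (hε : (ε : ℝ) < 1 / 2) {α β θ : ℝ} (hβ : 0 < β)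
    (hαβ : β * (1 + 2 * ε) ^ 2 * (((1 - 2 * ε)⁻¹ : ℝ≥0) : ℝ) ^ d < α) (hθ : |θ| = 1)
    (hpos : ∀ x ∈ Metric.ball p ρ, 0 < height n τ x → coeff D k x = ((θ * α : ℝ) : ℂ))
    (hneg : ∀ x ∈ Metric.ball p ρ, height n τ x < 0 → coeff D k x = ((-(θ * β) : ℝ) : ℂ)) :
    LocallyCoercive D k p := by
  set X : ℝ := (1 + 2 * ε) ^ 2 * (((1 - 2 * ε)⁻¹ : ℝ≥0) : ℝ) ^ d with hX
  have hX0 : 0 ≤ X := by positivity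
  rw [mul_assoc, ← hX] at hαβ
  have hα : 0 < α := lt_of_le_of_lt (by positivity) hαβ
  -- a Young parameter strictly between `β X / α` and `1`
  obtain ⟨s, hs1, hs2⟩ : ∃ s, β * X / α < s ∧ s < 1 := exists_between ((div_lt_one hα).2 hαβ)
  have hs : 0 < s := lt_of_le_of_lt (by positivity) hs1
  have hc1 : 0 < α - β * s⁻¹ * X := by
    have h1 : β * X < s * α := (div_lt_iff₀ hα).1 hs1
    have h2 : β * s⁻¹ * X = (β * X) / s := by field_simp
    rw [h2, sub_pos, div_lt_iff₀ hs]
    linarith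
  have hc2 : 0 < β * (1 - s) := mul_pos hβ (by linarith)
  set c := min (α - β * s⁻¹ * X) (β * (1 - s)) with hc
  have hθθ : θ * θ = 1 := by rw [← abs_mul_abs_self, hθ, one_mul]
  set K : ℝ := (((1 - 2 * ε)⁻¹ : ℝ≥0) : ℝ) ^ d with hK
  have hK0 : 0 ≤ K := by positivity
  refine ⟨ρ, c, (2 + 2 * 2 ^ 2 * K) + (2 + 2 * (2 * (1 + 2 * ε)) ^ 2 * K), hρ, lt_min hc1 hc2,
    by positivity, fun w hw hws => ?_⟩
  have hwc := hasCompactSupport_of_tsupport_subset_ball hws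
  obtain ⟨L, hL⟩ := hw.lipschitzWith_of_hasCompactSupport hwc (by simp)
  obtain ⟨M, hM⟩ := hw.continuous.bounded_above_of_compact_support hwc
  obtain ⟨L', hL'⟩ := exists_lipschitz_reflectedTest hn hτ hL
  have hwY : ∀ x ∉ unitCell d, x ∉ tsupport w := fun x hx hxs => hx (hball (hws hxs))
  have ew : ∫ x in unitCell d, ‖w x‖ ^ 2 = ∫ x, ‖w x‖ ^ 2 :=
    setIntegral_eq_integral_of_forall_compl_eq_zero fun x hx => by
      simp [image_eq_zero_of_notMem_tsupport (hwY x hx)]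
  have eV : ∫ x in unitCell d, ‖vgrad w x‖ ^ 2 = ∫ x, ‖vgrad w x‖ ^ 2 :=
    setIntegral_eq_integral_of_forall_compl_eq_zero fun x hx => by
      simp [vgrad_eq_zero_of_notMem_tsupport (hwY x hx)]
  have hwn : 0 ≤ ∫ x, ‖w x‖ ^ 2 := integral_nonneg fun x => by positivity
  have hVn : 0 ≤ ∫ x, ‖vgrad w x‖ ^ 2 := integral_nonneg fun x => by positivity
  obtain ⟨i1, i2⟩ := integral_sq_le_of_reflect hn hτ hε hw.continuous hwc
    hL'.continuous.aestronglyMeasurable (Eventually.of_forall norm_reflectedTest_le)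
  obtain ⟨i3, i4⟩ := integral_sq_le_of_reflect (M := 2 * (1 + 2 * ε)) hn hτ hε (continuous_vgrad hw)
    (hasCompactSupport_vgrad hwc) (measurable_vgrad (reflectedTest n τ w)).aestronglyMeasurable (by
      filter_upwards [ae_norm_vgrad_reflectedTest_le hn hτ hε (hw.differentiable (by simp))] with x hx
      rwa [mul_assoc])
  refine ⟨reflectedTest n τ w, ⟨L', hL'⟩, ⟨M + 2 * M, fun x => (norm_reflectedTest_le x).trans ?_⟩,
    ?_, ?_, ?_⟩
  · linarith [hM x, hM (reflect n τ x)]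
  · rw [ew]
    refine (setIntegral_le_integral i1 (Eventually.of_forall fun x => by positivity)).trans (i2.trans ?_)
    refine mul_le_mul_of_nonneg_right ?_ hwn
    have : 0 ≤ 2 + 2 * (2 * (1 + 2 * (ε : ℝ))) ^ 2 * K := by positivity
    linarith
  · rw [eV]
    refine (setIntegral_le_integral i3 (Eventually.of_forall fun x => by positivity)).trans (i4.trans ?_)
    refine mul_le_mul_of_nonneg_right ?_ hVn
    have : 0 ≤ 2 + 2 * 2 ^ 2 * K := by positivity
    linarith
  have hreal : ∀ x, coeff D k x = (((coeff D k x).re : ℝ) : ℂ) := by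
    intro x
    by_cases hx : x ∈ D
    · rw [coeff_of_mem hx]; simp
    · rw [coeff_of_notMem hx]; simp
  have hI := integrable_coeff_inner hD k (memLp_vgrad hL) (memLp_vgrad hL')
  have hre : ∀ x, θ * (coeff D k x * inner ℂ (vgrad w x) (vgrad (reflectedTest n τ w) x)).re =
      (θ * (coeff D k x).re) * (inner ℂ (vgrad (reflectedTest n τ w) x) (vgrad w x)).re := by
    intro x
    rw [hreal x, Complex.re_ofReal_mul, Complex.ofReal_re, ← inner_conj_symm, Complex.conj_re]
    ring
  have hzero : ∀ x ∉ unitCell d,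
      (θ * (coeff D k x).re) * (inner ℂ (vgrad (reflectedTest n τ w) x) (vgrad w x)).re = 0 := by
    intro x hx
    rw [vgrad_eq_zero_of_notMem_tsupport (hwY x hx), inner_zero_right, Complex.zero_re, mul_zero]
  have hint : Integrable fun x =>
      (θ * (coeff D k x).re) * (inner ℂ (vgrad (reflectedTest n τ w) x) (vgrad w x)).re := by
    rw [← integrableOn_iff_integrable_of_support_subset (s := unitCell d)]
    · refine (hI.re.const_mul θ).congr (Eventually.of_forall fun x => ?_)
      exact hre x
    · intro x hx
      by_contra hxY
      exact hx (hzero x hxY)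
  have key := reflectedTest_coercive hn hτ hε hw hwc (c := c) hβ hs
    (by rw [mul_assoc (β * s⁻¹)]; exact min_le_left _ _) (min_le_right _ _)
    (a := fun x => θ * (coeff D k x).re)
    (fun x hx hx' => by
      simp only [hpos x (hws hx) hx', Complex.ofReal_re]
      linear_combination α * hθθ)
    (fun x hx hx' => by
      simp only [hneg x (hws hx) hx', Complex.ofReal_re]
      linear_combination (-β) * hθθ) hint
  rw [eV]
  refine key.trans ?_
  rw [← setIntegral_eq_integral_of_forall_compl_eq_zero hzero]
  simp_rw [← hre]
  have hIre : ∫ x in unitCell d, (coeff D k x * inner ℂ (vgrad w x) (vgrad (reflectedTest n τ w) x)).re =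
      (∫ x in unitCell d, coeff D k x * inner ℂ (vgrad w x) (vgrad (reflectedTest n τ w) x)).re :=
    integral_re hI
  rw [integral_const_mul, hIre]
  refine (le_abs_self _).trans ?_
  rw [abs_mul, hθ, one_mul]
  exact Complex.abs_re_le_norm _

/-- For negative `k ≠ -1` the form is locally coercive everywhere: off the interface because the
coefficient is constant, on the interface by reflection towards the side of larger weight. -/
theorem IsInclusionDomain.locallyCoercive {D : Set (EuclideanSpace ℝ (Fin d))} (hD : IsInclusionDomain D)
    {k : ℝ} (hk : k < 0) (hk1 : k ≠ -1) (p : EuclideanSpace ℝ (Fin d)) : LocallyCoercive D k p := by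
  by_cases hpD : p ∈ D
  · obtain ⟨ρ, hρ, hball⟩ := Metric.isOpen_iff.1 hD.isOpen p hpD
    exact locallyCoercive_of_coeff_eq hρ one_ne_zero fun x hx => coeff_of_mem (hball hx)
  by_cases hpc : p ∈ closure D
  swap
  · obtain ⟨ρ, hρ, hball⟩ := Metric.isOpen_iff.1 isClosed_closure.isOpen_compl p hpc
    exact locallyCoercive_of_coeff_eq hρ (Complex.ofReal_ne_zero.2 hk.ne) fun x hx =>
      coeff_of_notMem fun hxD => hball hx (subset_closure hxD)
  have hpf : p ∈ frontier D := by
    rw [frontier, hD.isOpen.interior_eq]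
    exact ⟨hpc, hpD⟩
  obtain ⟨ρ', hρ', hball'⟩ := Metric.isOpen_iff.1 isOpen_interior p (hD.closure_subset hpc)
  obtain ⟨γ, -, hbd⟩ := hD.holder_boundary
  rcases lt_or_gt_of_ne hk1 with hlt | hgt
  · obtain ⟨ε, hε, hε2, hαβ⟩ := exists_small_distortion d (α := -k) (β := 1) (by linarith)
    obtain ⟨n, τ, ρ, hn, hτ, hρ, hflat⟩ := hbd.exists_flattening hpf hε
    refine locallyCoercive_of_height hD.isOpen.measurableSet (lt_min hρ hρ')
      (((Metric.ball_subset_ball (min_le_right _ _)).trans hball').trans interior_subset)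
      hn hτ hε2 (θ := -1) one_pos hαβ (by simp) (fun x hx hx' => ?_) fun x hx hx' => ?_
    · rw [coeff_of_notMem fun hxD => ?_]
      · simp
      · have := (hflat x (Metric.ball_subset_ball (min_le_left _ _) hx)).1 hxD
        rw [height] at hx'
        linarith
    · rw [coeff_of_mem ((hflat x (Metric.ball_subset_ball (min_le_left _ _) hx)).2 hx')]
      simp
  · obtain ⟨ε, hε, hε2, hαβ⟩ := exists_small_distortion d (α := 1) (β := -k) (by linarith)
    obtain ⟨n, τ, ρ, hn, hτ, hρ, hflat⟩ := hbd.exists_flattening hpf hε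
    have hh : ∀ x, height (-n) (-τ) x = -(inner ℝ n x + τ x) := fun x => by
      rw [height, inner_neg_left, Pi.neg_apply]
      ring
    refine locallyCoercive_of_height hD.isOpen.measurableSet (lt_min hρ hρ')
      (((Metric.ball_subset_ball (min_le_right _ _)).trans hball').trans interior_subset)
      (n := -n) (τ := -τ) (by rwa [norm_neg]) hτ.neg hε2 (θ := 1) (by linarith) hαβ (by simp)
      (fun x hx hx' => ?_) fun x hx hx' => ?_
    · rw [hh] at hx'
      rw [coeff_of_mem ((hflat x (Metric.ball_subset_ball (min_le_left _ _) hx)).2 (by linarith))]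
      simp
    · rw [coeff_of_notMem fun hxD => ?_]
      · simp
      · have := (hflat x (Metric.ball_subset_ball (min_le_left _ _) hx)).1 hxD
        rw [hh] at hx'
        linarith

end NeumannCell

/-! ### The a priori estimate for negative coefficients -/

namespace NeumannCell

variable {d : ℕ}

theorem norm_toLp_sq {F : Type*} [NormedAddCommGroup F] [InnerProductSpace ℂ F]
    {f : EuclideanSpace ℝ (Fin d) → F} (hf : MemLp f 2 (cellMeasure d)) :
    ‖hf.toLp f‖ ^ 2 = ∫ x in unitCell d, ‖f x‖ ^ 2 := by
  have h1 : ((‖hf.toLp f‖ ^ 2 : ℝ) : ℂ) = ((∫ x in unitCell d, ‖f x‖ ^ 2 : ℝ) : ℂ) := by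
    rw [← integral_complex_ofReal]
    refine (Complex.ofReal_pow _ _).trans ((inner_self_eq_norm_sq_to_K (𝕜 := ℂ) (hf.toLp f)).symm.trans ?_)
    rw [MeasureTheory.L2.inner_def]
    refine integral_congr_ae ?_
    filter_upwards [hf.coeFn_toLp] with x hx
    rw [hx, inner_self_eq_norm_sq_to_K]
    exact (Complex.ofReal_pow _ _).symm
  exact_mod_cast h1

theorem norm_Lp_sq {F : Type*} [NormedAddCommGroup F] [InnerProductSpace ℂ F]
    {f : EuclideanSpace ℝ (Fin d) → F} {g : Lp F 2 (cellMeasure d)} (h : g =ᵐ[cellMeasure d] f) :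
    ‖g‖ ^ 2 = ∫ x in unitCell d, ‖f x‖ ^ 2 := by
  have := norm_toLp_sq (Lp.memLp g)
  rw [Lp.toLp_coeFn] at this
  rw [this]
  refine integral_congr_ae ?_
  filter_upwards [h] with x hx
  rw [hx]

theorem integrable_norm_sq {F : Type*} [NormedAddCommGroup F]
    {f : EuclideanSpace ℝ (Fin d) → F} (hf : MemLp f 2 (cellMeasure d)) :
    Integrable (fun x => ‖f x‖ ^ 2) (cellMeasure d) := by
  have := hf.integrable_norm_rpow two_ne_zero ENNReal.ofNat_ne_top
  simpa using this

/-- The Cauchy–Schwarz inequality on the cell, for square integrals with known bounds. -/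
theorem norm_integral_le_of_sq_le {F G : Type*} [NormedAddCommGroup F] [InnerProductSpace ℂ F]
    [NormedAddCommGroup G] [InnerProductSpace ℂ G]
    {f : EuclideanSpace ℝ (Fin d) → F} {g : EuclideanSpace ℝ (Fin d) → G}
    (hf : MemLp f 2 (cellMeasure d)) (hg : MemLp g 2 (cellMeasure d)) {a b M : ℝ} (ha : 0 ≤ a)
    (hb : 0 ≤ b) (hM : 0 ≤ M) (hfa : ∫ x in unitCell d, ‖f x‖ ^ 2 ≤ a ^ 2)
    (hgb : ∫ x in unitCell d, ‖g x‖ ^ 2 ≤ b ^ 2) {q : EuclideanSpace ℝ (Fin d) → ℂ}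
    (hq : ∀ x, ‖q x‖ ≤ M * (‖f x‖ * ‖g x‖)) :
    ‖∫ x in unitCell d, q x‖ ≤ M * (a * b) := by
  have hfg : Integrable (fun x => ‖f x‖ * ‖g x‖) (cellMeasure d) := hf.norm.integrable_mul hg.norm
  have h1 : ‖∫ x in unitCell d, q x‖ ≤ ∫ x in unitCell d, M * (‖f x‖ * ‖g x‖) :=
    norm_integral_le_of_norm_le (hfg.const_mul M) (Eventually.of_forall hq)
  rw [integral_const_mul] at h1
  refine h1.trans (mul_le_mul_of_nonneg_left ?_ hM)
  have h2 := integral_mul_norm_le_Lp_mul_Lq (μ := cellMeasure d) (f := fun x => ‖f x‖)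
    (g := fun x => ‖g x‖) (p := 2) (q := 2)
    ⟨by norm_num, by norm_num, by norm_num⟩ (by simpa using hf.norm) (by simpa using hg.norm)
  simp only [norm_norm] at h2
  refine h2.trans ?_
  have e : ∀ {I r : ℝ}, 0 ≤ r → I ≤ r ^ 2 → I ^ (1 / (2 : ℝ)) ≤ r := by
    intro I r hr hle
    rw [← Real.sqrt_eq_rpow]
    exact Real.sqrt_le_iff.2 ⟨hr, hle⟩
  simp only [Real.rpow_two]
  exact mul_le_mul (e ha hfa) (e hb hgb)
    (Real.rpow_nonneg (integral_nonneg fun x => by positivity) _) ha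

theorem vgrad_mul {f g : EuclideanSpace ℝ (Fin d) → ℂ} {x : EuclideanSpace ℝ (Fin d)}
    (hf : DifferentiableAt ℝ f x) (hg : DifferentiableAt ℝ g x) :
    vgrad (fun y => g y * f y) x = g x • vgrad f x + f x • vgrad g x := by
  ext i
  simp [fderiv_fun_mul hg hf]

theorem exists_lipschitz_mul {f g : EuclideanSpace ℝ (Fin d) → ℂ} {K L : ℝ≥0} {M N : ℝ}
    (hf : LipschitzWith K f) (hg : LipschitzWith L g) (hfM : ∀ x, ‖f x‖ ≤ M) (hgN : ∀ x, ‖g x‖ ≤ N) :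
    ∃ C : ℝ≥0, LipschitzWith C fun x => g x * f x := by
  have hM : 0 ≤ M := (norm_nonneg _).trans (hfM 0)
  have hN : 0 ≤ N := (norm_nonneg _).trans (hgN 0)
  refine ⟨N.toNNReal * K + M.toNNReal * L, LipschitzWith.of_dist_le_mul fun x y => ?_⟩
  have h1 : g x * f x - g y * f y = g x * (f x - f y) + f y * (g x - g y) := by ring
  rw [dist_eq_norm, h1]
  refine (norm_add_le _ _).trans ?_
  rw [norm_mul, norm_mul, ← dist_eq_norm, ← dist_eq_norm]
  push_cast
  rw [Real.coe_toNNReal _ hM, Real.coe_toNNReal _ hN, add_mul, mul_assoc, mul_assoc]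
  exact add_le_add (mul_le_mul (hgN x) (hf.dist_le_mul x y) dist_nonneg hN)
    (mul_le_mul (hfM y) (hg.dist_le_mul x y) dist_nonneg hM)

/-- `B_k(v, u)` in terms of representatives of the gradients. -/
theorem inner_transmissionOp_eq_integral {D : Set (EuclideanSpace ℝ (Fin d))}
    (hD : IsInclusionDomain D) (k : ℂ) {u v : EnergySpace d}
    {U V : EuclideanSpace ℝ (Fin d) → EuclideanSpace ℂ (Fin d)}
    (hU : grad u =ᵐ[cellMeasure d] U) (hV : grad v =ᵐ[cellMeasure d] V) :
    inner ℂ u (transmissionOp D k v) = ∫ x in unitCell d, coeff D k x * inner ℂ (U x) (V x) := by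
  have hUm : MemLp U 2 (cellMeasure d) := (memLp_congr_ae hU).1 (Lp.memLp _)
  have hVm : MemLp V 2 (cellMeasure d) := (memLp_congr_ae hV).1 (Lp.memLp _)
  have hI := integrable_coeff_inner hD.isOpen.measurableSet k hUm hVm
  have hmeas : MeasurableSet (unitCell d \ D) :=
    (measurableSet_unitCell d).diff hD.isOpen.measurableSet
  have hsub : ∀ {A : Set (EuclideanSpace ℝ (Fin d))}, A ⊆ unitCell d →
      gradFormOn A v u = ∫ x in A, inner ℂ (U x) (V x) := by
    intro A hA
    refine integral_congr_ae ?_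
    filter_upwards [ae_mono (Measure.restrict_mono hA le_rfl) hU,
      ae_mono (Measure.restrict_mono hA le_rfl) hV] with x h1 h2
    rw [h1, h2, PiLp.inner_apply]
    rfl
  have hsplit := integral_inter_add_sdiff (μ := volume) (s := unitCell d) hD.isOpen.measurableSet hI
  rw [Set.inter_eq_right.2 hD.subset_unitCell] at hsplit
  rw [← hsplit, ← transmissionForm_eq_inner hD, transmissionForm, hsub Set.sdiff_subset,
    hsub hD.subset_unitCell, add_comm, ← integral_const_mul]
  congr 1
  · refine setIntegral_congr_fun hD.isOpen.measurableSet fun x hx => ?_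
    simp only [coeff_of_mem hx, one_mul]
  · refine setIntegral_congr_fun hmeas fun x hx => ?_
    simp only [coeff_of_notMem hx.2]

/-- The a priori estimate on the part of the cell in `s`, for smooth functions. -/
def AprioriOn (D : Set (EuclideanSpace ℝ (Fin d))) (k : ℂ) (s : Set (EuclideanSpace ℝ (Fin d))) : Prop :=
  ∃ C : ℝ, 0 ≤ C ∧ ∀ (u : EnergySpace d) (f : EuclideanSpace ℝ (Fin d) → ℂ), ContDiff ℝ ∞ f →
    HasCompactSupport f → u.1.fst =ᵐ[cellMeasure d] f →
    ∫ x in unitCell d ∩ s, ‖vgrad f x‖ ^ 2 ≤ C * (‖transmissionOp D k u‖ + ‖u.1.fst‖) * ‖u‖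

set_option maxHeartbeats 1000000 in
/-- Localisation: a cutoff commutes with the form up to terms without derivatives of one factor. -/
theorem LocallyCoercive.aprioriOn {D : Set (EuclideanSpace ℝ (Fin d))} (hD : IsInclusionDomain D)
    {k : ℝ} {p : EuclideanSpace ℝ (Fin d)} (h : LocallyCoercive D k p) :
    ∃ s ∈ 𝓝 p, AprioriOn D k s := by
  obtain ⟨ρ, c, C, hρ, hc, hC, h⟩ := h
  let χ : ContDiffBump p := ⟨ρ / 4, ρ / 2, by positivity, by linarith⟩
  set X : EuclideanSpace ℝ (Fin d) → ℂ := fun x => ((χ x : ℝ) : ℂ) with hX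
  have hXs : ContDiff ℝ ∞ X := Complex.ofRealCLM.contDiff.comp χ.contDiff
  have hXc : HasCompactSupport X := χ.hasCompactSupport.comp_left (g := ((↑) : ℝ → ℂ)) Complex.ofReal_zero
  obtain ⟨LX, hLX⟩ := hXs.lipschitzWith_of_hasCompactSupport hXc (by simp)
  have hX1 : ∀ x, ‖X x‖ ≤ 1 := fun x => by
    rw [hX, Complex.norm_real, Real.norm_of_nonneg χ.nonneg]
    exact χ.le_one
  set M : ℝ := √(d * (LX : ℝ) ^ 2) with hM
  have hM0 : 0 ≤ M := Real.sqrt_nonneg _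
  have hXM : ∀ x, ‖vgrad X x‖ ≤ M := norm_vgrad_le hLX
  have hXball : tsupport X ⊆ Metric.ball p ρ := by
    refine (tsupport_comp_subset (g := ((↑) : ℝ → ℂ)) Complex.ofReal_zero (χ : EuclideanSpace ℝ (Fin d) → ℝ)).trans ?_
    rw [χ.tsupport_eq]
    exact Metric.closedBall_subset_ball (show ρ / 2 < ρ by linarith)
  set A : ℝ := 1 + ‖(k : ℂ)‖ with hA
  have hA0 : 0 ≤ A := by positivity
  set Q : ℝ := 2 + 2 * M ^ 2 with hQ
  have hQ0 : 0 ≤ Q := by positivity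
  refine ⟨Metric.ball p (ρ / 4), Metric.ball_mem_nhds p (by positivity),
    c⁻¹ * (√(2 * Q * (C * Q)) + A * M * √C + A * M * √(C * Q)), by positivity, ?_⟩
  intro u f hf hfc huf
  obtain ⟨Lf, hLf⟩ := hf.lipschitzWith_of_hasCompactSupport hfc (by simp)
  have hfd : Differentiable ℝ f := hf.differentiable (by simp)
  have hXd : Differentiable ℝ X := hXs.differentiable (by simp)
  have hgu : grad u =ᵐ[cellMeasure d] vgrad f := grad_eq_vgrad hLf u huf
  set w : EuclideanSpace ℝ (Fin d) → ℂ := fun x => X x * f x with hw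
  have hws : ContDiff ℝ ∞ w := hXs.mul hf
  have hwt : tsupport w ⊆ Metric.ball p ρ := (tsupport_mul_subset_left).trans hXball
  obtain ⟨Lw, hLw⟩ := hws.lipschitzWith_of_hasCompactSupport
    (hasCompactSupport_of_tsupport_subset_ball hwt) (by simp)
  obtain ⟨v, ⟨Lv, hLv⟩, ⟨Mv, hMv⟩, hv1, hv2, hv3⟩ := h w hws hwt
  obtain ⟨Lz, hLz⟩ := exists_lipschitz_mul hLv hLX hMv hX1
  obtain ⟨z, -, hzg⟩ := exists_energy_of_lipschitz hLz
  have mf := memLp_of_continuous (d := d) hf.continuous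
  have mVf := memLp_vgrad hLf
  have mv := memLp_of_continuous (d := d) hLv.continuous
  have mVv := memLp_vgrad hLv
  have mw := memLp_of_continuous (d := d) hws.continuous
  have mVw := memLp_vgrad hLw
  have mVz := memLp_vgrad hLz
  -- square integrals of the factors
  have If : ∫ x in unitCell d, ‖f x‖ ^ 2 = ‖u.1.fst‖ ^ 2 := (norm_Lp_sq huf).symm
  have IVf : ∫ x in unitCell d, ‖vgrad f x‖ ^ 2 = ‖grad u‖ ^ 2 := (norm_Lp_sq hgu).symm
  have Iw : ∫ x in unitCell d, ‖w x‖ ^ 2 ≤ ‖u.1.fst‖ ^ 2 := by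
    rw [← If]
    refine integral_mono (integrable_norm_sq mw) (integrable_norm_sq mf) fun x => ?_
    refine pow_le_pow_left₀ (norm_nonneg _) ?_ 2
    rw [hw, norm_mul]
    exact mul_le_of_le_one_left (norm_nonneg _) (hX1 x)
  have hprod : ∀ (g : EuclideanSpace ℝ (Fin d) → ℂ) (x : EuclideanSpace ℝ (Fin d)),
      DifferentiableAt ℝ g x → ‖vgrad (fun y => X y * g y) x‖ ^ 2 ≤
        2 * ‖vgrad g x‖ ^ 2 + 2 * M ^ 2 * ‖g x‖ ^ 2 := by
    intro g x hg
    rw [vgrad_mul hg (hXd x)]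
    have h1 : ‖X x • vgrad g x + g x • vgrad X x‖ ≤ ‖vgrad g x‖ + M * ‖g x‖ := by
      refine (norm_add_le _ _).trans ?_
      rw [norm_smul, norm_smul]
      refine add_le_add (mul_le_of_le_one_left (norm_nonneg _) (hX1 x)) ?_
      rw [mul_comm]
      exact mul_le_mul_of_nonneg_right (hXM x) (norm_nonneg _)
    have h2 := pow_le_pow_left₀ (norm_nonneg _) h1 2
    nlinarith [sq_nonneg (‖vgrad g x‖ - M * ‖g x‖)]
  have hfu : ‖u.1.fst‖ ^ 2 ≤ ‖u‖ ^ 2 := by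
    rw [norm_energy_sq]; linarith [sq_nonneg ‖grad u‖]
  have hgrad_u : ‖grad u‖ ^ 2 ≤ ‖u‖ ^ 2 := by
    rw [norm_energy_sq]; linarith [sq_nonneg ‖u.1.fst‖]
  have IVw : ∫ x in unitCell d, ‖vgrad w x‖ ^ 2 ≤ Q * ‖u‖ ^ 2 := by
    have h1 : ∫ x in unitCell d, ‖vgrad w x‖ ^ 2 ≤
        ∫ x in unitCell d, (2 * ‖vgrad f x‖ ^ 2 + 2 * M ^ 2 * ‖f x‖ ^ 2) :=
      integral_mono (integrable_norm_sq mVw) (((integrable_norm_sq mVf).const_mul _).add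
        ((integrable_norm_sq mf).const_mul _)) fun x => hprod f x (hfd x)
    rw [integral_add ((integrable_norm_sq mVf).const_mul _) ((integrable_norm_sq mf).const_mul _),
      integral_const_mul, integral_const_mul, If, IVf] at h1
    have := mul_le_mul_of_nonneg_left hfu (show 0 ≤ 2 * M ^ 2 by positivity)
    rw [hQ]
    linarith
  have Iv : ∫ x in unitCell d, ‖v x‖ ^ 2 ≤ (√C * ‖u.1.fst‖) ^ 2 := by
    rw [mul_pow, Real.sq_sqrt hC]
    exact hv1.trans (mul_le_mul_of_nonneg_left Iw hC)
  have IVv' : ∫ x in unitCell d, ‖vgrad v x‖ ^ 2 ≤ C * Q * ‖u‖ ^ 2 := by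
    rw [mul_assoc]
    exact hv2.trans (mul_le_mul_of_nonneg_left IVw hC)
  have IVv : ∫ x in unitCell d, ‖vgrad v x‖ ^ 2 ≤ (√(C * Q) * ‖u‖) ^ 2 := by
    rwa [mul_pow, Real.sq_sqrt (by positivity)]
  have hvae : ∀ᵐ x ∂(cellMeasure d), DifferentiableAt ℝ v x :=
    ae_restrict_of_ae (hLv.ae_differentiableAt (μ := volume))
  have hz : ‖z‖ ≤ √(2 * Q * (C * Q)) * ‖u‖ := by
    have h1 : ‖grad z‖ ^ 2 ≤ ∫ x in unitCell d, (2 * ‖vgrad v x‖ ^ 2 + 2 * M ^ 2 * ‖v x‖ ^ 2) := by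
      rw [norm_Lp_sq hzg]
      refine integral_mono_ae (integrable_norm_sq mVz) (((integrable_norm_sq mVv).const_mul _).add
        ((integrable_norm_sq mv).const_mul _)) ?_
      filter_upwards [hvae] with x hx
      exact hprod v x hx
    rw [integral_add ((integrable_norm_sq mVv).const_mul _) ((integrable_norm_sq mv).const_mul _),
      integral_const_mul, integral_const_mul] at h1
    have hQ1 : 1 ≤ Q := by rw [hQ]; nlinarith [sq_nonneg M]
    have h2 : ∫ x in unitCell d, ‖v x‖ ^ 2 ≤ C * Q * ‖u‖ ^ 2 := by
      refine hv1.trans ((mul_le_mul_of_nonneg_left (Iw.trans hfu) hC).trans ?_)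
      rw [mul_assoc]
      refine mul_le_mul_of_nonneg_left ?_ hC
      nlinarith [sq_nonneg ‖u‖]
    have h3 := norm_energy_sq_le z
    have h4 := mul_le_mul_of_nonneg_left h2 (show 0 ≤ 2 * M ^ 2 by positivity)
    refine abs_le_of_sq_le_sq' ?_ (by positivity) |>.2
    rw [mul_pow, Real.sq_sqrt (by positivity)]
    have h5 : ‖grad z‖ ^ 2 ≤ Q * (C * Q * ‖u‖ ^ 2) := by
      have e : Q * (C * Q * ‖u‖ ^ 2) = 2 * (C * Q * ‖u‖ ^ 2) + 2 * M ^ 2 * (C * Q * ‖u‖ ^ 2) := by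
        rw [hQ]; ring
      rw [e]
      linarith
    linarith
  -- the commutator identity
  have hid : ∫ x in unitCell d, coeff D k x * inner ℂ (vgrad w x) (vgrad v x) =
      (∫ x in unitCell d, coeff D k x * inner ℂ (vgrad f x) (vgrad (fun y => X y * v y) x)) +
      ((∫ x in unitCell d, coeff D k x * ((starRingEnd ℂ) (f x) * inner ℂ (vgrad X x) (vgrad v x))) -
      ∫ x in unitCell d, coeff D k x * (v x * inner ℂ (vgrad f x) (vgrad X x))) := by
    have hXL := memLp_vgrad hLX
    have i1 := integrable_coeff_inner hD.isOpen.measurableSet k mVf mVz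
    have i2 : Integrable (fun x => coeff D k x *
        ((starRingEnd ℂ) (f x) * inner ℂ (vgrad X x) (vgrad v x))) (cellMeasure d) := by
      obtain ⟨N, hN⟩ := hf.continuous.bounded_above_of_compact_support hfc
      have := (integrable_coeff_inner hD.isOpen.measurableSet k hXL mVv).bdd_mul
        (f := fun x => (starRingEnd ℂ) (f x)) (c := N)
        (continuous_star.comp hf.continuous).aestronglyMeasurable
        (Eventually.of_forall fun x => by rw [RCLike.norm_conj]; exact hN x)
      refine this.congr (Eventually.of_forall fun x => ?_)
      ring
    have i3 : Integrable (fun x => coeff D k x * (v x * inner ℂ (vgrad f x) (vgrad X x)))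
        (cellMeasure d) := by
      have := (integrable_coeff_inner hD.isOpen.measurableSet k mVf hXL).bdd_mul
        (f := v) (c := Mv) hLv.continuous.aestronglyMeasurable (Eventually.of_forall hMv)
      refine this.congr (Eventually.of_forall fun x => ?_)
      ring
    rw [← integral_sub i2 i3]
    have i4 : Integrable (fun x => coeff D k x *
        ((starRingEnd ℂ) (f x) * inner ℂ (vgrad X x) (vgrad v x)) -
        coeff D k x * (v x * inner ℂ (vgrad f x) (vgrad X x))) (cellMeasure d) := i2.sub i3
    rw [← integral_add i1 i4]
    refine integral_congr_ae ?_
    filter_upwards [hvae] with x hx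
    have hconj : (starRingEnd ℂ) (X x) = X x := Complex.conj_ofReal _
    rw [hw, vgrad_mul (hfd x) (hXd x), vgrad_mul hx (hXd x), inner_add_left, inner_add_right,
      inner_smul_left, inner_smul_left, inner_smul_right, inner_smul_right, hconj]
    ring
  have b1 : ‖∫ x in unitCell d, coeff D k x * inner ℂ (vgrad f x) (vgrad (fun y => X y * v y) x)‖ ≤
      ‖transmissionOp D k u‖ * (√(2 * Q * (C * Q)) * ‖u‖) := by
    rw [← inner_transmissionOp_eq_integral hD k hgu hzg, ← ContinuousLinearMap.adjoint_inner_left,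
      adjoint_transmissionOp, Complex.conj_ofReal]
    exact (norm_inner_le_norm _ _).trans (mul_le_mul_of_nonneg_left hz (norm_nonneg _))
  have b2 : ‖∫ x in unitCell d, coeff D k x * ((starRingEnd ℂ) (f x) * inner ℂ (vgrad X x) (vgrad v x))‖ ≤
      A * M * (‖u.1.fst‖ * (√(C * Q) * ‖u‖)) := by
    refine norm_integral_le_of_sq_le mf mVv (norm_nonneg _) (by positivity) (by positivity) If.le IVv
      fun x => ?_
    rw [norm_mul, norm_mul, RCLike.norm_conj, mul_assoc]
    refine mul_le_mul (norm_coeff_le D k x) ?_ (by positivity) hA0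
    have := (norm_inner_le_norm (𝕜 := ℂ) (vgrad X x) (vgrad v x)).trans
      (mul_le_mul_of_nonneg_right (hXM x) (norm_nonneg _))
    calc ‖f x‖ * ‖inner ℂ (vgrad X x) (vgrad v x)‖ ≤ ‖f x‖ * (M * ‖vgrad v x‖) := by gcongr
      _ = _ := by ring
  have b3 : ‖∫ x in unitCell d, coeff D k x * (v x * inner ℂ (vgrad f x) (vgrad X x))‖ ≤
      A * M * (√C * ‖u.1.fst‖ * ‖u‖) := by
    refine norm_integral_le_of_sq_le mv mVf (by positivity) (norm_nonneg _) (by positivity) Iv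
      (IVf.trans_le hgrad_u) fun x => ?_
    rw [norm_mul, norm_mul, mul_assoc]
    refine mul_le_mul (norm_coeff_le D k x) ?_ (by positivity) hA0
    have := (norm_inner_le_norm (𝕜 := ℂ) (vgrad f x) (vgrad X x)).trans
      (mul_le_mul_of_nonneg_left (hXM x) (norm_nonneg _))
    calc ‖v x‖ * ‖inner ℂ (vgrad f x) (vgrad X x)‖ ≤ ‖v x‖ * (‖vgrad f x‖ * M) := by gcongr
      _ = _ := by ring
  rw [hid] at hv3
  have hv4 := hv3.trans ((norm_add_le _ _).trans (add_le_add b1 ((norm_sub_le _ _).trans (add_le_add b2 b3))))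
  have hlocal : ∫ x in unitCell d ∩ Metric.ball p (ρ / 4), ‖vgrad f x‖ ^ 2 ≤
      ∫ x in unitCell d, ‖vgrad w x‖ ^ 2 := by
    have h1 : ∫ x in unitCell d ∩ Metric.ball p (ρ / 4), ‖vgrad f x‖ ^ 2 =
        ∫ x in unitCell d ∩ Metric.ball p (ρ / 4), ‖vgrad w x‖ ^ 2 := by
      refine setIntegral_congr_fun ((measurableSet_unitCell d).inter Metric.isOpen_ball.measurableSet)
        fun x hx => ?_
      have h2 : w =ᶠ[𝓝 x] f := by
        filter_upwards [Metric.isOpen_ball.mem_nhds hx.2] with y hy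
        have : χ y = 1 := χ.one_of_mem_closedBall (Metric.ball_subset_closedBall hy)
        simp [hw, hX, this]
      simp only [vgrad_congr h2]
    rw [h1]
    exact setIntegral_mono_set (integrable_norm_sq mVw) (Eventually.of_forall fun x => by positivity)
      Set.inter_subset_left.eventuallyLE
  refine hlocal.trans ?_
  rw [mul_assoc c⁻¹, mul_assoc c⁻¹, ← div_eq_inv_mul, le_div_iff₀ hc, mul_comm _ c]
  refine hv4.trans ?_
  have n1 := norm_nonneg u
  have n2 := norm_nonneg u.1.fst
  have n3 := norm_nonneg (transmissionOp D k u)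
  have s1 := Real.sqrt_nonneg (2 * Q * (C * Q))
  have s2 : 0 ≤ A * M * √C := by positivity
  have s3 : 0 ≤ A * M * √(C * Q) := by positivity
  have r1 : 0 ≤ √(2 * Q * (C * Q)) * ‖u.1.fst‖ * ‖u‖ :=
    mul_nonneg (mul_nonneg s1 n2) n1
  have r2 : 0 ≤ (A * M * √C) * ‖transmissionOp D k u‖ * ‖u‖ :=
    mul_nonneg (mul_nonneg s2 n3) n1
  have r3 : 0 ≤ (A * M * √(C * Q)) * ‖transmissionOp D k u‖ * ‖u‖ :=
    mul_nonneg (mul_nonneg s3 n3) n1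
  have e : (√(2 * Q * (C * Q)) + A * M * √C + A * M * √(C * Q)) *
      (‖transmissionOp D k u‖ + ‖u.1.fst‖) * ‖u‖ =
      ‖transmissionOp D k u‖ * (√(2 * Q * (C * Q)) * ‖u‖) +
      (A * M * (‖u.1.fst‖ * (√(C * Q) * ‖u‖)) + A * M * (√C * ‖u.1.fst‖ * ‖u‖)) +
      (√(2 * Q * (C * Q)) * ‖u.1.fst‖ * ‖u‖ + (A * M * √C) * ‖transmissionOp D k u‖ * ‖u‖ +
        (A * M * √(C * Q)) * ‖transmissionOp D k u‖ * ‖u‖) := by ring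
  rw [e]
  linarith

theorem aprioriOn_closure_unitCell {D : Set (EuclideanSpace ℝ (Fin d))} (hD : IsInclusionDomain D)
    {k : ℝ} (hk : k < 0) (hk1 : k ≠ -1) : AprioriOn D k (closure (unitCell d)) := by
  refine (isCompact_closure_unitCell d).induction_on (p := AprioriOn D k) ?_ ?_ ?_ ?_
  · refine ⟨0, le_rfl, fun u f _ _ _ => ?_⟩
    simp
  · rintro s t hst ⟨C, hC, h⟩
    refine ⟨C, hC, fun u f hf hfc huf => le_trans ?_ (h u f hf hfc huf)⟩
    obtain ⟨Lf, hLf⟩ := hf.lipschitzWith_of_hasCompactSupport hfc (by simp)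
    refine setIntegral_mono_set ?_ (Eventually.of_forall fun x => by positivity)
      (Set.inter_subset_inter_right _ hst).eventuallyLE
    exact IntegrableOn.mono_set (integrable_norm_sq (memLp_vgrad hLf)) Set.inter_subset_left
  · rintro s t ⟨C, hC, h⟩ ⟨C', hC', h'⟩
    refine ⟨C + C', by positivity, fun u f hf hfc huf => ?_⟩
    obtain ⟨Lf, hLf⟩ := hf.lipschitzWith_of_hasCompactSupport hfc (by simp)
    have hI := integrable_norm_sq (memLp_vgrad hLf)
    have i1 : IntegrableOn (fun x => ‖vgrad f x‖ ^ 2) (unitCell d ∩ s) :=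
      IntegrableOn.mono_set hI Set.inter_subset_left
    have i2 : IntegrableOn (fun x => ‖vgrad f x‖ ^ 2) (unitCell d ∩ t) :=
      IntegrableOn.mono_set hI Set.inter_subset_left
    rw [Set.inter_union_distrib_left]
    have h1 := integral_mono_measure (f := fun x => ‖vgrad f x‖ ^ 2)
      (Measure.restrict_union_le (μ := volume) (unitCell d ∩ s) (unitCell d ∩ t))
      (Eventually.of_forall fun x => by positivity)
      (Integrable.add_measure (μ := volume.restrict (unitCell d ∩ s))
        (ν := volume.restrict (unitCell d ∩ t)) i1 i2)
    rw [integral_add_measure i1 i2] at h1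
    have h2 := h u f hf hfc huf
    have h3 := h' u f hf hfc huf
    rw [add_mul, add_mul]
    linarith
  · intro x _
    obtain ⟨s, hs, h⟩ := (hD.locallyCoercive hk hk1 x).aprioriOn hD
    exact ⟨s, mem_nhdsWithin_of_mem_nhds hs, h⟩

/-- For negative `k ≠ -1` the transmission operator is bounded below up to a compact term. -/
theorem IsInclusionDomain.apriori {D : Set (EuclideanSpace ℝ (Fin d))} (hD : IsInclusionDomain D)
    {k : ℝ} (hk : k < 0) (hk1 : k ≠ -1) :
    ∃ C : ℝ, ∀ u : EnergySpace d, ‖u‖ ≤ C * (‖transmissionOp D k u‖ + ‖energyToL2 d u‖) := by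
  obtain ⟨C, hC, h⟩ := aprioriOn_closure_unitCell hD hk hk1
  refine ⟨2 * C, fun u => ?_⟩
  have hclosed : IsClosed {u : EnergySpace d |
      ‖u‖ ≤ 2 * C * (‖transmissionOp D k u‖ + ‖energyToL2 d u‖)} := by
    refine isClosed_le continuous_norm (continuous_const.mul (Continuous.add ?_ ?_))
    · exact (transmissionOp D k).continuous.norm
    · exact (energyToL2 d).continuous.norm
  refine hclosed.closure_subset (Metric.mem_closure_iff.2 fun ε hε => ?_)
  obtain ⟨v, f, hf, hfc, hvf, huv⟩ := exists_smooth_near u hε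
  refine ⟨v, ?_, by rwa [dist_eq_norm]⟩
  have h1 := h v f hf hfc hvf
  obtain ⟨Lf, hLf⟩ := hf.lipschitzWith_of_hasCompactSupport hfc (by simp)
  rw [Set.inter_eq_left.2 subset_closure, ← norm_Lp_sq (grad_eq_vgrad hLf v hvf)] at h1
  have h2 := norm_energy_sq_le v
  change ‖v‖ ≤ 2 * C * (‖transmissionOp D k v‖ + ‖v.1.fst‖)
  rcases (norm_nonneg v).eq_or_lt with h0 | h0
  · rw [← h0]
    exact mul_nonneg (mul_nonneg zero_le_two hC) (add_nonneg (norm_nonneg _) (norm_nonneg _))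
  · by_contra hcon
    nlinarith

end NeumannCell

/-! ### Resonances and invertibility of the transmission operator -/

namespace NeumannCell

variable {d : ℕ} {D : Set (EuclideanSpace ℝ (Fin d))}

theorem gradFormOn_inclusion (hD : IsInclusionDomain D) (u v : EnergySpace d) :
    gradFormOn D u v = inner ℂ v (dirichletOp D u) :=
  gradFormOn_eq_inner hD.isOpen.measurableSet hD.subset_unitCell u v

theorem gradFormOn_exterior (hD : IsInclusionDomain D) (u v : EnergySpace d) :
    gradFormOn (unitCell d \ D) u v = inner ℂ v (dirichletOp (unitCell d \ D) u) :=
  gradFormOn_eq_inner ((measurableSet_unitCell d).diff hD.isOpen.measurableSet) Set.sdiff_subset u v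

theorem inner_dirichletOp_symm (A : Set (EuclideanSpace ℝ (Fin d))) (u v : EnergySpace d) :
    inner ℂ v (dirichletOp A u) = inner ℂ (dirichletOp A v) u := by
  rw [← ContinuousLinearMap.adjoint_inner_left, adjoint_dirichletOp]

/-- The gradient form splits into the contributions of the exterior and of the inclusions. -/
theorem gradForm_split (hD : IsInclusionDomain D) (u v : EnergySpace d) :
    gradForm u v = gradFormOn (unitCell d \ D) u v + gradFormOn D u v := by
  have hi : Integrable (fun x => ∑ i, grad u x i * (starRingEnd ℂ) (grad v x i)) (cellMeasure d) := by
    refine (MeasureTheory.L2.integrable_inner (𝕜 := ℂ) (grad v) (grad u)).congr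
      (Eventually.of_forall fun x => ?_)
    simp only [PiLp.inner_apply]
    rfl
  have := integral_inter_add_sdiff (μ := volume) (s := unitCell d) hD.isOpen.measurableSet hi
  rw [Set.inter_eq_right.2 hD.subset_unitCell, add_comm] at this
  exact this.symm

theorem IsResonance.abs_le (hD : IsInclusionDomain D) {μ : ℝ} (h : IsResonance D μ) : |μ| ≤ 1 / 2 := by
  obtain ⟨u, hu, hu0, h⟩ := h
  have h1 := h u hu
  rw [gradFormOn_exterior hD, gradFormOn_inclusion hD, inner_dirichletOp_self, inner_dirichletOp_self,
    gradForm_self] at h1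
  have h2 : 1 / 2 * ‖gradOnL (unitCell d \ D) u‖ ^ 2 - 1 / 2 * ‖gradOnL D u‖ ^ 2 =
      μ * ‖grad u‖ ^ 2 := by
    refine Complex.ofReal_injective ?_
    push_cast at h1 ⊢
    exact h1
  have h3 := norm_gradOnL_split hD u
  have h4 : 0 < ‖grad u‖ ^ 2 := pow_pos (grad_ne_zero hu0) 2
  have h5 := sq_nonneg ‖gradOnL (unitCell d \ D) u‖
  have h6 := sq_nonneg ‖gradOnL D u‖
  rw [_root_.abs_le]
  constructor <;> nlinarith

theorem exceptionalSet_subset (hD : IsInclusionDomain D) {k : ℂ} (hk : k ∈ exceptionalSet D) :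
    k.im = 0 ∧ k.re ≤ 0 := by
  obtain ⟨μ, hμ, hne, rfl⟩ := hk
  rw [Complex.ofReal_im, Complex.ofReal_re]
  refine ⟨rfl, ?_⟩
  have h : |μ| ≤ 1 / 2 := by
    rcases hμ with hμ | hμ
    · exact hμ.abs_le hD
    · rw [hμ]; norm_num
  rw [abs_le] at h
  exact div_nonpos_of_nonpos_of_nonneg (by linarith) (by linarith)

/-- Functions in `W₁` have vanishing gradient on `D`. -/
theorem dirichletOp_eq_zero_of_mem_W1 (hD : IsInclusionDomain D) {v : EnergySpace d} (hv : v ∈ W1 D) : dirichletOp D v = 0 := by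
  have hclosed : IsClosed {v : EnergySpace d | dirichletOp D v = 0} :=
    isClosed_eq (dirichletOp D).continuous continuous_const
  refine hclosed.closure_subset_iff.2 ?_ hv
  rintro u ⟨U, hU, hDU, hu⟩
  have h1 := IsWeakGradient.ae_eq_zero u.2.1 hU hu
  have h2 : gradOnL D u = 0 := by
    refine Lp.ext ?_
    have hle : (cellMeasure d).restrict D ≤ cellMeasure d := Measure.restrict_le_self
    filter_upwards [gradOnL_coeFn D u, ae_mono hle h1, ae_restrict_mem hD.isOpen.measurableSet,
      Lp.coeFn_zero (EuclideanSpace ℂ (Fin d)) 2 ((cellMeasure d).restrict D)] with x h4 h5 h6 h7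
    rw [h4, h7]
    exact h5 (hDU (subset_closure h6))
  change ContinuousLinearMap.adjoint (gradOnL D) (gradOnL D u) = 0
  rw [h2, map_zero]

/-- The weak gradient on a subset of the cell, on all of `H¹(Y)`. -/
noncomputable def gradOnH1 (A : Set (EuclideanSpace ℝ (Fin d))) :
    H1 d →L[ℂ] Lp (EuclideanSpace ℂ (Fin d)) 2 ((cellMeasure d).restrict A) :=
  (LpToLpRestrictCLM (EuclideanSpace ℝ (Fin d)) (EuclideanSpace ℂ (Fin d)) ℂ (cellMeasure d) 2 A).comp
    ((WithLp.sndL 2 ℂ (L2 d) (L2Vec d)).comp (H1 d).subtypeL)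

theorem gradOnH1_coeFn (A : Set (EuclideanSpace ℝ (Fin d))) (u : H1 d) :
    gradOnH1 A u =ᵐ[(cellMeasure d).restrict A] u.1.snd :=
  LpToLpRestrictCLM_coeFn ℂ A u.1.snd

theorem gradOnH1_eq_zero {A : Set (EuclideanSpace ℝ (Fin d))} (hA : MeasurableSet A) {w : H1 d}
    {f : EuclideanSpace ℝ (Fin d) → ℂ} {C : ℝ≥0} (hf : LipschitzWith C f)
    (hw : w.1.fst =ᵐ[cellMeasure d] f) (hfA : ∀ x ∈ A, vgrad f x = 0) : gradOnH1 A w = 0 := by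
  obtain ⟨w', h1, h2⟩ := exists_H1_of_lipschitz hf
  obtain rfl : w = w' := eq_of_fst_eq (Lp.ext (hw.trans h1.symm))
  refine Lp.ext ?_
  filter_upwards [gradOnH1_coeFn A w, ae_mono Measure.restrict_le_self h2, ae_restrict_mem hA,
    Lp.coeFn_zero (EuclideanSpace ℂ (Fin d)) 2 ((cellMeasure d).restrict A)] with x h3 h4 h5 h6
  rw [h3, h4, h6, hfA x h5, Pi.zero_apply]

/-- Functions in `W₂` have vanishing gradient outside of `D`. -/
theorem dirichletOp_eq_zero_of_mem_W2 (hD : IsInclusionDomain D) {v : EnergySpace d} (hv : v ∈ W2 D) :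
    dirichletOp (unitCell d \ D) v = 0 := by
  have hmeas : MeasurableSet (unitCell d \ D) :=
    (measurableSet_unitCell d).diff hD.isOpen.measurableSet
  obtain ⟨w, hw, hvw⟩ := hv
  have h1 : gradOnH1 (unitCell d \ D) w = 0 := by
    have hclosed : IsClosed {w : H1 d | gradOnH1 (unitCell d \ D) w = 0} :=
      isClosed_eq (gradOnH1 _).continuous continuous_const
    refine hclosed.closure_subset_iff.2 ?_ hw
    rintro w ⟨φ, h1, h2, h3, h4⟩
    obtain ⟨C, hC⟩ := h1.lipschitzWith_of_hasCompactSupport h2 (by simp)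
    exact gradOnH1_eq_zero hmeas hC h4 fun x hx =>
      vgrad_eq_zero_of_notMem_tsupport fun hxs => hx.2 (h3 hxs)
  set c := ∫ y in D, w.1.fst y with hc
  have hconst : LipschitzWith 0 (fun _ : EuclideanSpace ℝ (Fin d) => c) := LipschitzWith.const c
  obtain ⟨w', h2, -⟩ := exists_H1_of_lipschitz hconst
  have h3 : gradOnH1 (unitCell d \ D) w' = 0 := gradOnH1_eq_zero hmeas hconst h2 fun x _ => by
    ext i
    simp
  have h4 : energyToH1 v = w - w' := by
    refine eq_of_fst_eq (Lp.ext (hvw.trans ?_))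
    filter_upwards [Lp.coeFn_sub w.1.fst w'.1.fst, h2] with x h5 h6
    change _ = (w.1.fst - w'.1.fst) x
    rw [h5, Pi.sub_apply, h6]
  have h5 : gradOnL (unitCell d \ D) v = gradOnH1 (unitCell d \ D) (energyToH1 v) := rfl
  change ContinuousLinearMap.adjoint (gradOnL _) (gradOnL _ v) = 0
  rw [h5, h4, map_sub, h1, h3, sub_zero, map_zero]

/-- The kernel of the transmission operator lies in `W₃`: testing with `W₁` leaves only the exterior
Dirichlet form, testing with `W₂` only that of `D`. -/
theorem mem_W3_of_transmissionOp_eq_zero (hD : IsInclusionDomain D) {k : ℂ} (hk : k ≠ 0)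
    {u : EnergySpace d} (hu : transmissionOp D k u = 0) : u ∈ W3 D := by
  intro v hv
  have h1 : k * inner ℂ v (dirichletOp (unitCell d \ D) u) + inner ℂ v (dirichletOp D u) = 0 := by
    have : inner ℂ v (transmissionOp D k u) = 0 := by rw [hu, inner_zero_right]
    rwa [transmissionOp, add_apply, smul_apply, inner_add_right, inner_smul_right] at this
  rw [gradForm_split hD, gradFormOn_exterior hD, gradFormOn_inclusion hD]
  rcases hv with hv | hv
  · have h2 : inner ℂ v (dirichletOp D u) = 0 := by
      rw [inner_dirichletOp_symm, dirichletOp_eq_zero_of_mem_W1 hD hv, inner_zero_left]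
    rw [h2, add_zero] at h1 ⊢
    exact (mul_eq_zero.1 h1).resolve_left hk
  · have h2 : inner ℂ v (dirichletOp (unitCell d \ D) u) = 0 := by
      rw [inner_dirichletOp_symm, dirichletOp_eq_zero_of_mem_W2 hD hv, inner_zero_left]
    rw [h2, mul_zero, zero_add] at h1
    rw [h2, h1, add_zero]

/-- A negative `k` for which the transmission operator has a kernel is exceptional. -/
theorem mem_exceptionalSet_of_transmissionOp_eq_zero (hD : IsInclusionDomain D) {k : ℝ} (hk : k < 0)
    {u : EnergySpace d} (hu : transmissionOp D k u = 0) (hu0 : u ≠ 0) : (k : ℂ) ∈ exceptionalSet D := by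
  have hk1 : (1 - k) ≠ 0 := by linarith
  have hk1' : (1 - (k : ℂ)) ≠ 0 := by exact_mod_cast hk1
  refine ⟨(1 + k) / (2 * (1 - k)), Or.inl ⟨u, mem_W3_of_transmissionOp_eq_zero hD
    (Complex.ofReal_ne_zero.2 hk.ne) hu, hu0, fun v _ => ?_⟩, ?_, ?_⟩
  · have h1 : k * inner ℂ v (dirichletOp (unitCell d \ D) u) + inner ℂ v (dirichletOp D u) = 0 := by
      have : inner ℂ v (transmissionOp D k u) = 0 := by rw [hu, inner_zero_right]
      rwa [transmissionOp, add_apply, smul_apply, inner_add_right, inner_smul_right] at this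
    rw [gradForm_split hD, gradFormOn_exterior hD, gradFormOn_inclusion hD]
    push_cast
    field_simp
    linear_combination (-2 : ℂ) * h1
  · intro h
    field_simp at h
    linarith
  · congr 1
    have h1 : (1 + k) / (2 * (1 - k)) - 1 / 2 = k / (1 - k) := by field_simp; ring
    have h2 : (1 + k) / (2 * (1 - k)) + 1 / 2 = 1 / (1 - k) := by field_simp; ring
    rw [h1, h2]
    field_simp

theorem neg_one_mem_exceptionalSet : (-1 : ℂ) ∈ exceptionalSet D :=
  ⟨0, Or.inr rfl, by norm_num, by norm_num⟩

/-- The functions of `𝓗` which vanish near the closure of `D`. -/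
def vanishingNear (D : Set (EuclideanSpace ℝ (Fin d))) : Submodule ℂ (EnergySpace d) where
  carrier := {u | ∃ U : Set (EuclideanSpace ℝ (Fin d)), IsOpen U ∧ closure D ⊆ U ∧
    ∀ᵐ x ∂(cellMeasure d), x ∈ U → u.1.fst x = 0}
  zero_mem' := by
    refine ⟨Set.univ, isOpen_univ, Set.subset_univ _, ?_⟩
    filter_upwards [Lp.coeFn_zero ℂ 2 (cellMeasure d)] with x hx _
    exact hx
  add_mem' := by
    rintro u v ⟨U, hU, hDU, hu⟩ ⟨V, hV, hDV, hv⟩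
    refine ⟨U ∩ V, hU.inter hV, Set.subset_inter hDU hDV, ?_⟩
    filter_upwards [Lp.coeFn_add u.1.fst v.1.fst, hu, hv] with x h1 h2 h3 hx
    refine h1.trans ?_
    rw [Pi.add_apply, h2 hx.1, h3 hx.2, add_zero]
  smul_mem' := by
    rintro c u ⟨U, hU, hDU, hu⟩
    refine ⟨U, hU, hDU, ?_⟩
    filter_upwards [Lp.coeFn_smul c u.1.fst, hu] with x h1 h2 hx
    refine h1.trans ?_
    rw [Pi.smul_apply, h2 hx, smul_zero]

/-- Functions in `W₁` vanish on `D`. -/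
theorem ae_eq_zero_of_mem_W1 {v : EnergySpace d} (hv : v ∈ W1 D) (hD : IsInclusionDomain D) :
    ∀ᵐ x ∂(cellMeasure d).restrict D, v.1.fst x = 0 := by
  set R : EnergySpace d →L[ℂ] Lp ℂ 2 ((cellMeasure d).restrict D) :=
    (LpToLpRestrictCLM (EuclideanSpace ℝ (Fin d)) ℂ ℂ (cellMeasure d) 2 D).comp (energyToL2 d) with hR
  have hRc : ∀ u : EnergySpace d, R u =ᵐ[(cellMeasure d).restrict D] u.1.fst := fun u =>
    LpToLpRestrictCLM_coeFn ℂ D u.1.fst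
  have hclosed : IsClosed {u : EnergySpace d | R u = 0} := isClosed_eq R.continuous continuous_const
  have h0 : R v = 0 := by
    refine hclosed.closure_subset_iff.2 ?_ hv
    rintro u ⟨U, hU, hDU, hu⟩
    refine Lp.ext ?_
    filter_upwards [hRc u, ae_mono Measure.restrict_le_self hu, ae_restrict_mem hD.isOpen.measurableSet,
      Lp.coeFn_zero ℂ 2 ((cellMeasure d).restrict D)] with x h1 h2 h3 h4
    rw [h1, h2 (hDU (subset_closure h3)), h4, Pi.zero_apply]
  filter_upwards [hRc v, Lp.coeFn_zero ℂ 2 ((cellMeasure d).restrict D)] with x h1 h2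
  rw [← h1, h0, h2, Pi.zero_apply]

theorem antilipschitz_gradL (d : ℕ) : AntilipschitzWith 2 (gradL d) := by
  refine AddMonoidHomClass.antilipschitz_of_bound _ fun u => ?_
  rw [gradL_apply]
  have h := norm_energy_sq_le u
  refine abs_le_of_sq_le_sq' ?_ (by positivity) |>.2
  rw [mul_pow]
  push_cast
  nlinarith [sq_nonneg ‖grad u‖]

/-- The orthogonal projection onto `W₁` with respect to the gradient inner product. -/
theorem exists_gradForm_projection (u : EnergySpace d) :
    ∃ p ∈ W1 D, ∀ v ∈ W1 D, gradForm (u - p) v = 0 := by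
  set V : Submodule ℂ (L2Vec d) :=
    (vanishingNear D).topologicalClosure.map (gradL d : EnergySpace d →ₗ[ℂ] L2Vec d) with hV
  have hVc : IsClosed (V : Set (L2Vec d)) := by
    rw [hV, Submodule.map_coe]
    exact ((antilipschitz_gradL d).isClosedEmbedding (gradL d).uniformContinuous).isClosedMap _
      (Submodule.isClosed_topologicalClosure _)
  have hcomp : CompleteSpace V := hVc.completeSpace_coe
  obtain ⟨p, hp, hpe⟩ := V.starProjection_apply_mem (grad u)
  refine ⟨p, hp, fun v hv => ?_⟩
  have h1 := V.sub_starProjection_mem_orthogonal (grad u) (grad v) ⟨v, hv, rfl⟩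
  have h2 : grad (u - p) = grad u - V.starProjection (grad u) := by
    rw [← hpe]
    exact map_sub (gradL d) u p
  rw [← h2, MeasureTheory.L2.inner_def] at h1
  rw [← h1]
  refine integral_congr_ae (Eventually.of_forall fun x => ?_)
  simp only [PiLp.inner_apply]
  rfl

theorem interior_unitCell_not_subset (hd : 0 < d) (hD : IsInclusionDomain D) :
    ¬ interior (unitCell d) ⊆ closure D := by
  intro h
  have heq : interior (unitCell d) = closure D := h.antisymm hD.closure_subset
  have hclopen : IsClopen (interior (unitCell d)) := ⟨heq ▸ isClosed_closure, isOpen_interior⟩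
  rcases isClopen_iff.1 hclopen with h1 | h1
  · rw [heq] at h1
    exact hD.nonempty.closure.ne_empty h1
  · have h2 : (0 : EuclideanSpace ℝ (Fin d)) ∈ interior (unitCell d) := by rw [h1]; trivial
    exact lt_irrefl _ (interior_subset h2 ⟨0, hd⟩).1

/-- The number `1/2` is always a resonance. The distance to `D`, normalised to mean zero, is a nonzero
constant on `D`; minus its projection to `W₁` it is a resonance function. -/
theorem isResonance_half (hd : 0 < d) (hD : IsInclusionDomain D) : IsResonance D (1 / 2) := by
  set f : EuclideanSpace ℝ (Fin d) → ℂ := fun x => ((Metric.infDist x D : ℝ) : ℂ) with hf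
  have hfl : LipschitzWith 1 f := by
    refine LipschitzWith.of_dist_le_mul fun x y => ?_
    rw [hf, dist_eq_norm, ← Complex.ofReal_sub, Complex.norm_real, ← dist_eq_norm]
    exact (Metric.lipschitz_infDist_pt D).dist_le_mul x y
  obtain ⟨u₀, h1, h2⟩ := exists_energy_of_lipschitz hfl
  set m := ∫ y in unitCell d, f y with hm
  have hfD : ∀ x ∈ D, f x = 0 := fun x hx => by
    rw [hf]
    simp only [Metric.infDist_zero_of_mem hx, Complex.ofReal_zero]
  have hm0 : m ≠ 0 := by
    intro h0
    have hr : ∫ y in unitCell d, Metric.infDist y D = 0 := by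
      rw [hm, integral_complex_ofReal] at h0
      exact_mod_cast h0
    have hcont : Continuous fun y => Metric.infDist y D := Metric.continuous_infDist_pt D
    have hint : Integrable (fun y => Metric.infDist y D) (cellMeasure d) :=
      (memLp_of_continuous hcont).integrable one_le_two
    have hae := (integral_eq_zero_iff_of_nonneg (fun y => Metric.infDist_nonneg) hint).1 hr
    have hae2 : (fun y => Metric.infDist y D) =ᵐ[volume.restrict (interior (unitCell d))] fun _ => 0 :=
      ae_mono (Measure.restrict_mono interior_subset le_rfl) hae
    have heq := Measure.eqOn_open_of_ae_eq hae2 isOpen_interior hcont.continuousOn continuousOn_const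
    refine interior_unitCell_not_subset hd hD fun x hx => ?_
    rw [Metric.mem_closure_iff_infDist_zero hD.nonempty]
    exact heq hx
  have hDu₀ : dirichletOp D u₀ = 0 := by
    have h3 : gradOnL D u₀ = 0 := by
      refine Lp.ext ?_
      filter_upwards [gradOnL_coeFn D u₀, ae_mono Measure.restrict_le_self h2,
        ae_restrict_mem hD.isOpen.measurableSet,
        Lp.coeFn_zero (EuclideanSpace ℂ (Fin d)) 2 ((cellMeasure d).restrict D)] with x h4 h5 h6 h7
      have h8 : f =ᶠ[𝓝 x] fun _ => 0 := by
        filter_upwards [hD.isOpen.mem_nhds h6] with y hy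
        exact hfD y hy
      rw [h4, h5, h7, vgrad_congr h8]
      ext i
      simp
    change ContinuousLinearMap.adjoint (gradOnL D) (gradOnL D u₀) = 0
    rw [h3, map_zero]
  obtain ⟨p, hp, hproj⟩ := exists_gradForm_projection (D := D) u₀
  have hne : u₀ - p ≠ 0 := by
    intro h0
    have h3 : u₀ ∈ W1 D := by rwa [sub_eq_zero.1 h0]
    have h4 : ∀ᵐ x ∂(cellMeasure d).restrict D, False := by
      filter_upwards [ae_eq_zero_of_mem_W1 h3 hD, ae_mono Measure.restrict_le_self h1,
        ae_restrict_mem hD.isOpen.measurableSet] with x h5 h6 h7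
      rw [h5, hfD x h7, zero_sub, eq_comm, neg_eq_zero] at h6
      exact hm0 h6
    rw [Filter.eventually_false_iff_eq_bot, ae_eq_bot,
      cellMeasure_restrict hD.isOpen.measurableSet hD.subset_unitCell, Measure.restrict_eq_zero] at h4
    exact (hD.isOpen.measure_pos volume hD.nonempty).ne' h4
  have hDu : dirichletOp D (u₀ - p) = 0 := by
    rw [map_sub, hDu₀, dirichletOp_eq_zero_of_mem_W1 hD hp, sub_zero]
  have hDz : ∀ v, gradFormOn D (u₀ - p) v = 0 := fun v => by
    rw [gradFormOn_inclusion hD, hDu, inner_zero_right]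
  refine ⟨u₀ - p, ?_, hne, fun v _ => ?_⟩
  · rintro v (hv | hv)
    · exact hproj v hv
    · rw [gradForm_split hD, hDz, add_zero, gradFormOn_exterior hD, inner_dirichletOp_symm,
        dirichletOp_eq_zero_of_mem_W2 hD hv, inner_zero_left]
  · rw [gradForm_split hD, hDz]
    push_cast
    ring

theorem zero_mem_exceptionalSet (hd : 0 < d) (hD : IsInclusionDomain D) :
    (0 : ℂ) ∈ exceptionalSet D :=
  ⟨1 / 2, Or.inl (isResonance_half hd hD), by norm_num, by norm_num⟩

/-- Off the closed negative half axis, the form is coercive after multiplication by a suitable constant, so the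
transmission operator is bounded below. -/
theorem bounded_below_of_mem_slitPlane (hD : IsInclusionDomain D) {k : ℂ} (hk : k ∈ Complex.slitPlane) :
    ∃ c > 0, ∀ u : EnergySpace d, c * ‖u‖ ≤ ‖transmissionOp D k u‖ := by
  obtain ⟨θ, hθ, hθk⟩ : ∃ θ : ℂ, 0 < θ.re ∧ 0 < (θ * k).re := by
    rcases hk with hk | hk
    · exact ⟨1, by simp, by simpa using hk⟩
    · have hb : 0 < k.im ^ 2 := by positivity
      refine ⟨⟨k.im ^ 2 / (2 * (|k.re| + 1)), -k.im⟩, by positivity, ?_⟩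
      rw [Complex.mul_re]
      have h1 : k.im ^ 2 / (2 * (|k.re| + 1)) * |k.re| ≤ k.im ^ 2 / 2 := by
        rw [div_mul_eq_mul_div, div_le_div_iff₀ (by positivity) (by positivity)]
        nlinarith
      have h2 : k.im ^ 2 / (2 * (|k.re| + 1)) * -|k.re| ≤ k.im ^ 2 / (2 * (|k.re| + 1)) * k.re :=
        mul_le_mul_of_nonneg_left (neg_abs_le _) (by positivity)
      simp only
      nlinarith
  set c := min θ.re (θ * k).re with hc
  have hc0 : 0 < c := lt_min hθ hθk
  have hθ0 : 0 < ‖θ‖ := norm_pos_iff.2 fun h => by simp [h] at hθ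
  have h := bounded_below_of_re_inner (S := transmissionOp D k) (c := c / 2) θ fun u => by
    rw [transmissionOp, add_apply, smul_apply, inner_add_right, inner_smul_right,
      inner_dirichletOp_self, inner_dirichletOp_self, mul_add, ← mul_assoc, Complex.add_re,
      Complex.re_mul_ofReal, Complex.re_mul_ofReal]
    have h1 := norm_gradOnL_split hD u
    have h2 := norm_energy_sq_le u
    have h3 := mul_le_mul_of_nonneg_right (min_le_left θ.re (θ * k).re) (sq_nonneg ‖gradOnL D u‖)
    have h4 := mul_le_mul_of_nonneg_right (min_le_right θ.re (θ * k).re)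
      (sq_nonneg ‖gradOnL (unitCell d \ D) u‖)
    have h5 := mul_le_mul_of_nonneg_left h2 (show 0 ≤ c / 2 by positivity)
    rw [← h1] at h5
    rw [← hc] at h3 h4
    linarith
  refine ⟨c / 2 / ‖θ‖, by positivity, fun u => ?_⟩
  rw [div_mul_eq_mul_div, div_le_iff₀ hθ0, mul_comm _ ‖θ‖]
  exact h u

/-- The transmission operator is invertible for every `k` outside the exceptional set. -/
theorem isInvertible_transmissionOp (hd : 0 < d) (hD : IsInclusionDomain D) {k : ℂ}
    (hk : k ∉ exceptionalSet D) : (transmissionOp D k).IsInvertible := by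
  by_cases hs : k ∈ Complex.slitPlane
  · obtain ⟨c, hc, h⟩ := bounded_below_of_mem_slitPlane hD hs
    have hs' : (starRingEnd ℂ) k ∈ Complex.slitPlane := by
      simpa [Complex.mem_slitPlane_iff] using hs
    obtain ⟨c', hc', h'⟩ := bounded_below_of_mem_slitPlane hD hs'
    refine isInvertible_of_bounded_below hc h fun u hu => ?_
    rw [adjoint_transmissionOp] at hu
    have := h' u
    rw [hu, norm_zero] at this
    exact norm_eq_zero.1 (le_antisymm (nonpos_of_mul_nonpos_right this hc') (norm_nonneg u))
  rw [Complex.mem_slitPlane_iff, not_or, not_lt, not_not] at hs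
  obtain ⟨r, rfl⟩ : ∃ r : ℝ, k = r := ⟨k.re, Complex.ext rfl (by simp [hs.2])⟩
  rw [Complex.ofReal_re] at hs
  have hr0 : r ≠ 0 := by
    rintro rfl
    exact hk (by simpa using zero_mem_exceptionalSet hd hD)
  have hr1 : r ≠ -1 := by
    rintro rfl
    exact hk (by simpa using neg_one_mem_exceptionalSet)
  have hr : r < 0 := lt_of_le_of_ne hs.1 hr0
  have hinj : ∀ u, transmissionOp D (r : ℂ) u = 0 → u = 0 := fun u hu => by
    by_contra hu0
    exact hk (mem_exceptionalSet_of_transmissionOp_eq_zero hD hr hu hu0)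
  obtain ⟨C, hC⟩ := hD.apriori hr hr1
  obtain ⟨c, hc, h⟩ := bounded_below_of_apriori (isCompactOperator_energyToL2 d) hC hinj
  refine isInvertible_of_bounded_below hc h fun u hu => ?_
  rw [adjoint_transmissionOp, Complex.conj_ofReal] at hu
  exact hinj u hu

end NeumannCell

/-! ### The spectrum of the solution operator -/

namespace NeumannCell

open Module.End

variable {d : ℕ} {D : Set (EuclideanSpace ℝ (Fin d))} {k : ℂ}

theorem eq_zero_of_cellInner_energyIncl {f : L20 d}
    (h : ∀ v : EnergySpace d, cellInner f (energyIncl d v) = 0) : f = 0 := by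
  refine Subtype.ext (eq_zero_of_inner_cosH1 f.1 fun m => ?_)
  have hzero : ∀ m : Fin d → ℕ, inner ℂ (cosH1 fun i => (m i : ℤ)).1.fst f.1 = 0 := by
    intro m
    by_cases hm : m = 0
    · subst hm
      rw [show (fun i : Fin d => (((0 : Fin d → ℕ) i : ℕ) : ℤ)) = 0 from rfl, inner_cosH1_zero]
      exact f.2
    · have h1 := h (cosEnergy ⟨m, hm⟩)
      rwa [cellInner_eq_inner] at h1
  have := hzero fun i => (m i).natAbs
  rw [inner_cosH1_fst, cosProd_natAbs] at this
  rw [inner_cosH1_fst, this]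

/-- The weak solution of the transmission problem with right-hand side `f`. -/
noncomputable def weakSolution (D : Set (EuclideanSpace ℝ (Fin d))) (k : ℂ) : L20 d →L[ℂ] EnergySpace d :=
  (formOperator D k).inverse.comp (invNeumannLaplacian d)

theorem solutionOperator_apply (f : L20 d) :
    solutionOperator D k f = energyIncl d (weakSolution D k f) := rfl

theorem weakSolution_eq_iff (hD : IsInclusionDomain D) (hT : (formOperator D k).IsInvertible)
    (f : L20 d) (u : EnergySpace d) :
    weakSolution D k f = u ↔ ∀ v, transmissionForm D k u v = cellInner f (energyIncl d v) := by
  rw [weakSolution, ContinuousLinearMap.comp_apply, hT.inverse_apply_eq]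
  constructor
  · intro h v
    rw [← gradForm_formOperator hD, ← h, gradForm_invNeumannLaplacian]
  · intro h
    refine gradForm_right_cancel fun v => ?_
    rw [gradForm_invNeumannLaplacian, gradForm_formOperator hD, h]

theorem transmissionForm_weakSolution (hD : IsInclusionDomain D) (hT : (formOperator D k).IsInvertible)
    (f : L20 d) (v : EnergySpace d) :
    transmissionForm D k (weakSolution D k f) v = cellInner f (energyIncl d v) :=
  (weakSolution_eq_iff hD hT f _).1 rfl v

theorem isCompactOperator_solutionOperator (D : Set (EuclideanSpace ℝ (Fin d))) (k : ℂ) :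
    IsCompactOperator (solutionOperator D k) :=
  (isCompactOperator_energyIncl d).comp_clm ((formOperator D k).inverse.comp (invNeumannLaplacian d))

theorem differentiableAt_smul_add {F : Type*} [NormedAddCommGroup F] [NormedSpace ℂ F] (S T : F)
    (k : ℂ) : DifferentiableAt ℂ (fun κ : ℂ => κ • S + T) k :=
  (differentiableAt_fun_id.smul_const S).add_const T

theorem differentiableAt_solutionOperator (hD : IsInclusionDomain D)
    (hT : (formOperator D k).IsInvertible) :
    DifferentiableAt ℂ (fun κ : ℂ => solutionOperator D κ) k := by
  have h1 : DifferentiableAt ℂ (fun κ : ℂ => formOperator D κ) k := by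
    have : (fun κ : ℂ => formOperator D κ) = fun κ =>
        ((energyEquiv d).symm : EnergySpace d →L[ℂ] EnergySpace d).comp
          (κ • dirichletOp (unitCell d \ D) + dirichletOp D) := funext fun κ => formOperator_eq hD κ
    rw [this]
    exact (differentiableAt_const _).clm_comp
      (differentiableAt_smul_add (F := EnergySpace d →L[ℂ] EnergySpace d) _ _ k)
  have h2 : DifferentiableAt ℂ (fun κ : ℂ => (formOperator D κ).inverse) k :=
    ((hT.contDiffAt_map_inverse (n := 1)).differentiableAt one_ne_zero).comp k h1
  exact (differentiableAt_const _).clm_comp (h2.clm_comp (differentiableAt_const _))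

theorem mem_neumannEigenspace_iff (hD : IsInclusionDomain D) (hT : (formOperator D k).IsInvertible)
    {ν : ℂ} {u : EnergySpace d} :
    u ∈ neumannEigenspace D hD k ν ↔ u = ν • weakSolution D k (energyIncl d u) := by
  rw [eq_comm, ← map_smul, weakSolution_eq_iff hD hT]
  simp only [cellInner_smul_left]
  rfl

theorem map_neumannEigenspace (hD : IsInclusionDomain D) (hT : (formOperator D k).IsInvertible)
    {ν : ℂ} (hν : ν ≠ 0) :
    (neumannEigenspace D hD k ν).map (energyIncl d : EnergySpace d →ₗ[ℂ] L20 d) =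
      eigenspace (solutionOperator D k : L20 d →ₗ[ℂ] L20 d) ν⁻¹ := by
  ext f
  rw [Submodule.mem_map, mem_eigenspace_iff]
  constructor
  · rintro ⟨u, hu, rfl⟩
    rw [mem_neumannEigenspace_iff hD hT] at hu
    change energyIncl d (weakSolution D k (energyIncl d u)) = ν⁻¹ • energyIncl d u
    conv_rhs => rw [hu]
    rw [map_smul, smul_smul, inv_mul_cancel₀ hν, one_smul]
  · intro hf
    have hf' : energyIncl d (weakSolution D k f) = ν⁻¹ • f := hf
    have h1 : energyIncl d (ν • weakSolution D k f) = f := by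
      rw [map_smul, hf', smul_smul, mul_inv_cancel₀ hν, one_smul]
    refine ⟨ν • weakSolution D k f, ?_, h1⟩
    rw [mem_neumannEigenspace_iff hD hT, h1]

theorem neumannEigenspace_zero (hD : IsInclusionDomain D) (hT : (formOperator D k).IsInvertible) :
    neumannEigenspace D hD k 0 = ⊥ := by
  rw [eq_bot_iff]
  intro u hu
  rw [mem_neumannEigenspace_iff hD hT, zero_smul] at hu
  exact hu

theorem finiteDimensional_neumannEigenspace (hD : IsInclusionDomain D)
    (hT : (formOperator D k).IsInvertible) (ν : ℂ) :
    FiniteDimensional ℂ (neumannEigenspace D hD k ν) := by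
  by_cases hν : ν = 0
  · rw [hν, neumannEigenspace_zero hD hT]
    infer_instance
  have h1 := finiteDimensional_maxGenEigenspace (isCompactOperator_solutionOperator D k) (inv_ne_zero hν)
  have h2 : FiniteDimensional ℂ
      (eigenspace (solutionOperator D k : L20 d →ₗ[ℂ] L20 d) ν⁻¹) :=
    Submodule.finiteDimensional_of_le eigenspace_le_maxGenEigenspace
  rw [← map_neumannEigenspace hD hT hν] at h2
  exact LinearEquiv.finiteDimensional (Submodule.equivMapOfInjective
    (energyIncl d : EnergySpace d →ₗ[ℂ] L20 d) (energyIncl_injective d) _).symm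

theorem neumannEigenspace_ne_bot_iff (hD : IsInclusionDomain D) (hT : (formOperator D k).IsInvertible)
    {ν : ℂ} (hν : ν ≠ 0) : neumannEigenspace D hD k ν ≠ ⊥ ↔
      HasEigenvalue (solutionOperator D k : L20 d →ₗ[ℂ] L20 d) ν⁻¹ := by
  rw [hasEigenvalue_iff, ← map_neumannEigenspace hD hT hν]
  refine not_congr ⟨fun h => by rw [h, Submodule.map_bot], fun h => ?_⟩
  refine Submodule.map_injective_of_injective
    (f := (energyIncl d : EnergySpace d →ₗ[ℂ] L20 d)) (energyIncl_injective d) ?_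
  rw [h, Submodule.map_bot]

theorem zero_mem_spectrum_of_compact {H : Type*} [NormedAddCommGroup H] [NormedSpace ℂ H]
    {K : H →L[ℂ] H} (hK : IsCompactOperator K) (hinf : ¬ FiniteDimensional ℂ H) :
    (0 : ℂ) ∈ spectrum ℂ K := by
  rw [spectrum.zero_mem_iff]
  rintro ⟨e, he⟩
  refine hinf (FiniteDimensional.of_isCompactOperator_id ?_)
  have h1 : IsCompactOperator ((e⁻¹ : (H →L[ℂ] H)ˣ) * K : H →L[ℂ] H) := hK.clm_comp _
  rw [← he, Units.inv_mul] at h1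
  exact h1

theorem eq_zero_of_solutionOperator_eq_zero (hD : IsInclusionDomain D)
    (hT : (formOperator D k).IsInvertible) {f : L20 d} (hf : solutionOperator D k f = 0) : f = 0 := by
  have h1 : weakSolution D k f = 0 :=
    energyIncl_injective d (by rw [map_zero, ← solutionOperator_apply, hf])
  refine eq_zero_of_cellInner_energyIncl fun v => ?_
  rw [← transmissionForm_weakSolution hD hT, h1, transmissionForm_eq_inner hD, map_zero,
    inner_zero_right]

/-- `(g, B(k) f) = B_k(u_g, u_f)` with the weak solutions `u_f` and `u_g`. -/
theorem inner_solutionOperator (hD : IsInclusionDomain D) (hT : (formOperator D k).IsInvertible)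
    (f g : L20 d) : inner ℂ (solutionOperator D k f) g =
      inner ℂ (weakSolution D k f) (transmissionOp D k (weakSolution D k g)) := by
  rw [← transmissionForm_eq_inner hD, transmissionForm_weakSolution hD hT, cellInner_eq_inner,
    solutionOperator_apply]

theorem isSymmetric_solutionOperator (hD : IsInclusionDomain D) {k : ℝ}
    (hT : (formOperator D k).IsInvertible) :
    (solutionOperator D k : L20 d →ₗ[ℂ] L20 d).IsSymmetric := by
  intro f g
  change inner ℂ (solutionOperator D k f) g = inner ℂ f (solutionOperator D k g)
  rw [← inner_conj_symm f, inner_solutionOperator hD hT, inner_solutionOperator hD hT]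
  refine Eq.trans ?_ (inner_conj_symm (transmissionOp D k (weakSolution D k f))
    (weakSolution D k g)).symm
  rw [← ContinuousLinearMap.adjoint_inner_left, adjoint_transmissionOp, Complex.conj_ofReal]

theorem pos_of_hasEigenvalue (hD : IsInclusionDomain D) {k : ℝ} (hk : 0 < k)
    (hT : (formOperator D k).IsInvertible) {g : ℂ}
    (hg : HasEigenvalue (solutionOperator D k : L20 d →ₗ[ℂ] L20 d) g) : g.im = 0 ∧ 0 < g.re := by
  obtain ⟨f, hf, hf0⟩ := hg.exists_hasEigenvector
  rw [mem_eigenspace_iff] at hf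
  have hf' : solutionOperator D k f = g • f := hf
  set w := weakSolution D k f with hw
  have hw0 : w ≠ 0 := by
    intro h
    refine hf0 (eq_zero_of_solutionOperator_eq_zero hD hT (f := f) ?_)
    rw [solutionOperator_apply, ← hw, h, map_zero]
  have h1 := inner_solutionOperator hD hT f f
  rw [hf', (inner_smul_left f f g : inner ℂ (g • f) f = _), (inner_self_eq_norm_sq_to_K f : inner ℂ f f = _), ← hw, transmissionOp, add_apply, smul_apply,
    inner_add_right, inner_smul_right, inner_dirichletOp_self, inner_dirichletOp_self] at h1
  have h2 : (starRingEnd ℂ) g * ((‖f‖ ^ 2 : ℝ) : ℂ) =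
      ((k * ‖gradOnL (unitCell d \ D) w‖ ^ 2 + ‖gradOnL D w‖ ^ 2 : ℝ) : ℂ) := by
    push_cast at h1 ⊢
    exact h1
  have hre := congrArg Complex.re h2
  have him := congrArg Complex.im h2
  rw [Complex.re_mul_ofReal, Complex.conj_re, Complex.ofReal_re] at hre
  rw [Complex.im_mul_ofReal, Complex.conj_im, Complex.ofReal_im] at him
  have hfn : 0 < ‖f‖ ^ 2 := pow_pos (norm_pos_iff.2 hf0) 2
  refine ⟨neg_eq_zero.1 ((mul_eq_zero.1 him).resolve_right hfn.ne'), ?_⟩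
  have h3 := norm_gradOnL_split hD w
  have h4 : 0 < ‖grad w‖ ^ 2 := pow_pos (grad_ne_zero hw0) 2
  have h5 : 0 < k * ‖gradOnL (unitCell d \ D) w‖ ^ 2 + ‖gradOnL D w‖ ^ 2 := by
    rcases (sq_nonneg ‖gradOnL D w‖).eq_or_lt with h6 | h6
    · rw [← h6, add_zero] at h3 ⊢
      rw [h3]
      exact mul_pos hk h4
    · exact add_pos_of_nonneg_of_pos (mul_nonneg hk.le (sq_nonneg _)) h6
  rw [← hre] at h5
  exact (mul_pos_iff_of_pos_right hfn).1 h5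

end NeumannCell

theorem mainTheorem11 (d : ℕ) (hd : d = 2 ∨ d = 3) (D : Set (EuclideanSpace ℝ (Fin d)))
    (hD : NeumannCell.IsInclusionDomain D) :
    -- `Z` consists of non-positive real numbers
    (∀ k ∈ NeumannCell.exceptionalSet D, k.im = 0 ∧ k.re ≤ 0) ∧
    -- `(-Δ_N)⁻¹` is well defined
    (∀ A : NeumannCell.L20 d →L[ℂ] NeumannCell.EnergySpace d,
      NeumannCell.IsNeumannSolution A ↔ A = NeumannCell.invNeumannLaplacian d) ∧
    -- `T_k` is well defined for every complex `k`
    (∀ (k : ℂ) (T : NeumannCell.EnergySpace d →L[ℂ] NeumannCell.EnergySpace d),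
      NeumannCell.IsFormOperator D k T ↔ T = NeumannCell.formOperator D k) ∧
    ∀ k : ℂ, k ∉ NeumannCell.exceptionalSet D →
      (NeumannCell.formOperator D k).IsInvertible ∧
      IsCompactOperator (NeumannCell.solutionOperator D k) ∧
      DifferentiableAt ℂ (fun κ : ℂ => NeumannCell.solutionOperator D κ) k ∧
      -- the eigenfunctions of the Neumann problem and of `B(k)` agree
      (∀ ν : ℂ, ν ≠ 0 →
        ((NeumannCell.neumannEigenspace D hD k ν).map
            (NeumannCell.energyIncl d : NeumannCell.EnergySpace d →ₗ[ℂ] NeumannCell.L20 d) =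
          Module.End.eigenspace
            (NeumannCell.solutionOperator D k : NeumannCell.L20 d →ₗ[ℂ] NeumannCell.L20 d) ν⁻¹)) ∧
      (∀ ν : ℂ, FiniteDimensional ℂ (NeumannCell.neumannEigenspace D hD k ν)) ∧
      -- the eigenvalues `γ_j(k)`, listed with algebraic multiplicity by decreasing modulus, followed
      -- by zeros if there are only finitely many of them
      ∃ γ : ℕ → ℂ,
        Antitone (fun j => ‖γ j‖) ∧ Tendsto γ atTop (𝓝 0) ∧
        spectrum ℂ (NeumannCell.solutionOperator D k) = insert 0 (Set.range γ) ∧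
        (∀ g : ℂ, g ≠ 0 →
          FiniteDimensional ℂ (Module.End.maxGenEigenspace
            (NeumannCell.solutionOperator D k : NeumannCell.L20 d →ₗ[ℂ] NeumannCell.L20 d) g) ∧
          {j | γ j = g}.encard = Module.finrank ℂ (Module.End.maxGenEigenspace
            (NeumannCell.solutionOperator D k : NeumannCell.L20 d →ₗ[ℂ] NeumannCell.L20 d) g)) ∧
        -- the eigenvalues of the Neumann problem are the numbers `ν_j(k) = γ_j(k)⁻¹`
        (∀ ν : ℂ, NeumannCell.neumannEigenspace D hD k ν ≠ ⊥ ↔ ∃ j, γ j ≠ 0 ∧ ν = (γ j)⁻¹) ∧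
        -- on the positive real axis they form an infinite sequence `0 < ν_1(k) ≤ ν_2(k) ≤ …`
        (k.im = 0 → 0 < k.re → ∀ j, (γ j).im = 0 ∧ 0 < (γ j).re) := by
  have hd0 : 0 < d := by omega
  refine ⟨fun k hk => NeumannCell.exceptionalSet_subset hD hk, fun A => ?_, fun k T => ?_, fun k hk => ?_⟩
  · rw [NeumannCell.isNeumannSolution_iff, NeumannCell.invNeumannLaplacian_eq]
  · rw [NeumannCell.isFormOperator_iff hD, NeumannCell.formOperator_eq hD]
  have hT := NeumannCell.isInvertible_formOperator hD
    (NeumannCell.isInvertible_transmissionOp hd0 hD hk)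
  have hK := NeumannCell.isCompactOperator_solutionOperator D k
  have hinf := NeumannCell.not_finiteDimensional_L20 hd0
  refine ⟨hT, hK, NeumannCell.differentiableAt_solutionOperator hD hT,
    fun ν hν => NeumannCell.map_neumannEigenspace hD hT hν,
    NeumannCell.finiteDimensional_neumannEigenspace hD hT, ?_⟩
  set B : NeumannCell.L20 d →ₗ[ℂ] NeumannCell.L20 d :=
    (NeumannCell.solutionOperator D k : NeumannCell.L20 d →ₗ[ℂ] NeumannCell.L20 d) with hB
  have hm : ∀ g : ℂ, g ≠ 0 → (Module.finrank ℂ (Module.End.maxGenEigenspace B g) ≠ 0 ↔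
      Module.End.HasEigenvalue B g) := by
    intro g hg
    have := NeumannCell.finiteDimensional_maxGenEigenspace hK hg
    rw [← NeumannCell.maxGenEigenspace_ne_bot_iff, Ne, Submodule.finrank_eq_zero]
  obtain ⟨γ, hγ1, hγ2, hγ3⟩ := NeumannCell.exists_sequence_of_multiplicity
    (fun g => Module.finrank ℂ (Module.End.maxGenEigenspace B g)) fun r hr => by
      refine (NeumannCell.finite_eigenvalues hK hr).subset ?_
      rintro g ⟨h1, h2⟩
      exact ⟨h1, (hm g (norm_pos_iff.1 (hr.trans_le h1))).1 h2⟩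
  have hrange : ∀ g : ℂ, g ≠ 0 → (g ∈ Set.range γ ↔ Module.End.HasEigenvalue B g) := by
    intro g hg
    rw [← hm g hg, ← Nat.cast_ne_zero (R := ℕ∞), ← hγ3 g hg, Set.encard_ne_zero]
    rfl
  refine ⟨γ, hγ1, hγ2, ?_, fun g hg =>
    ⟨NeumannCell.finiteDimensional_maxGenEigenspace hK hg, hγ3 g hg⟩, fun ν => ?_, fun him hre => ?_⟩
  · ext g
    by_cases hg : g = 0
    · rw [hg]
      simp only [Set.mem_insert_iff, true_or, iff_true]
      exact NeumannCell.zero_mem_spectrum_of_compact hK hinf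
    · rw [Set.mem_insert_iff, or_iff_right hg, hrange g hg]
      exact (hK.hasEigenvalue_iff_mem_spectrum hg).symm
  · by_cases hν : ν = 0
    · rw [hν]
      refine iff_of_false (not_not.2 (NeumannCell.neumannEigenspace_zero hD hT)) ?_
      rintro ⟨j, hj, h⟩
      exact inv_ne_zero hj h.symm
    · rw [NeumannCell.neumannEigenspace_ne_bot_iff hD hT hν, ← hrange _ (inv_ne_zero hν)]
      constructor
      · rintro ⟨j, hj⟩
        exact ⟨j, hj ▸ inv_ne_zero hν, by rw [hj, inv_inv]⟩
      · rintro ⟨j, hj, rfl⟩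
        exact ⟨j, (inv_inv _).symm⟩
  · obtain ⟨r, rfl⟩ : ∃ r : ℝ, k = r := ⟨k.re, Complex.ext rfl (by simp [him])⟩
    rw [Complex.ofReal_re] at hre
    have hne : ∀ j, γ j ≠ 0 := by
      -- a zero in the sequence would leave only finitely many eigenvalues
      intro j hj
      obtain ⟨g, hg, hgs⟩ := NeumannCell.infinite_eigenvalues hK
        (NeumannCell.isSymmetric_solutionOperator hD hT)
        (fun f hf => NeumannCell.eq_zero_of_solutionOperator_eq_zero hD hT hf) hinf
        (insert 0 (γ '' Set.Iio j)) (((Set.finite_Iio j).image γ).insert 0)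
      rw [Set.mem_insert_iff, not_or] at hgs
      obtain ⟨i, hi⟩ := (hrange g hgs.1).2 hg
      have hij : i < j := by
        by_contra hij
        have h1 := hγ1 (not_lt.1 hij)
        simp only [hj, norm_zero] at h1
        exact hgs.1 (by rw [← hi, norm_le_zero_iff.1 h1])
      exact hgs.2 ⟨i, hij, hi⟩
    exact fun j => NeumannCell.pos_of_hasEigenvalue hD hre hT ((hrange _ (hne j)).1 ⟨j, rfl⟩)
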